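/- Let $l>0$ and let $\mathcal M$ be the space of smooth $2l$-periodic functions $\psi:\mathbb R\to\mathbb C$. For $\lambda\in\mathbb C$ let $M(x,\lambda)=N(x+2l)$, where $N'(s)=\begin{pmatrix}-i\lambda/2&\overline{\psi}(s)\\ \psi(s)&i\lambda/2\end{pmatrix}N(s)$, $N(x)=I$. Let $\Gamma=\{Q=(\lambda,w):\det(M(-l,\lambda)-wI)=0\}$ be the spectral curve, let $\mathcal X(x,Q)=e_2/e_1\in\mathbb C\cup\{\infty\}$, where $e\neq0$ and $M(x,\lambda)e=we$, be the Weyl function, and let $\Omega(Q)=\frac{w^2+1}{w^2-1}$. For $Q=(\lambda,w)\in\Gamma$ with $w^2\ne1$ (that is, $Q$ is neither a branch point nor a singular point of $\Gamma$) and $\mathcal X(x,Q)\neq\infty$, $\mathcal X(x,Q)$ is regarded as a functional of the potential near $\psi$: $\lambda$ is fixed and $w$ is continued analytically as a root of $w^2-2\Delta(\lambda)w+1=0$, $\Delta=\frac12\operatorname{tr}M(-l,\lambda)$. A bracket on $\mathcal M$ is given by bounded skew-symmetric complex bilinear forms $\Pi_\psi$ $(\psi\in\mathcal M)$ on $L^2(-l,l)\oplus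 L^2(-l,l)$ such that $t\mapsto\Pi_{\psi+t\varphi}(\xi,\eta)$ $(t\in\mathbb R)$ is continuous for all $\psi,\varphi\in\mathcal M$ and all $\xi,\eta$; one puts $$\{A,B\}(\psi)=\Pi_\psi\Big(\big(\tfrac{\delta A}{\delta\psi},\tfrac{\delta A}{\delta\overline\psi}\big),\big(\tfrac{\delta B}{\delta\psi},\tfrac{\delta B}{\delta\overline\psi}\big)\Big)$$ for functionals $A,B$ with variational derivatives in $L^2$ at $\psi$. Consider the following properties of a bracket at $\psi$. (AH) (The deformed Atiyah–Hitchin bracket.) For every $x\in\mathbb R$ and all points $Q=(\lambda,w(Q))$, $P=(\mu,w(P))$ of $\Gamma$, $\lambda\neq\mu$, that are neither branch points nor singular points of $\Gamma$ nor poles of $\mathcal X(x,\cdot)$, $$\{\mathcal X(x,Q),\mathcal X(x,P)\}=-2\,\frac{(\mathcal X(x,Q)-\mathcal X(x,P))^2}{\lambda-\mu}\cdot\frac{\Omega(Q)+\Omega(P)}2 .$$ (C) In the sense of generalized functions of $z$ and $y$ on the circle $\mathbb R/2l\mathbb Z$, $$\{\psi(z),\psi(y)\}=0,\qquad\{\overline\psi(z),\overline\psi(y)\}=0,\qquad\{\overline\psi(z),\psi(y)\}=2i\,\delta(z-y);$$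 that is, for all $f,g\in\mathcal M$ one has $\{\int f\psi,\int g\psi\}=0$, $\{\int f\overline\psi,\int g\overline\psi\}=0$ and $\{\int f\overline\psi,\int g\psi\}=2i\int fg$, with integrals over $(-l,l)$. (NLS) For all functionals $A,B$ with variational derivatives in $L^2$ at $\psi$, $$\{A,B\}(\psi)=2i\int_{-l}^{l}\Big(\frac{\delta A}{\delta\overline\psi(x)}\frac{\delta B}{\delta\psi(x)}-\frac{\delta A}{\delta\psi(x)}\frac{\delta B}{\delta\overline\psi(x)}\Big)dx .$$ Then, for every bracket on $\mathcal M$: (1) at every $\psi\in\mathcal M$ with $\psi\not\equiv0$, (AH) implies (C); (2) if (AH) holds at every $\psi\in\mathcal M$, then (C) holds at every $\psi\in\mathcal M$, including $\psi\equiv0$; (3) at every $\psi\in\mathcal M$, (C) holds if and only if (NLS) holds. -/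

import Mathlib

open MeasureTheory
open scoped ComplexConjugate ContDiff

noncomputable section

namespace NLS

/-- The phase space: all smooth `2l`-periodic complex potentials on the line. Its elements also
serve as the test functions on the circle `ℝ / 2lℤ`. -/
def phaseSpace (l : ℝ) : Submodule ℂ (ℝ → ℂ) where
  carrier := {ψ | ContDiff ℝ ∞ ψ ∧ Function.Periodic ψ (2 * l)}
  add_mem' := fun ha hb => ⟨ha.1.add hb.1, ha.2.add hb.2⟩
  zero_mem' := ⟨contDiff_const, fun _ => rfl⟩
  smul_mem' := fun c _ hf => ⟨contDiff_const.smul hf.1, hf.2.smul c⟩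

/-! ### The direct spectral problem -/

/-- The matrix `V(x, λ) = -(iλ/2) σ₃ + Y₀` of the auxiliary linear problem. -/
def V (ψ : ℝ → ℂ) (lam : ℂ) (x : ℝ) : Matrix (Fin 2) (Fin 2) ℂ :=
  !![-(Complex.I * lam / 2), conj (ψ x); ψ x, Complex.I * lam / 2]

/-- `N = M(·, y, λ)`: the matrix solution of `N' = V N` on the line with `N(y) = 1`. -/
def IsTransition (ψ : ℝ → ℂ) (y : ℝ) (lam : ℂ) (N : ℝ → Matrix (Fin 2) (Fin 2) ℂ) : Prop :=
  N y = 1 ∧ ∀ x i j, HasDerivAt (fun s => N s i j) ((V ψ lam x * N x) i j) x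

open Classical in
/-- The transition matrix `M(x, y, λ)`. (The solution of this linear initial value problem exists
and is unique for every continuous potential; the other branch is never used.) -/
def transition (ψ : ℝ → ℂ) (x y : ℝ) (lam : ℂ) : Matrix (Fin 2) (Fin 2) ℂ :=
  if h : ∃ N, IsTransition ψ y lam N then h.choose x else 0

/-- The monodromy matrix `M(x, λ) = M(x + 2l, x, λ)`. -/
def monodromy (l : ℝ) (ψ : ℝ → ℂ) (x : ℝ) (lam : ℂ) : Matrix (Fin 2) (Fin 2) ℂ :=
  transition ψ (x + 2 * l) x lam

/-- The discriminant `Δ(λ) = ½ trace M(-l, λ)`. -/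
def discriminant (l : ℝ) (ψ : ℝ → ℂ) (lam : ℂ) : ℂ :=
  (monodromy l ψ (-l) lam).trace / 2

/-- The spectral curve `Γ = {Q = (λ, w) : det (M(-l, λ) - w) = 0}`. -/
def spectralCurve (l : ℝ) (ψ : ℝ → ℂ) : Set (ℂ × ℂ) :=
  {Q | (monodromy l ψ (-l) Q.1 - Q.2 • (1 : Matrix (Fin 2) (Fin 2) ℂ)).det = 0}

/-- `Q = (λ, w)` is a branch point or a singular point of `Γ : w² - 2Δ(λ)w + 1 = 0`. Both kinds
are the points where the `w`-derivative `2w - 2Δ(λ)` vanishes, that is, the points of `Γ` with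
`w² = 1`. -/
def IsBranchOrSingular (Q : ℂ × ℂ) : Prop := Q.2 ^ 2 = 1

/-- `e` is an eigenvector of the monodromy matrix `M(x, λ)` for the eigenvalue `w`. -/
def IsFloquetVector (l : ℝ) (ψ : ℝ → ℂ) (x : ℝ) (lam w : ℂ) (e : Fin 2 → ℂ) : Prop :=
  e ≠ 0 ∧ (monodromy l ψ x lam).mulVec e = w • e

open Classical in
/-- The Weyl function `𝒳(x, Q) = e₂ / e₁` at `Q = (λ, w)`, where `e` is an eigenvector of
`M(x, λ)` with eigenvalue `w`. Away from the branch and singular points the eigenvector is unique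
up to a factor. -/
def weyl (l : ℝ) (ψ : ℝ → ℂ) (x : ℝ) (lam w : ℂ) : ℂ :=
  if h : ∃ e, IsFloquetVector l ψ x lam w e then h.choose 1 / h.choose 0 else 0

/-- `Q = (λ, w)` is a pole of `𝒳(x, ·)`, that is, `𝒳(x, Q) = ∞`: the first component of the
eigenvector vanishes. -/
def IsWeylPole (l : ℝ) (ψ : ℝ → ℂ) (x : ℝ) (Q : ℂ × ℂ) : Prop :=
  ∃ e, IsFloquetVector l ψ x Q.1 Q.2 e ∧ e 0 = 0

/-- The analytic branch near `Δ₀ = (w₀ + w₀⁻¹) / 2` of the root `w` of `w² - 2Δw + 1 = 0`, as a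
function of `Δ`, that takes the value `w₀` at `Δ₀` (for `w₀ ≠ 0`, `w₀² ≠ 1`). Here
`d₀ = (w₀ - w₀⁻¹) / 2` satisfies `d₀² = Δ₀² - 1`, and the power is the principal square root, taken
near `1`. -/
def floquetBranch (w₀ Δ : ℂ) : ℂ :=
  Δ + (w₀ - w₀⁻¹) / 2 * ((Δ ^ 2 - 1) / ((w₀ - w₀⁻¹) / 2) ^ 2) ^ (1 / 2 : ℂ)

/-- The Weyl function at `Q = (λ, w₀)` as a functional of the potential: the spectral parameter `λ`
is fixed, and the Floquet multiplier is the branch that continues `w₀`. -/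
def weylFunctional (l : ℝ) (x : ℝ) (Q : ℂ × ℂ) (ψ : phaseSpace l) : ℂ :=
  weyl l ψ x Q.1 (floquetBranch Q.2 (discriminant l ψ Q.1))

/-- `Ω(Q) = (w² + 1) / (w² - 1)`. -/
def Omega (Q : ℂ × ℂ) : ℂ := (Q.2 ^ 2 + 1) / (Q.2 ^ 2 - 1)

/-! ### Poisson brackets on the phase space -/

/-- Square integrable functions over one period. -/
abbrev L2 (l : ℝ) : Type := Lp ℂ 2 (volume.restrict (Set.Ioc (-l) l))

/-- Pairs `(δA/δψ, δA/δψ̄)`. -/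
abbrev Covector (l : ℝ) : Type := L2 l × L2 l

/-- `ξ = (δA/δψ, δA/δψ̄)` are the variational derivatives of the functional `A` at `ψ`:
`d/dt A(ψ + tφ) = ∫ (δA/δψ) φ + (δA/δψ̄) φ̄` at `t = 0`, for all directions `φ`. -/
def HasVariation {l : ℝ} (A : phaseSpace l → ℂ) (ψ : phaseSpace l) (ξ : Covector l) : Prop :=
  ∀ φ : phaseSpace l, HasDerivAt (fun t : ℝ => A (ψ + (t : ℂ) • φ))
    (∫ z in (-l)..l, (ξ.1 z * (φ : ℝ → ℂ) z + ξ.2 z * conj ((φ : ℝ → ℂ) z))) 0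

open Classical in
/-- The pair `(δA/δψ, δA/δψ̄)` of variational derivatives of `A` at `ψ` (zero if `A` has none). -/
def variation {l : ℝ} (A : phaseSpace l → ℂ) (ψ : phaseSpace l) : Covector l :=
  if h : ∃ ξ, HasVariation A ψ ξ then h.choose else 0

/-- A field of bounded skew-symmetric bilinear forms on covectors, weakly continuous along lines
in the phase space. The Jacobi identity is not imposed, so that all that is shown for such fields
holds in particular for Poisson structures. -/
structure PoissonTensor (l : ℝ) where
  /-- the bilinear form at a point of the phase space -/
  form : phaseSpace l → Covector l →L[ℂ] Covector l →L[ℂ] ℂ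
  skew : ∀ ψ ξ η, form ψ ξ η = -form ψ η ξ
  continuous_line : ∀ (ψ φ : phaseSpace l) (ξ η : Covector l),
    Continuous fun t : ℝ => form (ψ + (t : ℂ) • φ) ξ η

/-- The bracket `{A, B}` of two functionals, evaluated at `ψ`. -/
def PoissonTensor.bracket {l : ℝ} (J : PoissonTensor l) (A B : phaseSpace l → ℂ)
    (ψ : phaseSpace l) : ℂ :=
  J.form ψ (variation A ψ) (variation B ψ)

/-- The classical bracket of the nonlinear Schrödinger equation,
`{A, B} = 2i ∫ (δA/δψ̄)(δB/δψ) - (δA/δψ)(δB/δψ̄) dx` over one period. -/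
def nlsBracket {l : ℝ} (A B : phaseSpace l → ℂ) (ψ : phaseSpace l) : ℂ :=
  2 * Complex.I * ∫ z in (-l)..l,
    ((variation A ψ).2 z * (variation B ψ).1 z - (variation A ψ).1 z * (variation B ψ).2 z)

/-- The field variable `ψ(·)` as a generalized function: `f ↦ ∫ f(z) ψ(z) dz`. -/
def psiField {l : ℝ} (f ψ : phaseSpace l) : ℂ :=
  ∫ z in (-l)..l, (f : ℝ → ℂ) z * (ψ : ℝ → ℂ) z

/-- The field variable `ψ̄(·)` as a generalized function: `f ↦ ∫ f(z) ψ̄(z) dz`. -/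
def psiBarField {l : ℝ} (f ψ : phaseSpace l) : ℂ :=
  ∫ z in (-l)..l, (f : ℝ → ℂ) z * conj ((ψ : ℝ → ℂ) z)

/-- At the potential `ψ` the brackets of the Weyl function are given by the deformed
Atiyah–Hitchin formula
`{𝒳(x,Q), 𝒳(x,P)} = -2 (𝒳(x,Q) - 𝒳(x,P))² / (λ - μ) · (Ω(Q) + Ω(P)) / 2`
for all `x` and all points `Q = (λ, w(Q))`, `P = (μ, w(P))` of `Γ`, `λ ≠ μ`, that are neither
branch points nor singular points nor poles of `𝒳(x, ·)`. -/
def DeformedAH {l : ℝ} (J : PoissonTensor l) (ψ : phaseSpace l) : Prop :=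
  ∀ x : ℝ, ∀ Q ∈ spectralCurve l ψ, ∀ P ∈ spectralCurve l ψ,
    ¬ IsBranchOrSingular Q → ¬ IsBranchOrSingular P →
    ¬ IsWeylPole l ψ x Q → ¬ IsWeylPole l ψ x P → Q.1 ≠ P.1 →
    J.bracket (weylFunctional l x Q) (weylFunctional l x P) ψ =
      -2 * ((weyl l ψ x Q.1 Q.2 - weyl l ψ x P.1 P.2) ^ 2 / (Q.1 - P.1)) *
        ((Omega Q + Omega P) / 2)

/-- At the potential `ψ` the field variables satisfy `{ψ(z), ψ(y)} = 0`, `{ψ̄(z), ψ̄(y)} = 0` and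
`{ψ̄(z), ψ(y)} = 2i δ(z - y)` as generalized functions of `z` and `y` on the circle. -/
def CanonicalRelations {l : ℝ} (J : PoissonTensor l) (ψ : phaseSpace l) : Prop :=
  ∀ f g : phaseSpace l,
    J.bracket (psiField f) (psiField g) ψ = 0 ∧
    J.bracket (psiBarField f) (psiBarField g) ψ = 0 ∧
    J.bracket (psiBarField f) (psiField g) ψ =
      2 * Complex.I * ∫ z in (-l)..l, (f : ℝ → ℂ) z * (g : ℝ → ℂ) z

/-- At the potential `ψ` the bracket is the classical one on all functionals that have variational
derivatives there. -/
def IsNLSBracketAt {l : ℝ} (J : PoissonTensor l) (ψ : phaseSpace l) : Prop :=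
  ∀ A B : phaseSpace l → ℂ, (∃ ξ, HasVariation A ψ ξ) → (∃ η, HasVariation B ψ η) →
    J.bracket A B ψ = nlsBracket A B ψ

end NLS

end

noncomputable section

namespace NLS

/-! ### Linear systems with trace-free coefficients -/

/-! The bracket is compared with the canonical form 2i ∫ (ξ₂η₁ − ξ₁η₂) on a family of covectors that
is large enough to determine a bounded form.

At x = −l the Weyl function is the slope v(−l) of a Floquet solution (u, v) with u(−l) = 1, and its
variational derivative is (w² − 1)⁻¹ (u², −v²) (`hasVariation_weylFunctional`). For Floquet
solutions (u, v) at λ and (u', v') at μ the canonical integrand is, up to constants, (uv' − vu')(uv'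
+ vu'). This is a multiple of the derivative of the squared Wronskian, so the integral is a boundary
term. The multipliers evaluate it, and the result is exactly the deformed Atiyah–Hitchin expression
(`canonicalForm_squareCovector`). Hence (AH) makes the two forms agree on squared Floquet covectors
with λ ≠ μ.

The analytic core is completeness of these covectors (`ae_eq_zero_of_orthogonal`,
`eq_zero_of_squareCovectors`). Let (f, g) be orthogonal to the squared decaying Floquet solutions,
and pair it over [−l, z₀] with products of solutions normalized at z₀. This is an entire function of
λ. For large |Im λ| each solution splits into a growing one and the decaying Floquet one.
Orthogonality moves the decaying part of the integral to the other side of z₀, where it is small,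
and the pairing is bounded by a quantity that tends to 0 (`norm_integral_pairForm_le`). By Liouville
the pairing vanishes identically. Differentiation in z₀ at λ = 0 gives f = g = 0. Completeness in
each argument, together with skew-symmetry, identifies the forms (`form_eq_of_deformedAH`).

Finite Weyl functions require M₁₂(λ) ≠ 0. If M₁₂ vanished for every λ, a second Liouville argument
would force ψ = 0 (`eq_zero_of_transition_offdiag_eq_zero`). At ψ = 0 the form is a limit along a
line of nonzero potentials. Finally, the covectors of the field variables are also complete, so (C)
already determines the form (`form_eq_of_canonicalRelations`). -/

/-- A bounded continuous linear equation has a global solution for every initial value. -/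
theorem exists_linear_ode {E : Type*} [NormedAddCommGroup E] [NormedSpace ℝ E] [CompleteSpace E]
    (A : ℝ → E →L[ℝ] E) (hA : Continuous A) (K : ℝ) (hK : ∀ z, ‖A z‖ ≤ K) (y : ℝ) (u₀ : E) :
    ∃ u : ℝ → E, u y = u₀ ∧ ∀ z, HasDerivAt u (A z (u z)) z := by
  have hK0 : 0 ≤ K := (norm_nonneg _).trans (hK 0)
  -- The solution is sought as exp(c|z − y|) v with v bounded. In this weighted norm the integral
  -- operator has Lipschitz constant K/c ≤ 1/2 on the whole line at once, so no gluing of local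
  -- solutions is needed.
  set c : ℝ := 2 * K + 1 with hc
  have hc0 : 0 < c := by positivity
  -- the weighted Picard operator
  have hcont : ∀ v : BoundedContinuousFunction ℝ E,
      Continuous fun s => A s (Real.exp (c * |s - y|) • v s) := fun v =>
    hA.clm_apply ((by fun_prop : Continuous fun s => Real.exp (c * |s - y|)).smul v.continuous)
  have hbound : ∀ (C : ℝ) (f : ℝ → E), 0 ≤ C → Continuous f →
      (∀ s, ‖f s‖ ≤ C * Real.exp (c * |s - y|)) →
      ∀ z, ‖∫ s in y..z, f s‖ ≤ C / c * Real.exp (c * |z - y|) := by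
    intro C f hC hf hfb z
    have key : ∀ r : ℝ, 0 ≤ r → (∫ s in (0:ℝ)..r, C * Real.exp (c * s)) ≤ C / c * Real.exp (c * r) := by
      intro r hr
      have : ∀ s ∈ Set.uIcc 0 r, HasDerivAt (fun s => C / c * Real.exp (c * s))
          (C * Real.exp (c * s)) s := by
        intro s _
        have := (((hasDerivAt_id s).const_mul c).exp).const_mul (C / c)
        refine this.congr_deriv ?_
        simp; field_simp
      rw [intervalIntegral.integral_eq_sub_of_hasDerivAt this
        (Continuous.intervalIntegrable (by fun_prop) _ _)]
      have : 0 ≤ C / c * Real.exp (c * 0) := by positivity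
      linarith
    rcases le_total y z with h | h
    · calc ‖∫ s in y..z, f s‖ ≤ ∫ s in y..z, C * Real.exp (c * (s - y)) := by
            refine intervalIntegral.norm_integral_le_of_norm_le h (Filter.Eventually.of_forall ?_)
              (Continuous.intervalIntegrable (by fun_prop) _ _)
            intro s hs
            have := hfb s
            rwa [abs_of_nonneg (by linarith [hs.1])] at this
        _ = ∫ s in (0:ℝ)..(z - y), C * Real.exp (c * s) := by
            rw [intervalIntegral.integral_comp_sub_right (fun s => C * Real.exp (c * s))]; simp
        _ ≤ _ := by
            rw [abs_of_nonneg (by linarith)]; exact key _ (by linarith)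
    · rw [intervalIntegral.integral_symm, norm_neg]
      calc ‖∫ s in z..y, f s‖ ≤ ∫ s in z..y, C * Real.exp (c * (y - s)) := by
            refine intervalIntegral.norm_integral_le_of_norm_le h (Filter.Eventually.of_forall ?_)
              (Continuous.intervalIntegrable (by fun_prop) _ _)
            intro s hs
            have := hfb s
            rwa [abs_of_nonpos (by linarith [hs.2]), neg_sub] at this
        _ = ∫ s in (0:ℝ)..(y - z), C * Real.exp (c * s) := by
            rw [intervalIntegral.integral_comp_sub_left (fun s => C * Real.exp (c * s))]; simp
        _ ≤ _ := by
            rw [abs_of_nonpos (by linarith), neg_sub]; exact key _ (by linarith)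
  have hest : ∀ v : BoundedContinuousFunction ℝ E, ∀ s,
      ‖A s (Real.exp (c * |s - y|) • v s)‖ ≤ K * ‖v‖ * Real.exp (c * |s - y|) := by
    intro v s
    calc _ ≤ ‖A s‖ * ‖Real.exp (c * |s - y|) • v s‖ := (A s).le_opNorm _
      _ ≤ K * (Real.exp (c * |s - y|) * ‖v‖) := by
          rw [norm_smul, Real.norm_of_nonneg (Real.exp_pos _).le]
          gcongr
          · exact hK s
          · exact v.norm_coe_le_norm s
      _ = _ := by ring
  have hint : ∀ (v : BoundedContinuousFunction ℝ E) (a b : ℝ), IntervalIntegrable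
      (fun s => A s (Real.exp (c * |s - y|) • v s)) volume a b := fun v a b =>
    (hcont v).intervalIntegrable a b
  have hexp : ∀ z, Real.exp (-(c * |z - y|)) * Real.exp (c * |z - y|) = 1 := fun z => by
    rw [← Real.exp_add]; simp
  let T : BoundedContinuousFunction ℝ E → BoundedContinuousFunction ℝ E := fun v =>
    BoundedContinuousFunction.ofNormedAddCommGroup
      (fun z => Real.exp (-(c * |z - y|)) • (u₀ + ∫ s in y..z, A s (Real.exp (c * |s - y|) • v s)))
      ((by fun_prop : Continuous fun z => Real.exp (-(c * |z - y|))).smul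
        (continuous_const.add (intervalIntegral.continuous_primitive (hint v) y)))
      (‖u₀‖ + K * ‖v‖ / c) (by
        intro z
        rw [norm_smul, Real.norm_of_nonneg (Real.exp_pos _).le]
        have h1 := hbound (K * ‖v‖) _ (by positivity) (hcont v) (hest v) z
        have h2 : Real.exp (-(c * |z - y|)) ≤ 1 := Real.exp_le_one_iff.2 (by
          have : 0 ≤ c * |z - y| := by positivity
          linarith)
        calc _ ≤ Real.exp (-(c * |z - y|)) * (‖u₀‖ + K * ‖v‖ / c * Real.exp (c * |z - y|)) := by
              gcongr
              exact (norm_add_le _ _).trans (by gcongr)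
          _ = Real.exp (-(c * |z - y|)) * ‖u₀‖ + K * ‖v‖ / c := by
              rw [mul_add, mul_left_comm, hexp, mul_one]
          _ ≤ _ := by
              have := mul_le_mul_of_nonneg_right h2 (norm_nonneg u₀)
              linarith)
  have hT : ContractingWith (1 / 2) T := by
    refine ⟨by rw [← NNReal.coe_lt_coe]; norm_num, LipschitzWith.of_dist_le_mul fun v w => ?_⟩
    rw [BoundedContinuousFunction.dist_le (by positivity)]
    intro z
    rw [dist_eq_norm, dist_eq_norm]
    have e1 : T v z - T w z = Real.exp (-(c * |z - y|)) •
        ∫ s in y..z, A s (Real.exp (c * |s - y|) • (v - w) s) := by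
      change Real.exp (-(c * |z - y|)) • (u₀ + ∫ s in y..z, A s (Real.exp (c * |s - y|) • v s)) -
        Real.exp (-(c * |z - y|)) • (u₀ + ∫ s in y..z, A s (Real.exp (c * |s - y|) • w s)) = _
      rw [← smul_sub, add_sub_add_left_eq_sub, ← intervalIntegral.integral_sub (hint v _ _) (hint w _ _)]
      congr 1
      refine intervalIntegral.integral_congr fun s _ => ?_
      simp only [BoundedContinuousFunction.coe_sub, Pi.sub_apply, smul_sub, map_sub]
    rw [e1, norm_smul, Real.norm_of_nonneg (Real.exp_pos _).le]
    have h1 := hbound (K * ‖v - w‖) _ (by positivity) (hcont (v - w)) (hest (v - w)) z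
    calc _ ≤ Real.exp (-(c * |z - y|)) * (K * ‖v - w‖ / c * Real.exp (c * |z - y|)) := by gcongr
      _ = K / c * ‖v - w‖ := by
          rw [mul_left_comm, hexp, mul_one]; ring
      _ ≤ _ := by
          gcongr
          rw [div_le_iff₀ hc0, hc]
          push_cast
          linarith
  obtain ⟨v, hv, -⟩ := hT.exists_fixedPoint 0 (edist_ne_top _ _)
  have hv' : ∀ z, Real.exp (c * |z - y|) • v z =
      u₀ + ∫ s in y..z, A s (Real.exp (c * |s - y|) • v s) := by
    intro z
    have h : v z = Real.exp (-(c * |z - y|)) •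
        (u₀ + ∫ s in y..z, A s (Real.exp (c * |s - y|) • v s)) := by
      conv_lhs => rw [← hv.eq]
      rfl
    conv_lhs => rw [h]
    rw [smul_smul, mul_comm, hexp, one_smul]
  refine ⟨fun z => Real.exp (c * |z - y|) • v z, by simpa using hv' y, fun z => ?_⟩
  have h := ((hcont v).integral_hasStrictDerivAt y z).hasDerivAt.const_add u₀
  exact h.congr_of_eventuallyEq (Filter.Eventually.of_forall hv')

/-- `(u, v)` solves `u' = a u + b v`, `v' = c u - a v` on the line. -/
structure IsSol (a b c u v : ℝ → ℂ) : Prop where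
  left : ∀ z, HasDerivAt u (a z * u z + b z * v z) z
  right : ∀ z, HasDerivAt v (c z * u z - a z * v z) z

namespace IsSol

variable {a b c u v u' v' : ℝ → ℂ}

theorem continuous_left (h : IsSol a b c u v) : Continuous u :=
  continuous_iff_continuousAt.2 fun z => (h.left z).continuousAt

theorem continuous_right (h : IsSol a b c u v) : Continuous v :=
  continuous_iff_continuousAt.2 fun z => (h.right z).continuousAt

theorem linear_comb (h : IsSol a b c u v) (h' : IsSol a b c u' v') (α β : ℂ) :
    IsSol a b c (fun z => α * u z + β * u' z) (fun z => α * v z + β * v' z) where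
  left z := (((h.left z).const_mul α).add ((h'.left z).const_mul β)).congr_deriv (by ring)
  right z := (((h.right z).const_mul α).add ((h'.right z).const_mul β)).congr_deriv (by ring)

/-- This symmetry reverses the sign of the diagonal coefficient; it later transfers every estimate
from the upper to the lower half plane of λ. -/
theorem swap (h : IsSol a b c u v) : IsSol (fun z => -a z) c b v u where
  left z := (h.right z).congr_deriv (by ring)
  right z := (h.left z).congr_deriv (by ring)

/-- Variation of the Wronskian of solutions of two different systems. -/
theorem hasDerivAt_wronskian {a' b' c' : ℝ → ℂ} (h : IsSol a b c u v) (h' : IsSol a' b' c' u' v')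
    (z : ℝ) : HasDerivAt (fun z => u z * v' z - v z * u' z)
      (u z * ((c' z - c z) * u' z - (a' z - a z) * v' z) -
        v z * ((a' z - a z) * u' z + (b' z - b z) * v' z)) z :=
  (((h.left z).mul (h'.right z)).sub ((h.right z).mul (h'.left z))).congr_deriv (by ring)

theorem wronskian_eq (h : IsSol a b c u v) (h' : IsSol a b c u' v') (z y : ℝ) :
    u z * v' z - v z * u' z = u y * v' y - v y * u' y := by
  refine is_const_of_deriv_eq_zero (f := fun z => u z * v' z - v z * u' z)
    (fun z => (h.hasDerivAt_wronskian h' z).differentiableAt) (fun z => ?_) z y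
  rw [(h.hasDerivAt_wronskian h' z).deriv]
  ring

/-- A solution is the combination of the fundamental system with its values at a point. -/
theorem eq_comb {p q r s : ℝ → ℂ} {y : ℝ} (h1 : IsSol a b c p q) (h2 : IsSol a b c r s)
    (hp : p y = 1) (hq : q y = 0) (hr : r y = 0) (hs : s y = 1) (h : IsSol a b c u v) (z : ℝ) :
    u z = u y * p z + v y * r z ∧ v z = u y * q z + v y * s z := by
  -- Cramer's rule: the fundamental system has Wronskian 1, and its Wronskians with the given
  -- solution are the coordinates, up to sign.
  have e := h1.wronskian_eq h2 z y
  have e1 := h1.wronskian_eq h z y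
  have e2 := h2.wronskian_eq h z y
  rw [hp, hq, hr, hs] at e
  rw [hp, hq] at e1
  rw [hr, hs] at e2
  constructor
  · linear_combination (-u z) * e + r z * e1 - p z * e2
  · linear_combination (-v z) * e + s z * e1 - q z * e2

end IsSol

theorem exists_isSol {a b c : ℝ → ℂ} (ha : Continuous a) (hb : Continuous b) (hc : Continuous c)
    {K : ℝ} (hK : ∀ z, ‖a z‖ ≤ K ∧ ‖b z‖ ≤ K ∧ ‖c z‖ ≤ K) (y : ℝ) (α β : ℂ) :
    ∃ u v, IsSol a b c u v ∧ u y = α ∧ v y = β := by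
  let F := ContinuousLinearMap.fst ℝ ℂ ℂ
  let S := ContinuousLinearMap.snd ℝ ℂ ℂ
  let I₁ := ContinuousLinearMap.inl ℝ ℂ ℂ
  let I₂ := ContinuousLinearMap.inr ℝ ℂ ℂ
  let m : ℂ → ℂ →L[ℝ] ℂ := fun x => ContinuousLinearMap.mul ℝ ℂ x
  let A : ℝ → (ℂ × ℂ) →L[ℝ] (ℂ × ℂ) := fun z =>
    (((m (a z)).comp F + (m (b z)).comp S).prod ((m (c z)).comp F - (m (a z)).comp S))
  have hm : Continuous m := (ContinuousLinearMap.mul ℝ ℂ).continuous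
  have hA : Continuous A := by
    have e : A = fun z => I₁.comp ((m (a z)).comp F + (m (b z)).comp S) +
        I₂.comp ((m (c z)).comp F - (m (a z)).comp S) := by
      ext z x <;> simp [A, I₁, I₂]
    rw [e]
    have h1 := (hm.comp ha).clm_comp (continuous_const (y := F))
    have h2 := (hm.comp ha).clm_comp (continuous_const (y := S))
    have h3 := (hm.comp hb).clm_comp (continuous_const (y := S))
    have h4 := (hm.comp hc).clm_comp (continuous_const (y := F))
    exact ((continuous_const (y := I₁)).clm_comp (h1.add h3)).add
      ((continuous_const (y := I₂)).clm_comp (h4.sub h2))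
  have hAb : ∀ z, ‖A z‖ ≤ 2 * K := by
    intro z
    obtain ⟨h1, h2, h3⟩ := hK z
    have hK0 : 0 ≤ K := (norm_nonneg _).trans h1
    refine ContinuousLinearMap.opNorm_le_bound _ (by positivity) fun x => ?_
    have e : A z x = (a z * x.1 + b z * x.2, c z * x.1 - a z * x.2) := rfl
    have hx1 := norm_fst_le x
    have hx2 := norm_snd_le x
    have aux : ∀ p q : ℂ, ‖p‖ ≤ K → ‖q‖ ≤ K → ‖p * x.1‖ + ‖q * x.2‖ ≤ 2 * K * ‖x‖ := by
      intro p q hp hq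
      rw [norm_mul, norm_mul]
      have := mul_le_mul hp hx1 (norm_nonneg _) hK0
      have := mul_le_mul hq hx2 (norm_nonneg _) hK0
      linarith
    rw [e, Prod.norm_def]
    exact max_le ((norm_add_le _ _).trans (aux _ _ h1 h2)) ((norm_sub_le _ _).trans (aux _ _ h3 h1))
  obtain ⟨x, hx, hd⟩ := exists_linear_ode A hA _ hAb y (α, β)
  refine ⟨fun z => (x z).1, fun z => (x z).2, ⟨fun z => ?_, fun z => ?_⟩, by simp [hx], by simp [hx]⟩
  · exact (hd z).fst
  · exact (hd z).snd

/-! ### Growth of solutions -/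

/-- A differential inequality `G' ≥ m G` on an interval, integrated. -/
theorem exp_mul_le_of_hasDerivAt {G G' : ℝ → ℝ} {m x y : ℝ} (hxy : x ≤ y)
    (hG : ∀ z, HasDerivAt G (G' z) z) (h : ∀ z ∈ Set.Icc x y, m * G z ≤ G' z) :
    Real.exp (m * (y - x)) * G x ≤ G y := by
  have hd : ∀ z, HasDerivAt (fun z => Real.exp (m * (y - z)) * G z)
      (Real.exp (m * (y - z)) * (G' z - m * G z)) z := fun z => by
    have h1 := ((((hasDerivAt_id z).const_sub y).const_mul m).exp).mul (hG z)
    refine h1.congr_deriv ?_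
    simp only [id]; ring
  have hm : MonotoneOn (fun z => Real.exp (m * (y - z)) * G z) (Set.Icc x y) := by
    refine monotoneOn_of_deriv_nonneg (convex_Icc x y)
      (fun z _ => (hd z).continuousAt.continuousWithinAt)
      (fun z _ => (hd z).differentiableAt.differentiableWithinAt) fun z hz => ?_
    rw [(hd z).deriv]
    have := h z (interior_subset hz)
    exact mul_nonneg (Real.exp_pos _).le (by linarith)
  simpa using hm (Set.left_mem_Icc.2 hxy) (Set.right_mem_Icc.2 hxy) hxy

theorem abs_re_conj_mul_le {b x y : ℂ} {K : ℝ} (hb : ‖b‖ ≤ K) :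
    |(conj x * (b * y)).re| ≤ K * (‖x‖ * ‖y‖) := by
  refine (Complex.abs_re_le_norm _).trans ?_
  rw [norm_mul, norm_mul, RCLike.norm_conj]
  have := mul_le_mul_of_nonneg_right hb (mul_nonneg (norm_nonneg x) (norm_nonneg y))
  linarith

namespace IsSol

variable {a b c u v u' v' : ℝ → ℂ}

theorem hasDerivAt_norm_sq_left (h : IsSol a b c u v) (z : ℝ) : HasDerivAt (fun z => ‖u z‖ ^ 2)
    (2 * ((a z).re * ‖u z‖ ^ 2 + (conj (u z) * (b z * v z)).re)) z := by
  refine (h.left z).norm_sq.congr_deriv ?_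
  have e : (a z * u z + b z * v z) * conj (u z) =
      a z * ((‖u z‖ ^ 2 : ℝ) : ℂ) + conj (u z) * (b z * v z) := by
    rw [Complex.ofReal_pow, ← Complex.mul_conj']
    ring
  rw [Complex.inner, e, Complex.add_re, Complex.re_mul_ofReal]

theorem hasDerivAt_norm_sq_right (h : IsSol a b c u v) (z : ℝ) : HasDerivAt (fun z => ‖v z‖ ^ 2)
    (2 * (-(a z).re * ‖v z‖ ^ 2 + (conj (v z) * (c z * u z)).re)) z := by
  simpa using h.swap.hasDerivAt_norm_sq_left z

/-- Gronwall for the full norm in both directions of z. It is crude, but it involves the diagonal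
coefficient only through its real part, so it is uniform on horizontal strips of λ. -/
theorem norm_sq_add_le (h : IsSol a b c u v) {P K : ℝ} (ha : ∀ z, |(a z).re| ≤ P)
    (hb : ∀ z, ‖b z‖ ≤ K) (hc : ∀ z, ‖c z‖ ≤ K) (y z : ℝ) :
    ‖u z‖ ^ 2 + ‖v z‖ ^ 2 ≤ Real.exp (2 * (P + K) * |z - y|) * (‖u y‖ ^ 2 + ‖v y‖ ^ 2) := by
  have hd := fun s => (h.hasDerivAt_norm_sq_left s).add (h.hasDerivAt_norm_sq_right s)
  have hbd : ∀ s, |2 * ((a s).re * ‖u s‖ ^ 2 + (conj (u s) * (b s * v s)).re) +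
      2 * (-(a s).re * ‖v s‖ ^ 2 + (conj (v s) * (c s * u s)).re)| ≤
      2 * (P + K) * (‖u s‖ ^ 2 + ‖v s‖ ^ 2) := by
    intro s
    have h1 := abs_le.1 (abs_re_conj_mul_le (x := u s) (y := v s) (hb s))
    have h2 := abs_le.1 (abs_re_conj_mul_le (x := v s) (y := u s) (hc s))
    have h3 := abs_le.1 (ha s)
    have hK : 0 ≤ K := (norm_nonneg _).trans (hb s)
    have h4 := mul_nonneg hK (sq_nonneg (‖u s‖ - ‖v s‖))
    have h5 := mul_le_mul_of_nonneg_right h3.2 (sq_nonneg ‖u s‖)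
    have h6 := mul_le_mul_of_nonneg_right h3.2 (sq_nonneg ‖v s‖)
    have h7 := mul_le_mul_of_nonneg_right h3.1 (sq_nonneg ‖u s‖)
    have h8 := mul_le_mul_of_nonneg_right h3.1 (sq_nonneg ‖v s‖)
    rw [abs_le]
    constructor <;> nlinarith
  rcases le_total y z with hyz | hyz
  -- The integrated inequality bounds from below; an upper bound to the right comes from applying it
  -- to the negative of the norm.
  · have := exp_mul_le_of_hasDerivAt (m := 2 * (P + K)) hyz (fun s => (hd s).neg) fun s _ => by
      have := (abs_le.1 (hbd s)).2
      simp only [Pi.neg_apply, Pi.add_apply]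
      linarith
    simp only [Pi.neg_apply, Pi.add_apply] at this
    rw [abs_of_nonneg (by linarith)]
    linarith
  · have := exp_mul_le_of_hasDerivAt (m := -(2 * (P + K))) hyz hd fun s _ => by
      have := (abs_le.1 (hbd s)).1
      simp only [Pi.add_apply]
      linarith
    simp only [Pi.add_apply] at this
    rw [abs_of_nonpos (by linarith), neg_sub]
    have h1 : Real.exp (2 * (P + K) * (y - z)) * Real.exp (-(2 * (P + K)) * (y - z)) = 1 := by
      rw [← Real.exp_add]; simp
    have h2 := mul_le_mul_of_nonneg_left this (Real.exp_pos (2 * (P + K) * (y - z))).le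
    rw [← mul_assoc, h1, one_mul] at h2
    exact h2

/-! ### Invariant cones and exponential rates for a large diagonal coefficient -/

section Cone

variable {k : ℂ} {ψ : ℝ → ℂ} {K δ x y : ℝ}

/-- The off-diagonal part of the system is Hermitian, so both squared norms receive the same
coupling term. It therefore enters with the factor α − β and drops out for α = β. -/
theorem hasDerivAt_weighted (h : IsSol (fun _ => k) (fun z => conj (ψ z)) ψ u v) (α β z : ℝ) :
    HasDerivAt (fun z => α * ‖u z‖ ^ 2 - β * ‖v z‖ ^ 2)
      (2 * k.re * (α * ‖u z‖ ^ 2 + β * ‖v z‖ ^ 2) +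
        2 * (α - β) * (conj (u z) * (conj (ψ z) * v z)).re) z := by
  have h1 := ((h.hasDerivAt_norm_sq_left z).const_mul α).sub
    ((h.hasDerivAt_norm_sq_right z).const_mul β)
  refine h1.congr_deriv ?_
  have : (conj (v z) * (ψ z * u z)).re = (conj (u z) * (conj (ψ z) * v z)).re := by
    rw [← Complex.conj_re]
    congr 1
    simp only [map_mul, Complex.conj_conj]
    ring
  rw [this]
  ring

/-- The coupling is at most 2δ Re k · |u||v|. This is exactly what completes the square: the two
derivatives dominate 2 Re k · (δ|u| − |v|)² and 2 Re k · (|u| − δ|v|)². -/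
theorem weighted_mono (h : IsSol (fun _ => k) (fun z => conj (ψ z)) ψ u v) (hψ : ∀ z, ‖ψ z‖ ≤ K)
    (hk : K ≤ 2 * δ * k.re) (hδ : 0 < δ) (hδ1 : δ ≤ 1) (hxy : x ≤ y) :
    δ ^ 2 * ‖u x‖ ^ 2 - ‖v x‖ ^ 2 ≤ δ ^ 2 * ‖u y‖ ^ 2 - ‖v y‖ ^ 2 ∧
      ‖u x‖ ^ 2 - δ ^ 2 * ‖v x‖ ^ 2 ≤ ‖u y‖ ^ 2 - δ ^ 2 * ‖v y‖ ^ 2 := by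
  have hK : 0 ≤ K := (norm_nonneg _).trans (hψ 0)
  have hp : 0 ≤ k.re := by
    by_contra hneg
    nlinarith
  have hre : ∀ z, |(conj (u z) * (conj (ψ z) * v z)).re| ≤ 2 * δ * k.re * (‖u z‖ * ‖v z‖) :=
    fun z => abs_re_conj_mul_le (by rw [RCLike.norm_conj]; exact (hψ z).trans hk)
  have hsq : δ ^ 2 ≤ 1 := by nlinarith
  have haux : ∀ r s t : ℝ, 0 ≤ r → 0 ≤ s → |t| ≤ 2 * δ * k.re * (r * s) →
      |(1 - δ ^ 2) * t| ≤ 2 * δ * k.re * (r * s) := by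
    intro r s t hr hs ht
    rw [abs_mul, abs_of_nonneg (by linarith)]
    have : 0 ≤ δ ^ 2 * |t| := by positivity
    nlinarith
  constructor
  · have := exp_mul_le_of_hasDerivAt (m := 0) hxy (h.hasDerivAt_weighted (δ ^ 2) 1) fun z _ => by
      have h1 := abs_le.1 (haux _ _ _ (norm_nonneg (u z)) (norm_nonneg (v z)) (hre z))
      have h2 := mul_nonneg hp (sq_nonneg (δ * ‖u z‖ - ‖v z‖))
      nlinarith
    simpa using this
  · have := exp_mul_le_of_hasDerivAt (m := 0) hxy (h.hasDerivAt_weighted 1 (δ ^ 2)) fun z _ => by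
      have h1 := abs_le.1 (haux _ _ _ (norm_nonneg (u z)) (norm_nonneg (v z)) (hre z))
      have h2 := mul_nonneg hp (sq_nonneg (‖u z‖ - δ * ‖v z‖))
      nlinarith
    simpa using this

/-- The cone around the growing direction is invariant to the right. -/
theorem norm_right_le (h : IsSol (fun _ => k) (fun z => conj (ψ z)) ψ u v) (hψ : ∀ z, ‖ψ z‖ ≤ K)
    (hk : K ≤ 2 * δ * k.re) (hδ : 0 < δ) (hδ1 : δ ≤ 1) (hxy : x ≤ y) (hx : ‖v x‖ ≤ δ * ‖u x‖) :
    ‖v y‖ ≤ δ * ‖u y‖ := by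
  have h1 := (h.weighted_mono hψ hk hδ hδ1 hxy).1
  refine le_of_sq_le_sq ?_ (by positivity)
  have := pow_le_pow_left₀ (norm_nonneg _) hx 2
  rw [mul_pow] at this ⊢
  linarith

/-- Floquet solutions that decay to the right stay in the cone around the decaying direction. -/
theorem norm_left_le_of_floquet (h : IsSol (fun _ => k) (fun z => conj (ψ z)) ψ u v)
    (hψ : ∀ z, ‖ψ z‖ ≤ K) (hk : K ≤ 2 * δ * k.re) (hδ : 0 < δ) (hδ1 : δ ≤ 1) {w : ℂ}
    (hw : ‖w‖ < 1) (hu : u y = w * u x) (hv : v y = w * v x) {z : ℝ} (hz : z ∈ Set.Icc x y) :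
    ‖u z‖ ≤ δ * ‖v z‖ := by
  have h1 := (h.weighted_mono hψ hk hδ hδ1 (hz.1.trans hz.2)).2
  have h2 := (h.weighted_mono hψ hk hδ hδ1 hz.2).2
  rw [hu, hv, norm_mul, norm_mul] at h1 h2
  have h3 : ‖w‖ ^ 2 < 1 := by nlinarith [norm_nonneg w]
  -- Over the period the monotone quantity is multiplied by |w|² < 1 and yet does not decrease, so
  -- it is nonpositive at both ends, hence throughout.
  have h4 : ‖u x‖ ^ 2 - δ ^ 2 * ‖v x‖ ^ 2 ≤ 0 := by nlinarith
  refine le_of_sq_le_sq ?_ (by positivity)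
  nlinarith [mul_nonneg (sq_nonneg ‖w‖) (neg_nonneg.2 h4)]

/-- Inside the cone |v| ≤ |u| the coupling costs at most K|u|², so |u| grows at rate at least Re k −
K. -/
theorem exp_mul_norm_sq_left_le (h : IsSol (fun _ => k) (fun z => conj (ψ z)) ψ u v)
    (hψ : ∀ z, ‖ψ z‖ ≤ K) (hxy : x ≤ y) (hc : ∀ z ∈ Set.Icc x y, ‖v z‖ ≤ ‖u z‖) :
    Real.exp (2 * (k.re - K) * (y - x)) * ‖u x‖ ^ 2 ≤ ‖u y‖ ^ 2 := by
  refine exp_mul_le_of_hasDerivAt hxy h.hasDerivAt_norm_sq_left fun z hz => ?_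
  have hK : 0 ≤ K := (norm_nonneg _).trans (hψ 0)
  have h1 := abs_le.1 (abs_re_conj_mul_le (b := conj (ψ z)) (x := u z) (y := v z) (K := K)
    (by rw [RCLike.norm_conj]; exact hψ z))
  have h2 := mul_le_mul_of_nonneg_left (hc z hz) (mul_nonneg hK (norm_nonneg (u z)))
  nlinarith

theorem exp_mul_norm_sq_right_le (h : IsSol (fun _ => k) (fun z => conj (ψ z)) ψ u v)
    (hψ : ∀ z, ‖ψ z‖ ≤ K) (hxy : x ≤ y) (hc : ∀ z ∈ Set.Icc x y, ‖u z‖ ≤ ‖v z‖) :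
    Real.exp (2 * (k.re - K) * (y - x)) * ‖v y‖ ^ 2 ≤ ‖v x‖ ^ 2 := by
  have hK : 0 ≤ K := (norm_nonneg _).trans (hψ 0)
  have := exp_mul_le_of_hasDerivAt (m := -(2 * (k.re - K))) hxy
    (fun z => (h.hasDerivAt_norm_sq_right z).neg) fun z hz => by
      have h1 := abs_le.1 (abs_re_conj_mul_le (x := v z) (y := u z) (hψ z))
      have h2 := mul_le_mul_of_nonneg_left (hc z hz) (mul_nonneg hK (norm_nonneg (v z)))
      simp only [Pi.neg_apply]
      nlinarith
  simp only [Pi.neg_apply] at this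
  have h1 : Real.exp (2 * (k.re - K) * (y - x)) * Real.exp (-(2 * (k.re - K)) * (y - x)) = 1 := by
    rw [← Real.exp_add]; simp
  have h2 := mul_le_mul_of_nonneg_left this (Real.exp_pos (2 * (k.re - K) * (y - x))).le
  have h3 : Real.exp (2 * (k.re - K) * (y - x)) *
      (Real.exp (-(2 * (k.re - K)) * (y - x)) * -‖v x‖ ^ 2) = -‖v x‖ ^ 2 := by
    rw [← mul_assoc, h1, one_mul]
  linarith

/-- The indefinite form `|u|² - |v|²` is strictly increasing along nonzero solutions. -/
theorem norm_sq_sub_lt (h : IsSol (fun _ => k) (fun z => conj (ψ z)) ψ u v) (hk : 0 < k.re)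
    (hxy : x < y) (hne : ∀ z, u z ≠ 0 ∨ v z ≠ 0) :
    ‖u x‖ ^ 2 - ‖v x‖ ^ 2 < ‖u y‖ ^ 2 - ‖v y‖ ^ 2 := by
  have hm : StrictMono fun z => 1 * ‖u z‖ ^ 2 - 1 * ‖v z‖ ^ 2 := by
    refine strictMono_of_deriv_pos fun z => ?_
    rw [(h.hasDerivAt_weighted 1 1 z).deriv]
    have : 0 < ‖u z‖ ^ 2 + ‖v z‖ ^ 2 := by
      rcases hne z with h0 | h0
      · have := norm_pos_iff.2 h0
        positivity
      · have := norm_pos_iff.2 h0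
        positivity
    have := mul_pos hk this
    simp only [sub_self, mul_zero, zero_mul, add_zero, one_mul]
    linarith
  simpa using hm hxy

end Cone

end IsSol

/-! ### Dependence on a parameter -/

/-- The Wronskian of `(p, q)` with the image of `(u, v)` under `!![a, b; c, -a]`. -/
def perturbForm (a b c p q u v : ℝ → ℂ) (t : ℝ) : ℂ :=
  p t * (c t * u t - a t * v t) - q t * (a t * u t + b t * v t)

theorem norm_perturbForm_le {a b c p q u v : ℝ → ℂ} {t K C D : ℝ}
    (ha : ‖a t‖ ≤ K) (hb : ‖b t‖ ≤ K) (hc : ‖c t‖ ≤ K) (hp : ‖p t‖ ≤ C) (hq : ‖q t‖ ≤ C)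
    (hu : ‖u t‖ ≤ D) (hv : ‖v t‖ ≤ D) : ‖perturbForm a b c p q u v t‖ ≤ 4 * (C * (K * D)) := by
  have hK : 0 ≤ K := (norm_nonneg _).trans ha
  have hC : 0 ≤ C := (norm_nonneg _).trans hp
  have aux : ∀ {x y r : ℂ}, ‖x‖ ≤ K → ‖y‖ ≤ D → ‖r‖ ≤ C → ‖r * (x * y)‖ ≤ C * (K * D) := by
    intro x y r hx hy hr
    rw [norm_mul, norm_mul]
    gcongr
  have e : perturbForm a b c p q u v t = p t * (c t * u t) - p t * (a t * v t) -
      (q t * (a t * u t) + q t * (b t * v t)) := by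
    rw [perturbForm]; ring
  rw [e]
  refine (norm_sub_le _ _).trans ?_
  have h1 := norm_sub_le (p t * (c t * u t)) (p t * (a t * v t))
  have h2 := norm_add_le (q t * (a t * u t)) (q t * (b t * v t))
  have h3 := aux hc hu hp
  have h4 := aux ha hv hp
  have h5 := aux ha hu hq
  have h6 := aux hb hv hq
  linarith

section Param

variable {a b c a' b' c' : ℝ → ℂ} {K : ℝ} {U V : ℂ → ℝ → ℂ} {y : ℝ} {α β : ℂ}

/-- The families of solutions of `!![a, b; c, -a] + s !![a', b'; c', -a']` with initial value
independent of `s`. -/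
structure IsSolFamily (a b c a' b' c' : ℝ → ℂ) (K y : ℝ) (α β : ℂ) (U V : ℂ → ℝ → ℂ) : Prop where
  continuous : Continuous a ∧ Continuous b ∧ Continuous c
  continuous' : Continuous a' ∧ Continuous b' ∧ Continuous c'
  bound : ∀ z, ‖a z‖ ≤ K ∧ ‖b z‖ ≤ K ∧ ‖c z‖ ≤ K
  bound' : ∀ z, ‖a' z‖ ≤ K ∧ ‖b' z‖ ≤ K ∧ ‖c' z‖ ≤ K
  isSol : ∀ s, IsSol (fun z => a z + s * a' z) (fun z => b z + s * b' z) (fun z => c z + s * c' z)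
    (U s) (V s)
  left_eq : ∀ s, U s y = α
  right_eq : ∀ s, V s y = β

namespace IsSolFamily

variable (h : IsSolFamily a b c a' b' c' K y α β U V)

include h

theorem nonneg : 0 ≤ K := (norm_nonneg _).trans (h.bound 0).1

theorem continuous_perturbForm {p q : ℝ → ℂ} (hp : Continuous p) (hq : Continuous q) (s : ℂ) :
    Continuous (perturbForm a' b' c' p q (U s) (V s)) := by
  obtain ⟨h1, h2, h3⟩ := h.continuous'
  have h4 := (h.isSol s).continuous_left
  have h5 := (h.isSol s).continuous_right
  unfold perturbForm
  fun_prop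

/-- An exact Duhamel formula: the perturbation enters through an explicit factor s, and the integral
still contains the perturbed solution. Lipschitz dependence, and then the derivative at s = 0, are
read off from it. -/
theorem wronskian_eq {p q : ℝ → ℂ} (hpq : IsSol a b c p q) (s : ℂ) (z : ℝ) :
    p z * V s z - q z * U s z = p y * β - q y * α +
      s * ∫ t in y..z, perturbForm a' b' c' p q (U s) (V s) t := by
  have hd : ∀ t, HasDerivAt (fun z => p z * V s z - q z * U s z)
      (s * perturbForm a' b' c' p q (U s) (V s) t) t := fun t => by
    refine (hpq.hasDerivAt_wronskian (h.isSol s) t).congr_deriv ?_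
    rw [perturbForm]
    ring
  have := intervalIntegral.integral_eq_sub_of_hasDerivAt (a := y) (b := z) (fun t _ => hd t)
    ((continuous_const.mul (h.continuous_perturbForm hpq.continuous_left hpq.continuous_right
      s)).intervalIntegrable _ _)
  rw [intervalIntegral.integral_const_mul, h.left_eq, h.right_eq] at this
  rw [this]
  ring

theorem exists_bound (z : ℝ) : ∃ C, 0 ≤ C ∧
    (∀ s : ℂ, ‖s‖ ≤ 1 → ∀ t ∈ Set.uIcc y z, ‖U s t‖ ≤ C ∧ ‖V s t‖ ≤ C) ∧
    ∀ p q : ℝ → ℂ, IsSol a b c p q → ∀ t ∈ Set.uIcc y z,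
      ‖p t‖ ^ 2 + ‖q t‖ ^ 2 = 1 → ∀ r ∈ Set.uIcc y z, ‖p r‖ ≤ C ∧ ‖q r‖ ≤ C := by
  have hK := h.nonneg
  have hdist : ∀ r ∈ Set.uIcc y z, ∀ t ∈ Set.uIcc y z, |r - t| ≤ |z - y| := fun r hr t ht => by
    rw [Set.mem_uIcc] at hr ht
    rcases le_total y z with hyz | hyz
    · rw [abs_of_nonneg (sub_nonneg.2 hyz), abs_le]
      constructor <;> rcases hr with hr | hr <;> rcases ht with ht | ht <;> linarith
    · rw [abs_of_nonpos (sub_nonpos.2 hyz), abs_le]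
      constructor <;> rcases hr with hr | hr <;> rcases ht with ht | ht <;> linarith
  have hroot : ∀ x x' D D' : ℝ, D ≤ D' → x ^ 2 + x' ^ 2 ≤ D → x ≤ D' + 1 ∧ x' ≤ D' + 1 := by
    intro x x' D D' hD hx
    constructor <;> nlinarith [sq_nonneg (x - 1), sq_nonneg (x' - 1), sq_nonneg x, sq_nonneg x']
  set E := Real.exp (2 * (2 * K + 2 * K) * |z - y|) with hE
  have hEpos : 0 ≤ E := (Real.exp_pos _).le
  refine ⟨E * (‖α‖ ^ 2 + ‖β‖ ^ 2) + E + 1, by positivity, fun s hs t ht => ?_,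
    fun p q hpq t ht ht1 r hr => ?_⟩
  · have hb : ∀ x x' : ℂ, ‖x‖ ≤ K → ‖x'‖ ≤ K → ‖x + s * x'‖ ≤ 2 * K := fun x x' hx hx' => by
      refine (norm_add_le _ _).trans ?_
      rw [norm_mul]
      have := mul_le_mul hs hx' (norm_nonneg _) zero_le_one
      linarith
    have h1 := (h.isSol s).norm_sq_add_le (P := 2 * K) (K := 2 * K)
      (fun r => (Complex.abs_re_le_norm _).trans (hb _ _ (h.bound r).1 (h.bound' r).1))
      (fun r => hb _ _ (h.bound r).2.1 (h.bound' r).2.1)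
      (fun r => hb _ _ (h.bound r).2.2 (h.bound' r).2.2) y t
    rw [h.left_eq, h.right_eq] at h1
    refine hroot _ _ _ _ ?_ h1
    have h2 : Real.exp (2 * (2 * K + 2 * K) * |t - y|) ≤ E :=
      Real.exp_le_exp.2 (mul_le_mul_of_nonneg_left (hdist t ht y Set.left_mem_uIcc) (by positivity))
    have h3 := mul_le_mul_of_nonneg_right h2 (by positivity : 0 ≤ ‖α‖ ^ 2 + ‖β‖ ^ 2)
    linarith
  · have h1 := hpq.norm_sq_add_le (P := 2 * K) (K := 2 * K)
      (fun r => (Complex.abs_re_le_norm _).trans ((h.bound r).1.trans (by linarith)))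
      (fun r => (h.bound r).2.1.trans (by linarith))
      (fun r => (h.bound r).2.2.trans (by linarith)) t r
    rw [ht1, mul_one] at h1
    refine hroot _ _ _ _ ?_ h1
    have h2 : Real.exp (2 * (2 * K + 2 * K) * |r - t|) ≤ E :=
      Real.exp_le_exp.2 (mul_le_mul_of_nonneg_left (hdist r hr t ht) (by positivity))
    have : 0 ≤ E * (‖α‖ ^ 2 + ‖β‖ ^ 2) := by positivity
    linarith

/-- The Duhamel formula is tested against unperturbed solutions with data (0, −1) and (1, 0) at t,
whose Wronskians at t single out U and V. -/
theorem exists_lipschitz (z : ℝ) : ∃ L, ∀ s : ℂ, ‖s‖ ≤ 1 → ∀ t ∈ Set.uIcc y z,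
    ‖U s t - U 0 t‖ ≤ L * ‖s‖ ∧ ‖V s t - V 0 t‖ ≤ L * ‖s‖ := by
  obtain ⟨C, hC, h1, h2⟩ := h.exists_bound z
  have hK := h.nonneg
  refine ⟨4 * (C * (K * C)) * |z - y|, fun s hs t ht => ?_⟩
  have hsub : Set.uIcc y t ⊆ Set.uIcc y z := Set.uIcc_subset_uIcc_left ht
  have hyt : |t - y| ≤ |z - y| := Set.abs_sub_left_of_mem_uIcc ht
  have main : ∀ p q : ℝ → ℂ, IsSol a b c p q → ‖p t‖ ^ 2 + ‖q t‖ ^ 2 = 1 →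
      ‖(p t * V s t - q t * U s t) - (p t * V 0 t - q t * U 0 t)‖ ≤
        4 * (C * (K * C)) * |z - y| * ‖s‖ := by
    intro p q hpq hn
    rw [h.wronskian_eq hpq s t, h.wronskian_eq hpq 0 t, zero_mul, add_zero, add_sub_cancel_left,
      norm_mul]
    have := intervalIntegral.norm_integral_le_of_norm_le_const (a := y) (b := t)
      (f := perturbForm a' b' c' p q (U s) (V s)) (C := 4 * (C * (K * C))) fun r hr => by
        have hr' := hsub (Set.uIoc_subset_uIcc hr)
        exact norm_perturbForm_le (h.bound' r).1 (h.bound' r).2.1 (h.bound' r).2.2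
          (h2 p q hpq t ht hn r hr').1 (h2 p q hpq t ht hn r hr').2 (h1 s hs r hr').1
          (h1 s hs r hr').2
    have h3 : 4 * (C * (K * C)) * |t - y| ≤ 4 * (C * (K * C)) * |z - y| := by gcongr
    rw [mul_comm]
    exact mul_le_mul_of_nonneg_right (this.trans h3) (norm_nonneg _)
  obtain ⟨ca, cb, cc⟩ := h.continuous
  constructor
  · obtain ⟨p, q, hpq, hp, hq⟩ := exists_isSol ca cb cc h.bound t 0 (-1)
    simpa [hp, hq] using main p q hpq (by simp [hp, hq])
  · obtain ⟨p, q, hpq, hp, hq⟩ := exists_isSol ca cb cc h.bound t 1 0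
    simpa [hp, hq] using main p q hpq (by simp [hp, hq])

/-- First variation of the Wronskian with a fixed solution of the unperturbed system. -/
theorem hasDerivAt_wronskian {p q : ℝ → ℂ} (hpq : IsSol a b c p q) (z : ℝ) :
    HasDerivAt (fun s => p z * V s z - q z * U s z)
      (∫ t in y..z, perturbForm a' b' c' p q (U 0) (V 0) t) 0 := by
  set G : ℂ → ℂ := fun s => ∫ t in y..z, perturbForm a' b' c' p q (U s) (V s) t with hG
  obtain ⟨L, hL⟩ := h.exists_lipschitz z
  have hK := h.nonneg
  obtain ⟨C, hC⟩ : ∃ C, ∀ t ∈ Set.uIcc y z, ‖p t‖ ≤ C ∧ ‖q t‖ ≤ C := by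
    obtain ⟨C₁, h1⟩ := isCompact_uIcc.exists_bound_of_continuousOn
      (hpq.continuous_left.continuousOn (s := Set.uIcc y z))
    obtain ⟨C₂, h2⟩ := isCompact_uIcc.exists_bound_of_continuousOn
      (hpq.continuous_right.continuousOn (s := Set.uIcc y z))
    exact ⟨max C₁ C₂, fun t ht => ⟨(h1 t ht).trans (le_max_left _ _),
      (h2 t ht).trans (le_max_right _ _)⟩⟩
  have hGc : ContinuousAt G 0 := by
    have hle : ∀ s : ℂ, ‖s‖ ≤ 1 → ‖G s - G 0‖ ≤ 4 * (C * (K * L)) * |z - y| * ‖s‖ := by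
      intro s hs
      rw [hG]
      simp only
      rw [← intervalIntegral.integral_sub
        ((h.continuous_perturbForm hpq.continuous_left hpq.continuous_right s).intervalIntegrable _ _)
        ((h.continuous_perturbForm hpq.continuous_left hpq.continuous_right 0).intervalIntegrable _ _)]
      refine (intervalIntegral.norm_integral_le_of_norm_le_const
        (C := 4 * (C * (K * (L * ‖s‖)))) fun t ht => ?_).trans (le_of_eq (by ring))
      have ht' := Set.uIoc_subset_uIcc ht
      have e : perturbForm a' b' c' p q (U s) (V s) t - perturbForm a' b' c' p q (U 0) (V 0) t =
          perturbForm a' b' c' p q (fun t => U s t - U 0 t) (fun t => V s t - V 0 t) t := by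
        simp only [perturbForm]
        ring
      rw [e]
      exact norm_perturbForm_le (h.bound' t).1 (h.bound' t).2.1 (h.bound' t).2.2 (hC t ht').1
        (hC t ht').2 (hL s hs t ht').1 (hL s hs t ht').2
    rw [ContinuousAt, tendsto_iff_norm_sub_tendsto_zero]
    refine squeeze_zero_norm' (a := fun s : ℂ => 4 * (C * (K * L)) * |z - y| * ‖s‖) ?_ ?_
    · filter_upwards [Metric.ball_mem_nhds (0 : ℂ) one_pos] with s hs
      rw [norm_norm]
      exact hle s (by simpa using (Metric.mem_ball.1 hs).le)
    · have : Continuous fun s : ℂ => 4 * (C * (K * L)) * |z - y| * ‖s‖ := by fun_prop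
      simpa using this.tendsto 0
  -- Continuity of G at 0 suffices: the difference quotient of s G(s) at 0 is G(s) itself.
  have hd : HasDerivAt (fun s => s * G s) (G 0) 0 := by
    rw [hasDerivAt_iff_tendsto_slope]
    refine (hGc.tendsto.mono_left nhdsWithin_le_nhds).congr' ?_
    filter_upwards [self_mem_nhdsWithin] with s hs
    have hs' : s ≠ 0 := hs
    simp [slope_def_field, hs']
  have := hd.const_add (p y * β - q y * α)
  refine this.congr_of_eventuallyEq (Filter.Eventually.of_forall fun s => ?_)
  exact h.wronskian_eq hpq s z

theorem differentiableAt (z : ℝ) :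
    DifferentiableAt ℂ (fun s => U s z) 0 ∧ DifferentiableAt ℂ (fun s => V s z) 0 := by
  obtain ⟨ca, cb, cc⟩ := h.continuous
  constructor
  · obtain ⟨p, q, hpq, hp, hq⟩ := exists_isSol ca cb cc h.bound z 0 (-1)
    simpa [hp, hq] using (h.hasDerivAt_wronskian hpq z).differentiableAt
  · obtain ⟨p, q, hpq, hp, hq⟩ := exists_isSol ca cb cc h.bound z 1 0
    simpa [hp, hq] using (h.hasDerivAt_wronskian hpq z).differentiableAt

end IsSolFamily

end Param

/-! ### The transition matrix -/

theorem continuous_potential {l : ℝ} (ψ : phaseSpace l) : Continuous (ψ : ℝ → ℂ) :=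
  ψ.2.1.continuous

theorem exists_bound_potential {l : ℝ} (hl : 0 < l) (ψ : phaseSpace l) :
    ∃ K, 0 < K ∧ ∀ z, ‖(ψ : ℝ → ℂ) z‖ ≤ K := by
  obtain ⟨C, hC⟩ := isCompact_Icc.exists_bound_of_continuousOn
    ((continuous_potential ψ).continuousOn (s := Set.Icc 0 (0 + 2 * l)))
  refine ⟨max C 1, by positivity, fun z => ?_⟩
  obtain ⟨y, hy, e⟩ := ψ.2.2.exists_mem_Ico (by positivity) z 0
  rw [e]
  exact (hC y (Set.Ico_subset_Icc_self hy)).trans (le_max_left _ _)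

/-- The solutions of the auxiliary linear problem. -/
abbrev IsLaxSol (ψ : ℝ → ℂ) (lam : ℂ) (u v : ℝ → ℂ) : Prop :=
  IsSol (fun _ => -(Complex.I * lam / 2)) (fun z => conj (ψ z)) ψ u v

theorem monodromy_apply (l : ℝ) (ψ : ℝ → ℂ) (lam : ℂ) : monodromy l ψ (-l) lam = transition ψ l (-l) lam := by
  rw [monodromy]
  congr 1
  ring

section Transition

variable {ψ : ℝ → ℂ} {K : ℝ} (hc : Continuous ψ) (hK : ∀ z, ‖ψ z‖ ≤ K)

include hc hK

theorem exists_isLaxSol (lam : ℂ) (y : ℝ) (α β : ℂ) :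
    ∃ u v, IsLaxSol ψ lam u v ∧ u y = α ∧ v y = β := by
  refine exists_isSol (K := ‖-(Complex.I * lam / 2)‖ + K) continuous_const
    (Complex.continuous_conj.comp hc) hc (fun z => ?_) y α β
  have h0 : 0 ≤ K := (norm_nonneg _).trans (hK 0)
  have h1 := norm_nonneg (-(Complex.I * lam / 2))
  rw [Function.comp_apply, RCLike.norm_conj]
  exact ⟨by linarith, (hK z).trans (by linarith), (hK z).trans (by linarith)⟩

theorem isTransition_transition (y : ℝ) (lam : ℂ) :
    IsTransition ψ y lam (fun x => transition ψ x y lam) := by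
  have hex : ∃ N, IsTransition ψ y lam N := by
    obtain ⟨p, q, h1, hp, hq⟩ := exists_isLaxSol hc hK lam y 1 0
    obtain ⟨r, s, h2, hr, hs⟩ := exists_isLaxSol hc hK lam y 0 1
    refine ⟨fun z => !![p z, r z; q z, s z], ?_, fun z i j => ?_⟩
    · ext i j
      fin_cases i <;> fin_cases j <;> simp [hp, hq, hr, hs]
    · fin_cases i <;> fin_cases j
      · simpa [V, Matrix.mul_apply, Fin.sum_univ_two] using h1.left z
      · simpa [V, Matrix.mul_apply, Fin.sum_univ_two] using h2.left z
      · simpa [V, Matrix.mul_apply, Fin.sum_univ_two, sub_eq_add_neg, add_comm] using h1.right z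
      · simpa [V, Matrix.mul_apply, Fin.sum_univ_two, sub_eq_add_neg, add_comm] using h2.right z
  have e : (fun x => transition ψ x y lam) = hex.choose := by
    ext1 x
    rw [transition, dif_pos hex]
  rw [e]
  exact hex.choose_spec

theorem transition_self (y : ℝ) (lam : ℂ) : transition ψ y y lam = 1 :=
  (isTransition_transition hc hK y lam).1

theorem isLaxSol_transition (y : ℝ) (lam : ℂ) (j : Fin 2) :
    IsLaxSol ψ lam (fun z => transition ψ z y lam 0 j) (fun z => transition ψ z y lam 1 j) := by
  have h := (isTransition_transition hc hK y lam).2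
  constructor <;> intro z
  · simpa [V, Matrix.mul_apply, Fin.sum_univ_two] using h z 0 j
  · simpa [V, Matrix.mul_apply, Fin.sum_univ_two, sub_eq_add_neg, add_comm] using h z 1 j

theorem IsLaxSol.eq_transition {lam : ℂ} {u v : ℝ → ℂ} (h : IsLaxSol ψ lam u v) (y z : ℝ) :
    u z = u y * transition ψ z y lam 0 0 + v y * transition ψ z y lam 0 1 ∧
      v z = u y * transition ψ z y lam 1 0 + v y * transition ψ z y lam 1 1 := by
  have e := transition_self hc hK y lam
  exact IsSol.eq_comb (isLaxSol_transition hc hK y lam 0) (isLaxSol_transition hc hK y lam 1)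
    (by simp [e]) (by simp [e]) (by simp [e]) (by simp [e]) h z

theorem det_transition (y z : ℝ) (lam : ℂ) : (transition ψ z y lam).det = 1 := by
  have := (isLaxSol_transition hc hK y lam 0).wronskian_eq (isLaxSol_transition hc hK y lam 1) z y
  rw [transition_self hc hK] at this
  rw [Matrix.det_fin_two]
  simp at this
  linear_combination this

/-- A shift of the spectral parameter is a linear perturbation of the diagonal, so the parameter
theory yields that the transition matrix is entire in λ. -/
theorem isSolFamily_transition_spectral (y : ℝ) (lam : ℂ) (j : Fin 2) :
    IsSolFamily (fun _ => -(Complex.I * lam / 2)) (fun z => conj (ψ z)) ψ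
      (fun _ => -(Complex.I / 2)) (fun _ => 0) (fun _ => 0) (‖-(Complex.I * lam / 2)‖ + K + 1) y
      ((1 : Matrix (Fin 2) (Fin 2) ℂ) 0 j) ((1 : Matrix (Fin 2) (Fin 2) ℂ) 1 j)
      (fun s z => transition ψ z y (lam + s) 0 j) (fun s z => transition ψ z y (lam + s) 1 j) := by
  have h0 : 0 ≤ K := (norm_nonneg _).trans (hK 0)
  have h1 := norm_nonneg (-(Complex.I * lam / 2))
  refine ⟨⟨continuous_const, Complex.continuous_conj.comp hc, hc⟩,
    ⟨continuous_const, continuous_const, continuous_const⟩, fun z => ?_, fun z => ?_, fun s => ?_,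
    fun s => ?_, fun s => ?_⟩
  · rw [RCLike.norm_conj]
    exact ⟨by linarith, (hK z).trans (by linarith), (hK z).trans (by linarith)⟩
  · rw [norm_zero, norm_neg, norm_div, Complex.norm_I, Complex.norm_ofNat]
    exact ⟨by linarith, by linarith, by linarith⟩
  · have := isLaxSol_transition hc hK y (lam + s) j
    constructor <;> intro z
    · exact (this.left z).congr_deriv (by ring)
    · exact (this.right z).congr_deriv (by ring)
  · rw [transition_self hc hK]
  · rw [transition_self hc hK]

theorem differentiable_transition (y z : ℝ) (i j : Fin 2) :
    Differentiable ℂ fun lam => transition ψ z y lam i j := by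
  intro lam
  have h := (isSolFamily_transition_spectral hc hK y lam j).differentiableAt z
  have key : ∀ f : ℂ → ℂ, DifferentiableAt ℂ (fun s => f (lam + s)) 0 → DifferentiableAt ℂ f lam := by
    intro f hf
    have h2 : DifferentiableAt ℂ (fun m : ℂ => m - lam) lam := by fun_prop
    have h3 := DifferentiableAt.comp (f := fun m : ℂ => m - lam) lam (by simpa using hf) h2
    simpa [Function.comp_def] using h3
  fin_cases i
  · exact key _ h.1
  · exact key _ h.2

theorem norm_transition_le {P : ℝ} {lam : ℂ} (hP : |lam.im| ≤ 2 * P) (y z : ℝ) (i j : Fin 2) :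
    ‖transition ψ z y lam i j‖ ≤ Real.exp ((P + K) * |z - y|) := by
  have h := (isLaxSol_transition hc hK y lam j).norm_sq_add_le (P := P) (K := K) (fun _ => by
      have : (-(Complex.I * lam / 2)).re = lam.im / 2 := by simp; ring
      rw [this, abs_div, abs_two]
      linarith)
    (fun r => by rw [RCLike.norm_conj]; exact hK r) hK y z
  have e : ∀ j, ‖transition ψ y y lam 0 j‖ ^ 2 + ‖transition ψ y y lam 1 j‖ ^ 2 = 1 := by
    rw [transition_self hc hK]
    simp [Fin.forall_fin_two]
  have e2 : Real.exp (2 * (P + K) * |z - y|) = Real.exp ((P + K) * |z - y|) ^ 2 := by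
    rw [← Real.exp_nat_mul]
    congr 1
    push_cast
    ring
  rw [e, mul_one, e2] at h
  refine le_of_sq_le_sq ?_ (Real.exp_pos _).le
  fin_cases i
  · exact (le_add_of_nonneg_right (sq_nonneg _)).trans h
  · exact (le_add_of_nonneg_left (sq_nonneg _)).trans h

end Transition

/-! ### Entire functions -/

/-- Liouville's theorem makes the function constant, and the constant is read off along the positive
imaginary axis. -/
theorem eq_zero_of_bounded_of_tendsto {F : ℂ → ℂ} (hF : Differentiable ℂ F) {C : ℝ}
    (hC : ∀ lam, ‖F lam‖ ≤ C)
    (h0 : Filter.Tendsto (fun τ : ℝ => F (Complex.I * τ)) Filter.atTop (nhds 0)) : F = 0 := by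
  obtain ⟨c, hc⟩ := hF.exists_eq_const_of_bounded (isBounded_iff_forall_norm_le.2
    ⟨C, by rintro _ ⟨x, rfl⟩; exact hC x⟩)
  rw [hc] at h0
  have : c = 0 := tendsto_nhds_unique (tendsto_const_nhds (x := c) (f := Filter.atTop (α := ℝ))) h0
  rw [hc, this]
  rfl

/-- The zeros of a nonzero entire function are isolated. -/
theorem eventually_ne_zero_of_entire {F : ℂ → ℂ} (hF : Differentiable ℂ F) (hne : F ≠ 0) (lam : ℂ) :
    ∀ᶠ m in nhdsWithin lam {lam}ᶜ, F m ≠ 0 := by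
  have han : AnalyticOnNhd ℂ F Set.univ := fun x _ => hF.analyticAt x
  rcases (han lam (Set.mem_univ _)).eventually_eq_zero_or_eventually_ne_zero with h | h
  · refine absurd ?_ hne
    have := han.eqOn_zero_of_preconnected_of_eventuallyEq_zero isPreconnected_univ (Set.mem_univ lam) h
    ext x
    exact this (Set.mem_univ x)
  · exact h

/-- Integrals of entire functions with respect to a parameter are entire. -/
theorem differentiable_integral {f : ℝ → ℂ} {x y : ℝ} (hf : IntervalIntegrable f volume x y)
    {G : ℂ → ℝ → ℂ} (hG : ∀ s, Differentiable ℂ fun lam => G lam s) (hGc : ∀ lam, Continuous (G lam))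
    (hb : ∀ R : ℝ, ∃ C : ℝ, ∀ lam : ℂ, ‖lam‖ ≤ R → ∀ s ∈ Set.uIcc x y, ‖G lam s‖ ≤ C) :
    Differentiable ℂ fun lam => ∫ s in x..y, f s * G lam s := by
  intro lam
  obtain ⟨C, hC⟩ := hb (‖lam‖ + 2)
  -- Cauchy's estimate on unit circles centred in the unit ball around `lam`; this is why the bound
  -- is taken for radius ‖lam‖ + 2.
  have hd : ∀ m ∈ Metric.ball lam 1, ∀ s ∈ Set.uIcc x y, ‖deriv (fun m => G m s) m‖ ≤ C := by
    intro m hm s hs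
    have := Complex.norm_deriv_le_of_forall_mem_sphere_norm_le (f := fun m => G m s) (c := m)
      (C := C) one_pos (hG s).diffContOnCl fun z hz => hC z (by
        have h1 : ‖z - m‖ = 1 := by simpa [dist_eq_norm] using hz
        have h2 : ‖m - lam‖ < 1 := by simpa [dist_eq_norm] using hm
        have h3 : z = lam + (m - lam) + (z - m) := by ring
        rw [h3]
        refine (norm_add_le _ _).trans ?_
        have := norm_add_le lam (m - lam)
        linarith) s hs
    simpa using this
  have hmeas : ∀ m, AEStronglyMeasurable (fun s => f s * G m s)
      (volume.restrict (Set.uIoc x y)) := fun m =>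
    hf.def'.aestronglyMeasurable.mul (hGc m).aestronglyMeasurable
  have hmd : AEStronglyMeasurable (fun s => deriv (fun m => G m s) lam)
      (volume.restrict (Set.uIoc x y)) := by
    -- Measurability in s of the λ-derivative: it is a pointwise limit of difference quotients
    -- continuous in s.
    have hlim : ∀ s, Filter.Tendsto (fun n : ℕ => ((n : ℂ) + 1) * (G (lam + ((n : ℂ) + 1)⁻¹) s - G lam s))
        Filter.atTop (nhds (deriv (fun m => G m s) lam)) := by
      intro s
      have h1 := (hG s lam).hasDerivAt.tendsto_slope_zero
      have h2 : Filter.Tendsto (fun n : ℕ => ((n : ℂ) + 1)⁻¹) Filter.atTop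
          (nhdsWithin 0 {0}ᶜ) := by
        refine tendsto_nhdsWithin_iff.2 ⟨?_, Filter.Eventually.of_forall fun n => ?_⟩
        · have := tendsto_one_div_add_atTop_nhds_zero_nat (𝕜 := ℂ)
          simpa using this
        · simpa using Nat.cast_add_one_ne_zero n
      have h3 := h1.comp h2
      refine h3.congr fun n => ?_
      simp
    refine aestronglyMeasurable_of_tendsto_ae Filter.atTop (f := fun (n : ℕ) s =>
      ((n : ℂ) + 1) * (G (lam + ((n : ℂ) + 1)⁻¹) s - G lam s)) (fun n => ?_)
      (Filter.Eventually.of_forall hlim)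
    exact (continuous_const.mul ((hGc _).sub (hGc _))).aestronglyMeasurable
  have := intervalIntegral.hasDerivAt_integral_of_dominated_loc_of_deriv_le (μ := volume)
    (a := x) (b := y) (F := fun m s => f s * G m s) (F' := fun m s => f s * deriv (fun m => G m s) m)
    (x₀ := lam) (s := Metric.ball lam 1) (bound := fun s => ‖f s‖ * C)
    (Metric.ball_mem_nhds _ one_pos) (Filter.Eventually.of_forall hmeas)
    (hf.mul_continuousOn (hGc lam).continuousOn) (hf.def'.aestronglyMeasurable.mul hmd)
    (Filter.Eventually.of_forall fun s hs m hm => by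
      rw [norm_mul]
      exact mul_le_mul_of_nonneg_left (hd m hm s (Set.uIoc_subset_uIcc hs)) (norm_nonneg _))
    (hf.norm.mul_const C)
    (Filter.Eventually.of_forall fun s _ m _ => ((hG s m).hasDerivAt).const_mul (f s))
  exact this.2.differentiableAt

/-! ### Squared Floquet solutions -/

/-- The integrand of the pairing of `(f, g)` with products of solutions. -/
def pairForm (f g u v u' v' : ℝ → ℂ) (s : ℝ) : ℂ := f s * (u s * u' s) - g s * (v s * v' s)

theorem pairForm_swap (f g u v u' v' : ℝ → ℂ) :
    pairForm g f v u v' u' = -pairForm f g u v u' v' := by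
  ext s
  simp [pairForm]

theorem intervalIntegrable_pairForm {f g u v u' v' : ℝ → ℂ} {x y : ℝ}
    (hf : IntervalIntegrable f volume x y) (hg : IntervalIntegrable g volume x y)
    (hu : Continuous u) (hv : Continuous v) (hu' : Continuous u') (hv' : Continuous v') :
    IntervalIntegrable (pairForm f g u v u' v') volume x y :=
  (hf.mul_continuousOn (hu.mul hu').continuousOn).sub (hg.mul_continuousOn (hv.mul hv').continuousOn)

theorem norm_pairForm_le {f g u v u' v' : ℝ → ℂ} {s C : ℝ} (h1 : ‖u s‖ * ‖u' s‖ ≤ C)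
    (h2 : ‖v s‖ * ‖v' s‖ ≤ C) : ‖pairForm f g u v u' v' s‖ ≤ (‖f s‖ + ‖g s‖) * C := by
  refine (norm_sub_le _ _).trans ?_
  simp only [norm_mul]
  rw [add_mul]
  gcongr

/-- A function all of whose primitives vanish is zero almost everywhere. -/
theorem ae_eq_zero_of_primitive_eq_zero {h : ℝ → ℂ} {x y : ℝ} (hxy : x ≤ y)
    (hh : IntervalIntegrable h volume x y) (h0 : ∀ z ∈ Set.Icc x y, ∫ s in x..z, h s = 0) :
    ∀ᵐ s ∂volume.restrict (Set.Ioc x y), h s = 0 := by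
  rw [← Measure.restrict_congr_set Ioo_ae_eq_Ioc, ae_restrict_iff' measurableSet_Ioo]
  filter_upwards [hh.ae_hasDerivAt_integral] with s hs hsm
  have hsI : s ∈ Set.uIcc x y := by
    rw [Set.uIcc_of_le hxy]
    exact Set.Ioo_subset_Icc_self hsm
  refine (hs hsI x Set.left_mem_uIcc).unique ?_
  refine (hasDerivAt_const s (0 : ℂ)).congr_of_eventuallyEq ?_
  filter_upwards [Ioo_mem_nhds hsm.1 hsm.2] with z hz
  exact h0 z (Set.Ioo_subset_Icc_self hz)

/-! ### A bound for pairings orthogonal to one squared decaying Floquet solution -/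

section Estimate

variable {k : ℂ} {ψ f g a₁ a₂ b₁ b₂ Y₁ Y₂ Z₁ Z₂ : ℝ → ℂ} {K δ p x y z₀ : ℝ} {w : ℂ}

/-- The constant that bounds the pairing of `(f, g)` with products of solutions. -/
def pairBound (f g : ℝ → ℂ) (K x y z₀ δ p : ℝ) : ℝ :=
  16 * ((∫ s in x..y, (‖f s‖ + ‖g s‖) * Real.exp (-(2 * (p - K) * |s - z₀|))) +
    δ * ∫ s in x..y, (‖f s‖ + ‖g s‖))

/-- Solutions normalized at z₀ are combinations of a growing solution a and the decaying Floquet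
solution b. The aa-integral over [x, z₀] is concentrated near z₀. The bb-integral would be large
there, but the orthogonality `hint` replaces it by the integral over [z₀, y], also concentrated near
z₀. The mixed products a₁b₁ and a₂b₂ carry a factor δ because a and b lie in opposite cones. -/
theorem norm_integral_pairForm_le (hψ : ∀ z, ‖ψ z‖ ≤ K) (hp : p ≤ k.re)
    (hk : K ≤ 2 * δ * p) (hδ : 0 < δ) (hδ1 : δ ≤ 1 / 2) (hz : z₀ ∈ Set.Icc x y)
    (hf : IntervalIntegrable f volume x y) (hg : IntervalIntegrable g volume x y)
    (ha : IsSol (fun _ => k) (fun z => conj (ψ z)) ψ a₁ a₂) (ha₁ : a₁ x = 1) (ha₂ : a₂ x = 0)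
    (hb : IsSol (fun _ => k) (fun z => conj (ψ z)) ψ b₁ b₂) (hw : ‖w‖ < 1)
    (hb₁ : b₁ y = w * b₁ x) (hb₂ : b₂ y = w * b₂ x) (hb0 : b₁ z₀ ≠ 0 ∨ b₂ z₀ ≠ 0)
    (hint : ∫ s in x..y, pairForm f g b₁ b₂ b₁ b₂ s = 0)
    (hY : IsSol (fun _ => k) (fun z => conj (ψ z)) ψ Y₁ Y₂) (hY₁ : ‖Y₁ z₀‖ ≤ 1) (hY₂ : ‖Y₂ z₀‖ ≤ 1)
    (hZ : IsSol (fun _ => k) (fun z => conj (ψ z)) ψ Z₁ Z₂) (hZ₁ : ‖Z₁ z₀‖ ≤ 1)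
    (hZ₂ : ‖Z₂ z₀‖ ≤ 1) :
    ‖∫ s in x..z₀, pairForm f g Y₁ Y₂ Z₁ Z₂ s‖ ≤ pairBound f g K x y z₀ δ p := by
  have hxy : x ≤ y := hz.1.trans hz.2
  have hk' : K ≤ 2 * δ * k.re := hk.trans (by gcongr)
  have hδ' : δ ≤ 1 := by linarith
  -- the two cones
  have hac : ∀ s, x ≤ s → ‖a₂ s‖ ≤ δ * ‖a₁ s‖ := fun s hs =>
    ha.norm_right_le hψ hk' hδ hδ' hs (by rw [ha₂, norm_zero]; positivity)
  have hbc : ∀ s ∈ Set.Icc x y, ‖b₁ s‖ ≤ δ * ‖b₂ s‖ := fun s hs =>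
    hb.norm_left_le_of_floquet hψ hk' hδ hδ' hw hb₁ hb₂ hs
  have hac' : ∀ s, x ≤ s → ‖a₂ s‖ ≤ ‖a₁ s‖ := fun s hs =>
    (hac s hs).trans (mul_le_of_le_one_left (norm_nonneg _) hδ')
  have hbc' : ∀ s ∈ Set.Icc x y, ‖b₁ s‖ ≤ ‖b₂ s‖ := fun s hs =>
    (hbc s hs).trans (mul_le_of_le_one_left (norm_nonneg _) hδ')
  have hexp : ∀ d, 0 ≤ d → ∀ r t : ℝ, Real.exp (2 * (k.re - K) * d) * r ^ 2 ≤ t ^ 2 →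
      r ^ 2 ≤ t ^ 2 * Real.exp (-(2 * (p - K) * d)) := by
    intro d hd r t h
    have h1 : Real.exp (2 * (p - K) * d) * r ^ 2 ≤ t ^ 2 := by
      refine le_trans ?_ h
      gcongr
    rw [Real.exp_neg, ← div_eq_mul_inv, le_div_iff₀ (Real.exp_pos _)]
    linarith
  have ha0 : 0 < ‖a₁ z₀‖ := by
    have h1 := ha.exp_mul_norm_sq_left_le hψ hz.1 fun s hs => hac' s hs.1
    rw [ha₁, norm_one] at h1
    have h2 := Real.exp_pos (2 * (k.re - K) * (z₀ - x))
    refine norm_pos_iff.2 fun h0 => ?_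
    rw [h0, norm_zero] at h1
    linarith
  have hb0' : 0 < ‖b₂ z₀‖ := by
    refine norm_pos_iff.2 fun h0 => ?_
    have := hbc' z₀ hz
    rw [h0, norm_zero] at this
    exact hb0.elim (fun h => h (norm_le_zero_iff.1 this)) (fun h => h h0)
  set A := ‖a₁ z₀‖
  set B := ‖b₂ z₀‖
  have haz := hac z₀ hz.1
  have hbz := hbc z₀ hz
  -- the Wronskian of the two solutions
  set W := a₁ z₀ * b₂ z₀ - a₂ z₀ * b₁ z₀ with hWdef
  -- With δ ≤ 1/2 the two cones give the factor 1/4; hence the Wronskian lies between 3/4 and 5/4 of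
  -- its main term.
  have hsmall : ∀ s ∈ Set.Icc x y, ‖a₂ s * b₁ s‖ ≤ ‖a₁ s * b₂ s‖ / 4 := fun s hs => by
    rw [norm_mul, norm_mul]
    have h1 := (hac s hs.1).trans (mul_le_mul_of_nonneg_right hδ1 (norm_nonneg _))
    have h2 := (hbc s hs).trans (mul_le_mul_of_nonneg_right hδ1 (norm_nonneg _))
    have := mul_le_mul h1 h2 (norm_nonneg _) (by positivity)
    linarith
  have hWlow : 3 / 4 * (A * B) ≤ ‖W‖ := by
    have h1 := norm_sub_norm_le (a₁ z₀ * b₂ z₀) (a₂ z₀ * b₁ z₀)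
    have h2 := hsmall z₀ hz
    rw [norm_mul (a₁ z₀)] at h1 h2
    linarith
  have hWup : ‖W‖ ≤ 5 / 4 * (A * B) := by
    have h1 := norm_sub_le (a₁ z₀ * b₂ z₀) (a₂ z₀ * b₁ z₀)
    have h2 := hsmall z₀ hz
    rw [norm_mul (a₁ z₀)] at h1 h2
    linarith
  have hAB : 0 < A * B := mul_pos ha0 hb0'
  have hWpos : 0 < ‖W‖ := by linarith
  have hW0 : W ≠ 0 := norm_pos_iff.1 hWpos
  -- The Wronskian is constant in s, so a₁b₂ stays comparable with its value at z₀ although its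
  -- factors grow and decay exponentially.
  have hcross : ∀ s ∈ Set.Icc x y, ‖a₁ s‖ * ‖b₂ s‖ ≤ 2 * (A * B) := fun s hs => by
    have h0 := ha.wronskian_eq hb s z₀
    have h1 := norm_sub_norm_le (a₁ s * b₂ s) (a₂ s * b₁ s)
    have h2 := hsmall s hs
    rw [h0, ← hWdef] at h1
    rw [norm_mul (a₁ s)] at h1 h2
    linarith
  -- coefficients of the given solutions
  have hcoef : ∀ {Y₁ Y₂ : ℝ → ℂ}, IsSol (fun _ => k) (fun z => conj (ψ z)) ψ Y₁ Y₂ →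
      ‖Y₁ z₀‖ ≤ 1 → ‖Y₂ z₀‖ ≤ 1 → ∃ α β : ℂ, ‖α‖ ≤ 2 / A ∧ ‖β‖ ≤ 2 / B ∧
        ∀ s, Y₁ s = α * a₁ s + β * b₁ s ∧ Y₂ s = α * a₂ s + β * b₂ s := by
    intro Y₁ Y₂ hY hY₁ hY₂
    refine ⟨(Y₁ z₀ * b₂ z₀ - Y₂ z₀ * b₁ z₀) / W, (a₁ z₀ * Y₂ z₀ - a₂ z₀ * Y₁ z₀) / W, ?_, ?_,
      fun s => ?_⟩
    · have h1 := norm_sub_le (Y₁ z₀ * b₂ z₀) (Y₂ z₀ * b₁ z₀)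
      rw [norm_mul, norm_mul] at h1
      have h2 := mul_le_mul hY₁ le_rfl (norm_nonneg (b₂ z₀)) zero_le_one
      have h3 := mul_le_mul hY₂ (hbz.trans (mul_le_mul_of_nonneg_right hδ1 (norm_nonneg _)))
        (norm_nonneg _) zero_le_one
      rw [norm_div, div_le_div_iff₀ hWpos ha0]
      have h4 : ‖Y₁ z₀ * b₂ z₀ - Y₂ z₀ * b₁ z₀‖ ≤ 3 / 2 * B := by linarith
      have := mul_le_mul_of_nonneg_right h4 ha0.le
      linarith
    · have h1 := norm_sub_le (a₁ z₀ * Y₂ z₀) (a₂ z₀ * Y₁ z₀)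
      rw [norm_mul, norm_mul] at h1
      have h2 := mul_le_mul (le_refl ‖a₁ z₀‖) hY₂ (norm_nonneg _) (norm_nonneg _)
      have h3 := mul_le_mul (haz.trans (mul_le_mul_of_nonneg_right hδ1 (norm_nonneg _))) hY₁
        (norm_nonneg _) (by positivity)
      rw [norm_div, div_le_div_iff₀ hWpos hb0']
      have h4 : ‖a₁ z₀ * Y₂ z₀ - a₂ z₀ * Y₁ z₀‖ ≤ 3 / 2 * A := by linarith
      have := mul_le_mul_of_nonneg_right h4 hb0'.le
      linarith
    · have e := ha.wronskian_eq hb s z₀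
      have e1 := hY.wronskian_eq hb s z₀
      have e2 := ha.wronskian_eq hY s z₀
      rw [← hWdef] at e
      rw [← e1, ← e2]
      constructor
      · rw [div_mul_eq_mul_div, div_mul_eq_mul_div, ← add_div, eq_div_iff hW0, ← e]
        ring
      · rw [div_mul_eq_mul_div, div_mul_eq_mul_div, ← add_div, eq_div_iff hW0, ← e]
        ring
  obtain ⟨α, β, hα, hβ, hYe⟩ := hcoef hY hY₁ hY₂
  obtain ⟨α', β', hα', hβ', hZe⟩ := hcoef hZ hZ₁ hZ₂
  -- integrability
  have hsub₁ : Set.uIcc x z₀ ⊆ Set.uIcc x y := by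
    rw [Set.uIcc_of_le hz.1, Set.uIcc_of_le hxy]
    exact Set.Icc_subset_Icc_right hz.2
  have hsub₂ : Set.uIcc z₀ y ⊆ Set.uIcc x y := by
    rw [Set.uIcc_of_le hz.2, Set.uIcc_of_le hxy]
    exact Set.Icc_subset_Icc_left hz.1
  have iaa := intervalIntegrable_pairForm hf hg ha.continuous_left ha.continuous_right
    ha.continuous_left ha.continuous_right
  have iab := intervalIntegrable_pairForm hf hg ha.continuous_left ha.continuous_right
    hb.continuous_left hb.continuous_right
  have ibb := intervalIntegrable_pairForm hf hg hb.continuous_left hb.continuous_right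
    hb.continuous_left hb.continuous_right
  have ih : IntervalIntegrable (fun s => ‖f s‖ + ‖g s‖) volume x y := hf.norm.add hg.norm
  have ihe : IntervalIntegrable
      (fun s => (‖f s‖ + ‖g s‖) * Real.exp (-(2 * (p - K) * |s - z₀|))) volume x y :=
    ih.mul_continuousOn (by fun_prop)
  set H := ∫ s in x..y, (‖f s‖ + ‖g s‖) with hH
  set E := ∫ s in x..y, (‖f s‖ + ‖g s‖) * Real.exp (-(2 * (p - K) * |s - z₀|)) with hE
  have hhnn : ∀ s, 0 ≤ ‖f s‖ + ‖g s‖ := fun s => by positivity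
  have hH₁ : ∫ s in x..z₀, (‖f s‖ + ‖g s‖) ≤ H :=
    intervalIntegral.integral_mono_interval le_rfl hz.1 hz.2 (Filter.Eventually.of_forall hhnn) ih
  have hE₁ : ∫ s in x..z₀, (‖f s‖ + ‖g s‖) * Real.exp (-(2 * (p - K) * |s - z₀|)) ≤ E :=
    intervalIntegral.integral_mono_interval le_rfl hz.1 hz.2 (Filter.Eventually.of_forall fun s =>
      mul_nonneg (hhnn s) (Real.exp_pos _).le) ihe
  have hE₂ : ∫ s in z₀..y, (‖f s‖ + ‖g s‖) * Real.exp (-(2 * (p - K) * |s - z₀|)) ≤ E :=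
    intervalIntegral.integral_mono_interval hz.1 hz.2 le_rfl (Filter.Eventually.of_forall fun s =>
      mul_nonneg (hhnn s) (Real.exp_pos _).le) ihe
  -- the three integrals
  have haa : ‖∫ s in x..z₀, pairForm f g a₁ a₂ a₁ a₂ s‖ ≤ A ^ 2 * E := by
    refine le_trans ?_ (mul_le_mul_of_nonneg_left hE₁ (sq_nonneg A))
    rw [← intervalIntegral.integral_const_mul]
    refine intervalIntegral.norm_integral_le_of_norm_le hz.1 (Filter.Eventually.of_forall ?_)
      ((ihe.mono_set hsub₁).const_mul _)
    intro s hs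
    have h1 := ha.exp_mul_norm_sq_left_le hψ hs.2 fun t ht => hac' t (hs.1.le.trans ht.1)
    have h2 := hexp _ (sub_nonneg.2 hs.2) _ _ h1
    rw [abs_sub_comm, abs_of_nonneg (sub_nonneg.2 hs.2)]
    have h3 := hac' s hs.1.le
    refine (norm_pairForm_le (C := A ^ 2 * Real.exp (-(2 * (p - K) * (z₀ - s)))) ?_ ?_).trans
      (le_of_eq (by ring))
    · rwa [← sq]
    · rw [← sq]
      exact (pow_le_pow_left₀ (norm_nonneg _) h3 2).trans h2
  have hbb : ‖∫ s in x..z₀, pairForm f g b₁ b₂ b₁ b₂ s‖ ≤ B ^ 2 * E := by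
    -- The only use of orthogonality: it moves the integral to the side of z₀ on which b² is
    -- smaller.
    have e : ∫ s in x..z₀, pairForm f g b₁ b₂ b₁ b₂ s =
        -∫ s in z₀..y, pairForm f g b₁ b₂ b₁ b₂ s := by
      rw [← intervalIntegral.integral_add_adjacent_intervals (ibb.mono_set hsub₁)
        (ibb.mono_set hsub₂)] at hint
      exact eq_neg_of_add_eq_zero_left hint
    rw [e, norm_neg]
    refine le_trans ?_ (mul_le_mul_of_nonneg_left hE₂ (sq_nonneg B))
    rw [← intervalIntegral.integral_const_mul]
    refine intervalIntegral.norm_integral_le_of_norm_le hz.2 (Filter.Eventually.of_forall ?_)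
      ((ihe.mono_set hsub₂).const_mul _)
    intro s hs
    have h1 := hb.exp_mul_norm_sq_right_le hψ hs.1.le fun t ht =>
      hbc' t ⟨hz.1.trans ht.1, ht.2.trans hs.2⟩
    have h2 := hexp _ (sub_nonneg.2 hs.1.le) _ _ h1
    rw [abs_of_nonneg (sub_nonneg.2 hs.1.le)]
    have h3 := hbc' s ⟨hz.1.trans hs.1.le, hs.2⟩
    refine (norm_pairForm_le (C := B ^ 2 * Real.exp (-(2 * (p - K) * (s - z₀)))) ?_ ?_).trans
      (le_of_eq (by ring))
    · rw [← sq]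
      exact (pow_le_pow_left₀ (norm_nonneg _) h3 2).trans h2
    · rwa [← sq]
  have hab : ‖∫ s in x..z₀, pairForm f g a₁ a₂ b₁ b₂ s‖ ≤ 2 * δ * (A * B) * H := by
    refine le_trans ?_ (mul_le_mul_of_nonneg_left hH₁ (by positivity))
    rw [← intervalIntegral.integral_const_mul]
    refine intervalIntegral.norm_integral_le_of_norm_le hz.1 (Filter.Eventually.of_forall ?_)
      ((ih.mono_set hsub₁).const_mul _)
    intro s hs
    have hs' : s ∈ Set.Icc x y := ⟨hs.1.le, hs.2.trans hz.2⟩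
    have h1 := hcross s hs'
    refine (norm_pairForm_le (C := 2 * δ * (A * B)) ?_ ?_).trans (le_of_eq (by ring))
    · have := mul_le_mul_of_nonneg_left (hbc s hs') (norm_nonneg (a₁ s))
      have := mul_le_mul_of_nonneg_left h1 hδ.le
      linarith
    · have := mul_le_mul_of_nonneg_right (hac s hs.1.le) (norm_nonneg (b₂ s))
      have := mul_le_mul_of_nonneg_left h1 hδ.le
      linarith
  have hsum : ∫ s in x..z₀, pairForm f g Y₁ Y₂ Z₁ Z₂ s =
      α * α' * (∫ s in x..z₀, pairForm f g a₁ a₂ a₁ a₂ s) +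
      (α * β' + β * α') * (∫ s in x..z₀, pairForm f g a₁ a₂ b₁ b₂ s) +
      β * β' * ∫ s in x..z₀, pairForm f g b₁ b₂ b₁ b₂ s := by
    have i1 := (iaa.mono_set hsub₁).const_mul (α * α')
    have i2 := (iab.mono_set hsub₁).const_mul (α * β' + β * α')
    have i3 := (ibb.mono_set hsub₁).const_mul (β * β')
    simp only [← intervalIntegral.integral_const_mul]
    rw [← intervalIntegral.integral_add i1 i2, ← intervalIntegral.integral_add (i1.add i2) i3]
    refine intervalIntegral.integral_congr fun s _ => ?_
    simp only [pairForm, (hYe s).1, (hYe s).2, (hZe s).1, (hZe s).2]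
    ring
  have hEnn : 0 ≤ E := intervalIntegral.integral_nonneg hxy fun s _ =>
    mul_nonneg (hhnn s) (Real.exp_pos _).le
  have hHnn : 0 ≤ H := intervalIntegral.integral_nonneg hxy fun s _ => hhnn s
  have n1 : ‖α * α' * ∫ s in x..z₀, pairForm f g a₁ a₂ a₁ a₂ s‖ ≤ 4 * E := by
    rw [norm_mul, norm_mul]
    calc _ ≤ 2 / A * (2 / A) * (A ^ 2 * E) := by gcongr
      _ = 4 * E := by field_simp; ring
  have n3 : ‖β * β' * ∫ s in x..z₀, pairForm f g b₁ b₂ b₁ b₂ s‖ ≤ 4 * E := by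
    rw [norm_mul, norm_mul]
    calc _ ≤ 2 / B * (2 / B) * (B ^ 2 * E) := by gcongr
      _ = 4 * E := by field_simp; ring
  have n2 : ‖(α * β' + β * α') * ∫ s in x..z₀, pairForm f g a₁ a₂ b₁ b₂ s‖ ≤ 16 * (δ * H) := by
    rw [norm_mul]
    have : ‖α * β' + β * α'‖ ≤ 2 / A * (2 / B) + 2 / B * (2 / A) := by
      refine (norm_add_le _ _).trans ?_
      rw [norm_mul, norm_mul]
      gcongr
    calc _ ≤ (2 / A * (2 / B) + 2 / B * (2 / A)) * (2 * δ * (A * B) * H) := by gcongr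
      _ = 16 * (δ * H) := by field_simp; ring
  rw [hsum]
  have t1 := norm_add₃_le (a := α * α' * ∫ s in x..z₀, pairForm f g a₁ a₂ a₁ a₂ s)
    (b := (α * β' + β * α') * ∫ s in x..z₀, pairForm f g a₁ a₂ b₁ b₂ s)
    (c := β * β' * ∫ s in x..z₀, pairForm f g b₁ b₂ b₁ b₂ s)
  have : pairBound f g K x y z₀ δ p = 16 * (E + δ * H) := rfl
  rw [this]
  linarith

end Estimate

/-! ### Completeness of the squared Floquet solutions -/

/-- A solution with multiplier `w` over `[x, y]`. -/
structure IsFloquetSol (ψ : ℝ → ℂ) (x y : ℝ) (lam w : ℂ) (u v : ℝ → ℂ) : Prop where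
  isSol : IsLaxSol ψ lam u v
  left : u y = w * u x
  right : v y = w * v x
  ne_zero : ∀ z, u z ≠ 0 ∨ v z ≠ 0

/-- The two roots have product 1, so one of them lies in the closed unit disc. -/
theorem exists_root_norm_le (t : ℂ) : ∃ w : ℂ, ‖w‖ ≤ 1 ∧ w ^ 2 - t * w + 1 = 0 := by
  obtain ⟨d, hd⟩ := IsAlgClosed.exists_pow_nat_eq ((t / 2) ^ 2 - 1) (n := 2) two_pos
  have h : ‖t / 2 + d‖ * ‖t / 2 - d‖ = 1 := by
    rw [← norm_mul, ← norm_one (α := ℂ)]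
    congr 1
    linear_combination -hd
  rcases le_total ‖t / 2 + d‖ 1 with h1 | h1
  · exact ⟨t / 2 + d, h1, by linear_combination hd⟩
  · refine ⟨t / 2 - d, ?_, by linear_combination hd⟩
    by_contra! h2
    nlinarith

section

variable {ψ : ℝ → ℂ} {K : ℝ} (hc : Continuous ψ) (hK : ∀ z, ‖ψ z‖ ≤ K)

include hc hK

theorem IsLaxSol.ne_zero {lam : ℂ} {u v : ℝ → ℂ} (h : IsLaxSol ψ lam u v) {x : ℝ}
    (hx : u x ≠ 0 ∨ v x ≠ 0) (z : ℝ) : u z ≠ 0 ∨ v z ≠ 0 := by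
  by_contra! h0
  have := h.eq_transition hc hK z x
  rw [h0.1, h0.2] at this
  simp at this
  exact hx.elim (fun h => h this.1) fun h => h this.2

theorem exists_isFloquetSol {x y : ℝ} {lam w : ℂ}
    (hw : (transition ψ y x lam - w • (1 : Matrix (Fin 2) (Fin 2) ℂ)).det = 0) :
    ∃ u v, IsFloquetSol ψ x y lam w u v := by
  obtain ⟨e, he, hM⟩ := Matrix.exists_mulVec_eq_zero_iff.2 hw
  obtain ⟨u, v, h, hu, hv⟩ := exists_isLaxSol hc hK lam x (e 0) (e 1)
  have h0 := congrFun hM 0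
  have h1 := congrFun hM 1
  simp [Matrix.mulVec, dotProduct, Fin.sum_univ_two] at h0 h1
  have ht := h.eq_transition hc hK x y
  refine ⟨u, v, h, ?_, ?_, h.ne_zero hc hK (x := x) ?_⟩
  · rw [ht.1, hu, hv]
    linear_combination h0
  · rw [ht.2, hu, hv]
    linear_combination h1
  · rw [hu, hv]
    by_contra! h0
    refine he ?_
    ext i
    fin_cases i
    · exact h0.1
    · exact h0.2

theorem det_sub_smul_eq (x y : ℝ) (lam w : ℂ) :
    (transition ψ y x lam - w • (1 : Matrix (Fin 2) (Fin 2) ℂ)).det =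
      w ^ 2 - (transition ψ y x lam).trace * w + 1 := by
  have h := det_transition hc hK x y lam
  rw [Matrix.det_fin_two] at h ⊢
  rw [Matrix.trace_fin_two]
  simp
  linear_combination h

theorem IsFloquetSol.det_eq_zero {x y : ℝ} {lam w : ℂ} {u v : ℝ → ℂ}
    (h : IsFloquetSol ψ x y lam w u v) :
    (transition ψ y x lam - w • (1 : Matrix (Fin 2) (Fin 2) ℂ)).det = 0 := by
  refine Matrix.exists_mulVec_eq_zero_iff.1 ⟨![u x, v x], fun h0 => ?_, ?_⟩
  · have h1 := congrFun h0 0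
    have h2 := congrFun h0 1
    exact (h.ne_zero x).elim (fun h => h h1) fun h => h h2
  · have ht := h.isSol.eq_transition hc hK x y
    rw [h.left, h.right] at ht
    ext i
    fin_cases i
    · simp [Matrix.mulVec, dotProduct, Fin.sum_univ_two]
      linear_combination -ht.1
    · simp [Matrix.mulVec, dotProduct, Fin.sum_univ_two]
      linear_combination -ht.2

theorem IsFloquetSol.multiplier_ne_zero {x y : ℝ} {lam w : ℂ} {u v : ℝ → ℂ}
    (h : IsFloquetSol ψ x y lam w u v) : w ≠ 0 := by
  rintro rfl
  have := h.det_eq_zero hc hK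
  rw [det_sub_smul_eq hc hK] at this
  simp at this

end

/-- Exchanging the components turns ψ into its conjugate and λ into −λ, so the cone estimates become
available in the lower half plane. -/
theorem IsLaxSol.swap_form {ψ : ℝ → ℂ} {lam : ℂ} {u v : ℝ → ℂ} (h : IsLaxSol ψ lam u v) :
    IsSol (fun _ => Complex.I * lam / 2) (fun z => conj (conj (ψ z))) (fun z => conj (ψ z)) v u := by
  have := h.swap
  simpa using this

theorem re_spectral (lam : ℂ) : (-(Complex.I * lam / 2)).re = lam.im / 2 ∧
    (Complex.I * lam / 2).re = -lam.im / 2 := by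
  constructor
  · simp
    ring
  · simp

/-- A unimodular multiplier would give |u|² − |v|² equal values at both end points, while for
nonreal λ this quantity is strictly monotone. -/
theorem IsFloquetSol.norm_ne_one {ψ : ℝ → ℂ} {x y : ℝ} {lam w : ℂ} {u v : ℝ → ℂ}
    (h : IsFloquetSol ψ x y lam w u v) (hxy : x < y) (him : lam.im ≠ 0) : ‖w‖ ≠ 1 := by
  intro hw
  have e1 : ‖u y‖ = ‖u x‖ := by rw [h.left, norm_mul, hw, one_mul]
  have e2 : ‖v y‖ = ‖v x‖ := by rw [h.right, norm_mul, hw, one_mul]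
  rcases lt_or_gt_of_ne him with h0 | h0
  · have := h.isSol.swap_form.norm_sq_sub_lt (by rw [(re_spectral lam).2]; linarith) hxy
      fun z => (h.ne_zero z).symm
    rw [e1, e2] at this
    exact lt_irrefl _ this
  · have := h.isSol.norm_sq_sub_lt (by rw [(re_spectral lam).1]; linarith) hxy h.ne_zero
    rw [e1, e2] at this
    exact lt_irrefl _ this

section

variable {ψ : ℝ → ℂ} {K : ℝ} (hc : Continuous ψ) (hK : ∀ z, ‖ψ z‖ ≤ K)

include hc hK

theorem exists_isFloquetSol_norm_lt {x y : ℝ} (hxy : x < y) {lam : ℂ} (him : lam.im ≠ 0) :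
    ∃ w u v, ‖w‖ < 1 ∧ IsFloquetSol ψ x y lam w u v := by
  obtain ⟨w, hw, hroot⟩ := exists_root_norm_le (transition ψ y x lam).trace
  obtain ⟨u, v, h⟩ := exists_isFloquetSol hc hK (x := x) (y := y) (lam := lam) (w := w)
    (by rw [det_sub_smul_eq hc hK, hroot])
  exact ⟨w, u, v, lt_of_le_of_ne hw (h.norm_ne_one hxy him), h⟩

/-! ### The entire function attached to an orthogonal pair -/

section Pairing

variable {f g : ℝ → ℂ} {x y : ℝ} (hxy : x < y) (hf : IntervalIntegrable f volume x y)
  (hg : IntervalIntegrable g volume x y)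

/-- The pairing of `(f, g)` over `[x, z₀]` with the products of the solutions that are normalized
at `z₀`. -/
def normalizedPairing (ψ f g : ℝ → ℂ) (x z₀ : ℝ) (i j : Fin 2) (lam : ℂ) : ℂ :=
  ∫ s in x..z₀, pairForm f g (fun s => transition ψ s z₀ lam 0 i) (fun s => transition ψ s z₀ lam 1 i)
    (fun s => transition ψ s z₀ lam 0 j) (fun s => transition ψ s z₀ lam 1 j) s

include hf hg in
theorem differentiable_normalizedPairing {z₀ : ℝ} (hz : z₀ ∈ Set.Icc x y) (i j : Fin 2) :
    Differentiable ℂ (normalizedPairing ψ f g x z₀ i j) := by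
  have hxy : x ≤ y := hz.1.trans hz.2
  have hsub : Set.uIcc x z₀ ⊆ Set.uIcc x y := by
    rw [Set.uIcc_of_le hz.1, Set.uIcc_of_le hxy]
    exact Set.Icc_subset_Icc_right hz.2
  have hcont : ∀ lam m n, Continuous fun s => transition ψ s z₀ lam m n := fun lam m n => by
    have := isLaxSol_transition hc hK z₀ lam n
    fin_cases m
    · exact this.continuous_left
    · exact this.continuous_right
  have hbd : ∀ m, ∀ R : ℝ, ∃ C : ℝ, ∀ lam : ℂ, ‖lam‖ ≤ R → ∀ s ∈ Set.uIcc x z₀,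
      ‖transition ψ s z₀ lam m i * transition ψ s z₀ lam m j‖ ≤ C := by
    intro m R
    refine ⟨Real.exp ((R + K) * |z₀ - x|) * Real.exp ((R + K) * |z₀ - x|), fun lam hlam s hs => ?_⟩
    have hR : 0 ≤ R := (norm_nonneg _).trans hlam
    have hK0 : 0 ≤ K := (norm_nonneg _).trans (hK 0)
    have hs' : |s - z₀| ≤ |z₀ - x| := by
      rw [abs_sub_comm]
      exact Set.abs_sub_right_of_mem_uIcc hs
    have h1 : ∀ n, ‖transition ψ s z₀ lam m n‖ ≤ Real.exp ((R + K) * |z₀ - x|) := fun n =>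
      (norm_transition_le hc hK (P := R) ((Complex.abs_im_le_norm _).trans (by linarith)) z₀ s
        m n).trans (Real.exp_le_exp.2 (by gcongr))
    rw [norm_mul]
    gcongr
    · exact h1 i
    · exact h1 j
  have key : ∀ (h : ℝ → ℂ), IntervalIntegrable h volume x y → ∀ m : Fin 2, Differentiable ℂ fun lam =>
      ∫ s in x..z₀, h s * (transition ψ s z₀ lam m i * transition ψ s z₀ lam m j) := fun h hh m =>
    differentiable_integral (hh.mono_set hsub)
      (fun s => (differentiable_transition hc hK z₀ s m i).mul
        (differentiable_transition hc hK z₀ s m j))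
      (fun lam => (hcont lam m i).mul (hcont lam m j)) (hbd m)
  have e : normalizedPairing ψ f g x z₀ i j = fun lam =>
      (∫ s in x..z₀, f s * (transition ψ s z₀ lam 0 i * transition ψ s z₀ lam 0 j)) -
        ∫ s in x..z₀, g s * (transition ψ s z₀ lam 1 i * transition ψ s z₀ lam 1 j) := by
    ext lam
    rw [← intervalIntegral.integral_sub]
    · rfl
    · exact (hf.mono_set hsub).mul_continuousOn ((hcont lam 0 i).mul (hcont lam 0 j)).continuousOn
    · exact (hg.mono_set hsub).mul_continuousOn ((hcont lam 1 i).mul (hcont lam 1 j)).continuousOn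
  rw [e]
  exact (key f hf 0).sub (key g hg 1)

-- With δ = K/(2p) the second term tends to 0 directly. In the first the exponential tends to 0 off
-- the single point z₀ and is at most 1 for p ≥ K, so dominated convergence applies.
omit hc hK in
include hf hg in
theorem tendsto_pairBound (z₀ : ℝ) :
    Filter.Tendsto (fun p : ℝ => pairBound f g K x y z₀ (K / (2 * p)) p) Filter.atTop (nhds 0) := by
  have ih : IntervalIntegrable (fun s => ‖f s‖ + ‖g s‖) volume x y := hf.norm.add hg.norm
  have h1 : Filter.Tendsto (fun p : ℝ => ∫ s in x..y,
      (‖f s‖ + ‖g s‖) * Real.exp (-(2 * (p - K) * |s - z₀|))) Filter.atTop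
      (nhds (∫ s in x..y, (0 : ℝ))) := by
    refine intervalIntegral.tendsto_integral_filter_of_dominated_convergence
      (fun s => ‖f s‖ + ‖g s‖) (Filter.Eventually.of_forall fun p => ?_) ?_ ih ?_
    · exact (ih.mul_continuousOn (g := fun s => Real.exp (-(2 * (p - K) * |s - z₀|)))
        (by fun_prop)).def'.aestronglyMeasurable
    · filter_upwards [Filter.eventually_ge_atTop K] with p hp
      refine Filter.Eventually.of_forall fun s _ => ?_
      have h0 : 0 ≤ ‖f s‖ + ‖g s‖ := by positivity
      rw [norm_mul, Real.norm_of_nonneg h0, Real.norm_of_nonneg (Real.exp_pos _).le]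
      refine mul_le_of_le_one_right h0 (Real.exp_le_one_iff.2 ?_)
      have : 0 ≤ 2 * (p - K) * |s - z₀| := mul_nonneg (by linarith) (abs_nonneg _)
      linarith
    · have hne : ∀ᵐ s : ℝ, s ≠ z₀ := by simp [ae_iff, measure_singleton]
      filter_upwards [hne] with s hs _
      rw [← mul_zero (‖f s‖ + ‖g s‖)]
      refine Filter.Tendsto.const_mul _ (Real.tendsto_exp_neg_atTop_nhds_zero.comp ?_)
      have hpos : 0 < |s - z₀| := abs_pos.2 (sub_ne_zero.2 hs)
      refine Filter.Tendsto.atTop_mul_const hpos (Filter.Tendsto.const_mul_atTop two_pos ?_)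
      exact Filter.tendsto_atTop_add_const_right _ _ Filter.tendsto_id
  have h2 : Filter.Tendsto (fun p : ℝ => K / (2 * p)) Filter.atTop (nhds 0) :=
    Filter.Tendsto.const_div_atTop (Filter.Tendsto.const_mul_atTop two_pos Filter.tendsto_id) K
  have h3 := (h1.add (h2.mul_const (∫ s in x..y, (‖f s‖ + ‖g s‖)))).const_mul 16
  simpa [pairBound] using h3

variable {D : ℂ → Prop} (hD : ∀ lam, ∀ᶠ m in nhdsWithin lam {lam}ᶜ, D m)
  (H : ∀ lam w u v, D lam → lam.im ≠ 0 → ‖w‖ < 1 → IsFloquetSol ψ x y lam w u v →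
    ∫ s in x..y, pairForm f g u v u v s = 0)

include hxy hf hg hD H

/-- Orthogonality is known only where `D` holds. The exceptional points are isolated and the pairing
is continuous in λ, so the bound passes to the limit. Negative Im λ is reduced to positive by
exchanging the components together with f and g. -/
theorem norm_normalizedPairing_le {z₀ : ℝ} (hz : z₀ ∈ Set.Icc x y) (i j : Fin 2) {p δ : ℝ}
    (hpos : 0 < p) (hk : K ≤ 2 * δ * p) (hδ : 0 < δ) (hδ1 : δ ≤ 1 / 2) {lam : ℂ}
    (hlam : 2 * p < |lam.im|) :
    ‖normalizedPairing ψ f g x z₀ i j lam‖ ≤ pairBound f g K x y z₀ δ p := by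
  have hopen : ∀ᶠ m in nhdsWithin lam {lam}ᶜ, 2 * p < |m.im| := by
    have : Continuous fun m : ℂ => |m.im| := Complex.continuous_im.abs
    exact nhdsWithin_le_nhds (this.continuousAt.eventually_const_lt hlam)
  have hcont : Filter.Tendsto (fun m => ‖normalizedPairing ψ f g x z₀ i j m‖)
      (nhdsWithin lam {lam}ᶜ) (nhds ‖normalizedPairing ψ f g x z₀ i j lam‖) :=
    ((differentiable_normalizedPairing hc hK hf hg hz i j).continuous.norm.tendsto lam).mono_left
      nhdsWithin_le_nhds
  refine le_of_tendsto hcont ?_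
  filter_upwards [hopen, hD lam] with m hm hDm
  have him : m.im ≠ 0 := by
    intro h
    rw [h, abs_zero] at hm
    linarith
  obtain ⟨w, u, v, hw, hfl⟩ := exists_isFloquetSol_norm_lt hc hK hxy him
  have hint := H m w u v hDm him hw hfl
  have hT : ∀ a b, ‖transition ψ z₀ z₀ m a b‖ ≤ 1 := fun a b => by
    rw [transition_self hc hK]
    fin_cases a <;> fin_cases b <;> simp
  have hi := isLaxSol_transition hc hK z₀ m i
  have hj := isLaxSol_transition hc hK z₀ m j
  rcases lt_abs.1 hm with hm | hm
  · obtain ⟨a₁, a₂, ha, ha₁, ha₂⟩ := exists_isLaxSol hc hK m x 1 0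
    exact norm_integral_pairForm_le hK (by rw [(re_spectral m).1]; linarith) hk hδ hδ1 hz hf hg
      ha ha₁ ha₂ hfl.isSol hw hfl.left hfl.right (hfl.ne_zero z₀) hint hi (hT 0 i) (hT 1 i) hj
      (hT 0 j) (hT 1 j)
  · obtain ⟨a₁, a₂, ha, ha₁, ha₂⟩ := exists_isLaxSol hc hK m x 0 1
    have := norm_integral_pairForm_le (f := g) (g := f) (ψ := fun z => conj (ψ z))
      (k := Complex.I * m / 2) (fun z => by rw [RCLike.norm_conj]; exact hK z)
      (by rw [(re_spectral m).2]; linarith) hk hδ hδ1 hz hg hf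
      ha.swap_form ha₂ ha₁ hfl.isSol.swap_form hw hfl.right hfl.left (hfl.ne_zero z₀).symm
      (by
        rw [pairForm_swap]
        simp only [Pi.neg_apply, intervalIntegral.integral_neg, neg_eq_zero]
        exact hint)
      hi.swap_form (hT 1 i) (hT 0 i) hj.swap_form (hT 1 j) (hT 0 j)
    have e : pairBound g f K x y z₀ δ p = pairBound f g K x y z₀ δ p := by
      simp only [pairBound, add_comm ‖g _‖]
    rw [pairForm_swap] at this
    simp only [Pi.neg_apply, intervalIntegral.integral_neg, norm_neg] at this
    rw [← e]
    exact this

/-- Liouville: the Gronwall bound controls a horizontal strip, the cone estimate its complement, and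
the latter tends to 0 along the imaginary axis. -/
theorem normalizedPairing_eq_zero {z₀ : ℝ} (hz : z₀ ∈ Set.Icc x y) (i j : Fin 2) (hKpos : 0 < K) :
    normalizedPairing ψ f g x z₀ i j = 0 := by
  have hxy' : x ≤ y := hxy.le
  refine eq_zero_of_bounded_of_tendsto (differentiable_normalizedPairing hc hK hf hg hz i j)
    (C := max (pairBound f g K x y z₀ (1 / 2) K)
      (∫ s in x..z₀, (‖f s‖ + ‖g s‖) * Real.exp ((K + K) * |y - x|) ^ 2)) (fun lam => ?_) ?_
  -- Outside the strip |Im λ| ≤ 2K the values p = K and δ = 1/2 are just admissible in the cone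
  -- estimate.
  · rcases lt_or_ge (2 * K) |lam.im| with h | h
    · exact (norm_normalizedPairing_le hc hK hxy hf hg hD H hz i j hKpos (by linarith) one_half_pos
        le_rfl h).trans (le_max_left _ _)
    · refine le_trans ?_ (le_max_right _ _)
      have hsub : Set.uIcc x z₀ ⊆ Set.uIcc x y := by
        rw [Set.uIcc_of_le hz.1, Set.uIcc_of_le hxy']
        exact Set.Icc_subset_Icc_right hz.2
      refine intervalIntegral.norm_integral_le_of_norm_le hz.1 (Filter.Eventually.of_forall ?_)
        (((hf.norm.add hg.norm).mono_set hsub).mul_const _)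
      intro s hs
      have h1 : ∀ m n, ‖transition ψ s z₀ lam m n‖ ≤ Real.exp ((K + K) * |y - x|) := fun m n => by
        refine (norm_transition_le hc hK h z₀ s m n).trans (Real.exp_le_exp.2 ?_)
        refine mul_le_mul_of_nonneg_left ?_ (by positivity)
        rw [abs_of_nonneg (by linarith : 0 ≤ y - x), abs_sub_comm,
          abs_of_nonneg (by linarith [hs.2] : 0 ≤ z₀ - s)]
        linarith [hs.1, hz.2]
      refine norm_pairForm_le ?_ ?_ <;> rw [sq] <;> gcongr <;> exact h1 _ _
  -- At λ = iτ take p = τ/4: then 2p < τ strictly, and δ = K/(2p) = 2K/τ is at most 1/2 once τ ≥ 4K.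
  · have h1 := (tendsto_pairBound (K := K) hf hg z₀).comp
      (Filter.Tendsto.atTop_mul_const (by norm_num : (0 : ℝ) < 1 / 4) Filter.tendsto_id)
    refine squeeze_zero_norm' ?_ h1
    filter_upwards [Filter.eventually_gt_atTop (4 * K)] with τ hτ
    have hτ0 : 0 < τ * (1 / 4) := by linarith
    refine norm_normalizedPairing_le hc hK hxy hf hg hD H hz i j hτ0 ?_ (by simp only [id]; positivity)
      ?_ ?_
    · simp only [id]
      have hτ1 : τ ≠ 0 := (by linarith : 0 < τ).ne'
      refine le_of_eq ?_
      field_simp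
    · simp only [id]
      rw [div_le_iff₀ (by linarith)]
      linarith
    · rw [Complex.mul_im]
      simp only [Complex.I_re, Complex.I_im, Complex.ofReal_re, Complex.ofReal_im, zero_mul, one_mul,
        zero_add]
      rw [abs_of_pos (by linarith)]
      linarith

/-- Pairs `(f, g)` orthogonal to the squared decaying Floquet solutions vanish. -/
theorem ae_eq_zero_of_orthogonal (hKpos : 0 < K) :
    (∀ᵐ s ∂volume.restrict (Set.Ioc x y), f s = 0) ∧
      ∀ᵐ s ∂volume.restrict (Set.Ioc x y), g s = 0 := by
  obtain ⟨a₁, a₂, ha, ha₁, ha₂⟩ := exists_isLaxSol hc hK 0 x 1 0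
  obtain ⟨b₁, b₂, hb, hb₁, hb₂⟩ := exists_isLaxSol hc hK 0 x 0 1
  have key : ∀ {u v u' v' : ℝ → ℂ}, IsLaxSol ψ 0 u v → IsLaxSol ψ 0 u' v' →
      ∀ᵐ s ∂volume.restrict (Set.Ioc x y), pairForm f g u v u' v' s = 0 := by
    intro u v u' v' h h'
    refine ae_eq_zero_of_primitive_eq_zero hxy.le (intervalIntegrable_pairForm hf hg
      h.continuous_left h.continuous_right h'.continuous_left h'.continuous_right) fun z₀ hz => ?_
    have hsub : Set.uIcc x z₀ ⊆ Set.uIcc x y := by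
      rw [Set.uIcc_of_le hz.1, Set.uIcc_of_le hxy.le]
      exact Set.Icc_subset_Icc_right hz.2
    have hi : ∀ i j, IntervalIntegrable (pairForm f g (fun s => transition ψ s z₀ 0 0 i)
        (fun s => transition ψ s z₀ 0 1 i) (fun s => transition ψ s z₀ 0 0 j)
        (fun s => transition ψ s z₀ 0 1 j)) volume x z₀ := fun i j => by
      have h1 := isLaxSol_transition hc hK z₀ 0 i
      have h2 := isLaxSol_transition hc hK z₀ 0 j
      exact intervalIntegrable_pairForm (hf.mono_set hsub) (hg.mono_set hsub) h1.continuous_left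
        h1.continuous_right h2.continuous_left h2.continuous_right
    have h0 : ∀ i j, ∫ s in x..z₀, pairForm f g (fun s => transition ψ s z₀ 0 0 i)
        (fun s => transition ψ s z₀ 0 1 i) (fun s => transition ψ s z₀ 0 0 j)
        (fun s => transition ψ s z₀ 0 1 j) s = 0 := fun i j =>
      congrFun (normalizedPairing_eq_zero hc hK hxy hf hg hD H hz i j hKpos) 0
    -- Re-expansion at the moving end point z₀: the coefficients do not depend on s, so each
    -- primitive is a combination of normalized pairings, all of which vanish.
    have e : ∀ s, pairForm f g u v u' v' s =
        (u z₀ * u' z₀) * pairForm f g (fun s => transition ψ s z₀ 0 0 0)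
          (fun s => transition ψ s z₀ 0 1 0) (fun s => transition ψ s z₀ 0 0 0)
          (fun s => transition ψ s z₀ 0 1 0) s +
        (u z₀ * v' z₀ + v z₀ * u' z₀) * pairForm f g (fun s => transition ψ s z₀ 0 0 0)
          (fun s => transition ψ s z₀ 0 1 0) (fun s => transition ψ s z₀ 0 0 1)
          (fun s => transition ψ s z₀ 0 1 1) s +
        (v z₀ * v' z₀) * pairForm f g (fun s => transition ψ s z₀ 0 0 1)
          (fun s => transition ψ s z₀ 0 1 1) (fun s => transition ψ s z₀ 0 0 1)
          (fun s => transition ψ s z₀ 0 1 1) s := by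
      intro s
      have e1 := h.eq_transition hc hK z₀ s
      have e2 := h'.eq_transition hc hK z₀ s
      simp only [pairForm]
      rw [e1.1, e1.2, e2.1, e2.2]
      ring
    simp only [e]
    rw [intervalIntegral.integral_add (((hi 0 0).const_mul _).add ((hi 0 1).const_mul _))
      ((hi 1 1).const_mul _), intervalIntegral.integral_add ((hi 0 0).const_mul _)
      ((hi 0 1).const_mul _)]
    simp only [intervalIntegral.integral_const_mul, h0, mul_zero, add_zero]
  have hW : ∀ s, a₁ s * b₂ s - a₂ s * b₁ s = 1 := fun s => by
    rw [ha.wronskian_eq hb s x, ha₁, ha₂, hb₁, hb₂]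
    simp
  constructor
  -- The three products of a fundamental system recover f through f·W² = b₂²·(aa) − 2a₂b₂·(ab) +
  -- a₂²·(bb), where W = 1 is the Wronskian; g is obtained in the same way with a₁, b₁.
  · filter_upwards [key ha ha, key ha hb, key hb hb] with s h1 h2 h3
    simp only [pairForm] at h1 h2 h3
    linear_combination (-f s * (a₁ s * b₂ s - a₂ s * b₁ s + 1)) * hW s + b₂ s ^ 2 * h1 -
      2 * a₂ s * b₂ s * h2 + a₂ s ^ 2 * h3
  · filter_upwards [key ha ha, key ha hb, key hb hb] with s h1 h2 h3
    simp only [pairForm] at h1 h2 h3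
    linear_combination (-g s * (a₁ s * b₂ s - a₂ s * b₁ s + 1)) * hW s - b₁ s ^ 2 * h1 +
      2 * a₁ s * b₁ s * h2 - a₁ s ^ 2 * h3

end Pairing

end

/-! ### Nonvanishing of the off-diagonal monodromy entry -/

/-- The off-diagonal entry of the monodromy matrix determines whether the potential vanishes. -/
theorem eq_zero_of_transition_offdiag_eq_zero {ψ : ℝ → ℂ} {K : ℝ} (hc : Continuous ψ)
    (hK : ∀ z, ‖ψ z‖ ≤ K) (hKpos : 0 < K) {x y : ℝ} (hxy : x < y)
    (h0 : ∀ lam, transition ψ y x lam 0 1 = 0) {z : ℝ} (hz : z ∈ Set.Ioo x y) : ψ z = 0 := by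
  have hsol := fun lam => isLaxSol_transition hc hK x lam 1
  have hself : ∀ lam, transition ψ x x lam = 1 := transition_self hc hK x
  have hne : ∀ lam z, transition ψ z x lam 0 1 ≠ 0 ∨ transition ψ z x lam 1 1 ≠ 0 := fun lam =>
    (hsol lam).ne_zero hc hK (x := x) (by simp [hself])
  -- the decay in the upper half plane
  have hdecay : ∀ z ∈ Set.Icc x y, ∀ lam : ℂ, 0 < lam.im → ∀ δ : ℝ, 0 < δ → δ ≤ 1 → K ≤ δ * lam.im →
      Real.exp (lam.im / 2 * (z - x)) * ‖transition ψ z x lam 0 1‖ ≤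
        δ * Real.exp (K * (z - x)) := by
    intro z hz lam him δ hδ hδ1 hk
    have hre := (re_spectral lam).1
    -- Since the upper entry vanishes at both ends, the second column is a Floquet solution. Strict
    -- growth of |u|² − |v|² from the value −1 makes its multiplier less than 1 in modulus, so it
    -- decays.
    have hw : ‖transition ψ y x lam 1 1‖ < 1 := by
      have := (hsol lam).norm_sq_sub_lt (by rw [hre]; linarith) hxy (hne lam)
      simp [hself, h0] at this
      exact this
    have hcone : ∀ s ∈ Set.Icc x y, ∀ δ : ℝ, 0 < δ → δ ≤ 1 → K ≤ δ * lam.im →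
        ‖transition ψ s x lam 0 1‖ ≤ δ * ‖transition ψ s x lam 1 1‖ := fun s hs δ hδ hδ1 hk =>
      (hsol lam).norm_left_le_of_floquet hK (by rw [hre]; linarith) hδ hδ1 hw
        (by simp [hself, h0]) (by simp [hself]) hs
    have h1 := (hsol lam).exp_mul_norm_sq_right_le hK hz.1 fun s hs => by
      have := hcone s ⟨hs.1, hs.2.trans hz.2⟩ 1 one_pos le_rfl (by nlinarith)
      rwa [one_mul] at this
    rw [hself, hre] at h1
    simp only [Matrix.one_apply_eq, norm_one, one_pow] at h1
    have e : Real.exp (2 * (lam.im / 2 - K) * (z - x)) * ‖transition ψ z x lam 1 1‖ ^ 2 =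
        (Real.exp ((lam.im / 2 - K) * (z - x)) * ‖transition ψ z x lam 1 1‖) ^ 2 := by
      rw [mul_pow, ← Real.exp_nat_mul]
      congr 2
      push_cast
      ring
    rw [e] at h1
    have h2 := (sq_le_one_iff₀ (by positivity)).1 h1
    have h3 := hcone z hz δ hδ hδ1 hk
    calc _ ≤ Real.exp (lam.im / 2 * (z - x)) * (δ * ‖transition ψ z x lam 1 1‖) := by gcongr
      _ = δ * (Real.exp (K * (z - x)) *
          (Real.exp ((lam.im / 2 - K) * (z - x)) * ‖transition ψ z x lam 1 1‖)) := by
        have : Real.exp (lam.im / 2 * (z - x)) =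
            Real.exp (K * (z - x)) * Real.exp ((lam.im / 2 - K) * (z - x)) := by
          rw [← Real.exp_add]
          congr 1
          ring
        rw [this]
        ring
      _ ≤ _ := by
        have := mul_le_mul_of_nonneg_left h2 (Real.exp_pos (K * (z - x))).le
        have := mul_le_mul_of_nonneg_left this hδ.le
        linarith
  have hzero : ∀ z ∈ Set.Icc x y, transition ψ z x 0 0 1 = 0 := by
    intro z hz
    have hd : 0 ≤ z - x := sub_nonneg.2 hz.1
    have hnorm : ∀ lam : ℂ, ‖Complex.exp (-(Complex.I * lam / 2) * ((z - x : ℝ) : ℂ)) *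
        transition ψ z x lam 0 1‖ =
        Real.exp (lam.im / 2 * (z - x)) * ‖transition ψ z x lam 0 1‖ := fun lam => by
      rw [norm_mul, Complex.norm_exp, Complex.re_mul_ofReal, (re_spectral lam).1]
    -- The factor exp(−iλ(z − x)/2) cancels the exponential growth of the entry in the lower half
    -- plane; in the upper half plane, where the factor grows, the decay of the Floquet solution
    -- compensates it.
    have := eq_zero_of_bounded_of_tendsto (F := fun lam =>
      Complex.exp (-(Complex.I * lam / 2) * ((z - x : ℝ) : ℂ)) * transition ψ z x lam 0 1)
      ((by fun_prop : Differentiable ℂ fun lam : ℂ =>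
        Complex.exp (-(Complex.I * lam / 2) * ((z - x : ℝ) : ℂ))).mul
        (differentiable_transition hc hK x z 0 1)) (C := Real.exp (3 * K * (z - x)))
      (fun lam => ?_) ?_
    · have h1 := congrFun this 0
      simpa using h1
    · rw [hnorm]
      rcases le_or_gt (2 * K) lam.im with h | h
      · refine (hdecay z hz lam (by linarith) 1 one_pos le_rfl (by linarith)).trans ?_
        rw [one_mul]
        gcongr
        linarith
      · have h1 := norm_transition_le hc hK (P := |lam.im| / 2) (lam := lam) (by linarith) x z 0 1
        refine (mul_le_mul_of_nonneg_left h1 (Real.exp_pos _).le).trans ?_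
        rw [← Real.exp_add, abs_of_nonneg hd, ← add_mul]
        gcongr
        rcases abs_cases lam.im with ⟨h2, -⟩ | ⟨h2, -⟩ <;> rw [h2] <;> linarith
    · have hlim : Filter.Tendsto (fun τ : ℝ => K / τ * Real.exp (K * (z - x))) Filter.atTop
          (nhds 0) := by
        have := (Filter.Tendsto.const_div_atTop Filter.tendsto_id K).mul_const
          (Real.exp (K * (z - x)))
        simpa using this
      refine squeeze_zero_norm' ?_ hlim
      filter_upwards [Filter.eventually_ge_atTop K] with τ hτ
      have hτ0 : 0 < τ := by linarith
      have him : (Complex.I * τ).im = τ := by simp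
      rw [hnorm]
      refine hdecay z hz _ (by rw [him]; exact hτ0) _ (by positivity) ?_ ?_
      · rwa [div_le_one hτ0]
      · rw [him, div_mul_cancel₀ _ hτ0.ne']
  -- The upper component vanishes identically, so its equation reduces to conj ψ times the lower
  -- component, which cannot vanish as well.
  have h1 := (hsol 0).left z
  have h2 : HasDerivAt (fun z => transition ψ z x 0 0 1) 0 z := by
    refine (hasDerivAt_const z (0 : ℂ)).congr_of_eventuallyEq ?_
    filter_upwards [Ioo_mem_nhds hz.1 hz.2] with s hs
    exact hzero s (Set.Ioo_subset_Icc_self hs)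
  have h3 := h1.unique h2
  rw [hzero z (Set.Ioo_subset_Icc_self hz), mul_zero, zero_add, mul_eq_zero] at h3
  rcases h3 with h3 | h3
  · simpa using h3
  · exact absurd h3 ((hne 0 z).resolve_left fun h => h (hzero z (Set.Ioo_subset_Icc_self hz)))

/-- This is where a nonzero potential is needed: at ψ = 0 the monodromy matrix is diagonal for every
λ. -/
theorem exists_monodromy_offdiag_ne_zero {l : ℝ} (hl : 0 < l) {ψ : phaseSpace l} (hψ : ψ ≠ 0) :
    ∃ lam, transition ψ l (-l) lam 0 1 ≠ 0 := by
  obtain ⟨K, hKpos, hK⟩ := exists_bound_potential hl ψ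
  by_contra! h0
  refine hψ (Subtype.ext (funext fun z => ?_))
  have hc := continuous_potential ψ
  have h1 : Set.Ioo (-l) l ⊆ {z | (ψ : ℝ → ℂ) z = 0} := fun z hz =>
    eq_zero_of_transition_offdiag_eq_zero hc hK hKpos (by linarith) h0 hz
  have h2 := (isClosed_eq hc continuous_const).closure_subset_iff.2 h1
  rw [closure_Ioo (by linarith)] at h2
  obtain ⟨y, hy, e⟩ := ψ.2.2.exists_mem_Ico (by positivity) z (-l)
  rw [e]
  exact h2 ⟨hy.1, by linarith [hy.2]⟩

/-! ### Square integrable functions over one period -/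

variable {l : ℝ}

theorem intervalIntegrable_L2 (hl : 0 < l) (a : L2 l) : IntervalIntegrable a volume (-l) l := by
  rw [intervalIntegrable_iff_integrableOn_Ioc_of_le (by linarith)]
  exact (Lp.memLp a).integrable one_le_two

theorem memLp_of_continuous {f : ℝ → ℂ} (hf : Continuous f) :
    MemLp f 2 (volume.restrict (Set.Ioc (-l) l)) := by
  obtain ⟨C, hC⟩ := isCompact_Icc.exists_bound_of_continuousOn (hf.continuousOn (s := Set.Icc (-l) l))
  refine MemLp.of_bound hf.aestronglyMeasurable C ?_
  filter_upwards [ae_restrict_mem measurableSet_Ioc] with z hz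
  exact hC z (Set.Ioc_subset_Icc_self hz)

/-- The class of a continuous function in `L²`. -/
def toL2 (l : ℝ) (f : ℝ → ℂ) (hf : Continuous f) : L2 l := (memLp_of_continuous hf).toLp f

theorem coeFn_toL2 {f : ℝ → ℂ} (hf : Continuous f) :
    ⇑(toL2 l f hf) =ᵐ[volume.restrict (Set.Ioc (-l) l)] f :=
  MemLp.coeFn_toLp _

theorem integral_congr_period {F G : ℝ → ℂ} (hl : 0 < l)
    (h : F =ᵐ[volume.restrict (Set.Ioc (-l) l)] G) : ∫ z in (-l)..l, F z = ∫ z in (-l)..l, G z := by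
  rw [intervalIntegral.integral_of_le (by linarith), intervalIntegral.integral_of_le (by linarith)]
  exact integral_congr_ae h

/-- The bilinear pairing `∫ a b` over one period. -/
def pairing (a : L2 l) : L2 l →L[ℂ] ℂ := innerSL ℂ (star a)

theorem pairing_apply (hl : 0 < l) (a b : L2 l) : pairing a b = ∫ z in (-l)..l, a z * b z := by
  rw [pairing, innerSL_apply_apply, L2.inner_def, intervalIntegral.integral_of_le (by linarith)]
  refine integral_congr_ae ?_
  filter_upwards [Lp.coeFn_star a] with z hz
  rw [hz]
  simp [mul_comm]

theorem pairing_toL2_right (hl : 0 < l) (a : L2 l) {f : ℝ → ℂ} (hf : Continuous f) :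
    pairing a (toL2 l f hf) = ∫ z in (-l)..l, a z * f z := by
  rw [pairing_apply hl]
  refine integral_congr_period hl ?_
  filter_upwards [coeFn_toL2 (l := l) hf] with z hz
  rw [hz]

theorem pairing_comm (hl : 0 < l) (a b : L2 l) : pairing a b = pairing b a := by
  rw [pairing_apply hl, pairing_apply hl]
  simp only [mul_comm]

theorem exists_eq_pairing (Λ : L2 l →L[ℂ] ℂ) : ∃ r : L2 l, Λ = pairing r := by
  refine ⟨star ((InnerProductSpace.toDual ℂ (L2 l)).symm Λ), ?_⟩
  ext b
  rw [pairing, star_star, innerSL_apply_apply, InnerProductSpace.toDual_symm_apply]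

/-- Periodic extension of a smooth function with compact support in one period. -/
theorem exists_periodic_extension (hl : 0 < l) {g : ℝ → ℝ} (hg : ContDiff ℝ ∞ g)
    (hsupp : tsupport g ⊆ Set.Ioo (-l) l) :
    ∃ φ : phaseSpace l, ∀ z ∈ Set.Ioc (-l) l, (φ : ℝ → ℂ) z = g z := by
  have hp : (0 : ℝ) < 2 * l := by linarith
  have hz : ∀ z, z ∉ Set.Ioo (-l) l → g z = 0 := fun z h =>
    image_eq_zero_of_notMem_tsupport fun h' => h (hsupp h')
  set φ : ℝ → ℂ := fun z => (g (toIocMod hp (-l) z) : ℂ) with hφ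
  have hper : Function.Periodic φ (2 * l) := fun z => by
    simp only [hφ, toIocMod_add_right]
  have hmem : ∀ z ∈ Set.Ioc (-l) l, φ z = g z := fun z h => by
    simp only [hφ]
    rw [(toIocMod_eq_self hp).2 (by rwa [show -l + 2 * l = l by ring])]
  have hgc : ContDiff ℝ ∞ fun z => (g z : ℂ) := Complex.ofRealCLM.contDiff.comp hg
  have hat : ∀ z ∈ Set.Ioc (-l) l, ContDiffAt ℝ ∞ φ z := by
    intro z h
    rcases h.2.eq_or_lt with rfl | hlt
    · -- near the end point of the period the function vanishes
      have h1 : ∀ᶠ s in nhds z, s ∉ tsupport g :=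
        (isClosed_tsupport g).isOpen_compl.mem_nhds fun h' => lt_irrefl _ (hsupp h').2
      have h2 : ∀ᶠ s in nhds z, s - 2 * z ∉ tsupport g := by
        have hcont : Continuous fun s : ℝ => s - 2 * z := by fun_prop
        refine hcont.continuousAt.eventually ((isClosed_tsupport g).isOpen_compl.mem_nhds ?_)
        intro h'
        have := (hsupp h').1
        linarith
      refine (contDiffAt_const (c := (0 : ℂ))).congr_of_eventuallyEq ?_
      filter_upwards [h1, h2, Ioo_mem_nhds h.1 (by linarith : z < z + 2 * z)] with s hs1 hs2 hs
      rcases le_or_gt s z with hle | hgt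
      · rw [hmem s ⟨hs.1, hle⟩, image_eq_zero_of_notMem_tsupport hs1, Complex.ofReal_zero]
      · rw [← hper.sub_eq, hmem (s - 2 * z) ⟨by linarith, by linarith [hs.2]⟩,
          image_eq_zero_of_notMem_tsupport hs2, Complex.ofReal_zero]
    · refine hgc.contDiffAt.congr_of_eventuallyEq ?_
      filter_upwards [Ioo_mem_nhds h.1 hlt] with s hs
      exact hmem s (Set.Ioo_subset_Ioc_self hs)
  refine ⟨⟨φ, contDiff_iff_contDiffAt.2 fun z => ?_, hper⟩, hmem⟩
  have h1 := hat (toIocMod hp (-l) z) (by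
    have := toIocMod_mem_Ioc hp (-l) z
    rwa [show -l + 2 * l = l by ring] at this)
  have e : φ = φ ∘ fun s => s - toIocDiv hp (-l) z • (2 * l) := by
    ext s
    exact (hper.sub_zsmul_eq _).symm
  rw [e]
  exact ContDiffAt.comp z h1 (contDiffAt_id.sub contDiffAt_const)

/-- The functions of the phase space separate the points of `L²`. -/
theorem eq_zero_of_pairing_phaseSpace (hl : 0 < l) {a : L2 l}
    (h : ∀ φ : phaseSpace l, ∫ z in (-l)..l, a z * (φ : ℝ → ℂ) z = 0) : a = 0 := by
  have hint : IntegrableOn a (Set.Ioc (-l) l) volume := (Lp.memLp a).integrable one_le_two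
  have h0 := isOpen_Ioo.ae_eq_zero_of_integral_contDiff_smul_eq_zero (μ := volume)
    (U := Set.Ioo (-l) l) (hint.mono_set Set.Ioo_subset_Ioc_self).locallyIntegrableOn
    fun g hg _ hsupp => by
      obtain ⟨φ, hφ⟩ := exists_periodic_extension hl hg hsupp
      rw [← setIntegral_eq_integral_of_forall_compl_eq_zero (s := Set.Ioc (-l) l),
        ← h φ, intervalIntegral.integral_of_le (by linarith)]
      · refine setIntegral_congr_fun measurableSet_Ioc fun z hz => ?_
        simp only [hφ z hz, Complex.real_smul]
        ring
      · intro z hz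
        rw [image_eq_zero_of_notMem_tsupport fun h' => hz (Set.Ioo_subset_Ioc_self (hsupp h')),
          zero_smul]
  have hIoc : ∀ g : ℝ → ℂ, (∀ᵐ z, z ∈ Set.Ioo (-l) l → g z = 0) →
      g =ᵐ[volume.restrict (Set.Ioc (-l) l)] 0 := fun g hg => by
    rw [← Measure.restrict_congr_set Ioo_ae_eq_Ioc]
    exact (ae_restrict_iff' measurableSet_Ioo).2 hg
  exact (Lp.eq_zero_iff_ae_eq_zero).2 (hIoc a h0)

/-- The complex conjugate of a potential. -/
def conjPotential (φ : phaseSpace l) : phaseSpace l :=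
  ⟨fun z => conj ((φ : ℝ → ℂ) z), Complex.conjCLE.contDiff.comp φ.2.1, fun z => by
    simp only [φ.2.2 z]⟩

theorem intervalIntegrable_L2_mul (hl : 0 < l) (a : L2 l) {f : ℝ → ℂ} (hf : Continuous f) :
    IntervalIntegrable (fun z => a z * f z) volume (-l) l :=
  (intervalIntegrable_L2 hl a).mul_continuousOn hf.continuousOn

theorem continuous_conj_potential (φ : phaseSpace l) :
    Continuous fun z => conj ((φ : ℝ → ℂ) z) :=
  Complex.continuous_conj.comp (continuous_potential φ)

theorem covector_pairing_eq (hl : 0 < l) (ξ : Covector l) (φ : phaseSpace l) :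
    ∫ z in (-l)..l, (ξ.1 z * (φ : ℝ → ℂ) z + ξ.2 z * conj ((φ : ℝ → ℂ) z)) =
      pairing ξ.1 (toL2 l φ (continuous_potential φ)) +
        pairing ξ.2 (toL2 l _ (continuous_conj_potential φ)) := by
  rw [pairing_toL2_right hl, pairing_toL2_right hl, intervalIntegral.integral_add
    (intervalIntegrable_L2_mul hl _ (continuous_potential φ))
    (intervalIntegrable_L2_mul hl _ (continuous_conj_potential φ))]

theorem eq_zero_of_pairing_toL2 (hl : 0 < l) {a : L2 l}
    (h : ∀ φ : phaseSpace l, pairing a (toL2 l φ (continuous_potential φ)) = 0) : a = 0 :=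
  eq_zero_of_pairing_phaseSpace hl fun φ => by
    rw [← pairing_toL2_right hl a (continuous_potential φ), h φ]

theorem toL2_smul {f : ℝ → ℂ} (hf : Continuous f) (c : ℂ) :
    toL2 l (c • f) (hf.const_smul c) = c • toL2 l f hf := rfl

/-- Variational derivatives are unique. -/
theorem HasVariation.unique (hl : 0 < l) {A : phaseSpace l → ℂ} {ψ : phaseSpace l}
    {ξ η : Covector l} (h : HasVariation A ψ ξ) (h' : HasVariation A ψ η) : ξ = η := by
  have h1 : ∀ φ : phaseSpace l,
      pairing ξ.1 (toL2 l φ (continuous_potential φ)) +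
        pairing ξ.2 (toL2 l _ (continuous_conj_potential φ)) =
      pairing η.1 (toL2 l φ (continuous_potential φ)) +
        pairing η.2 (toL2 l _ (continuous_conj_potential φ)) := fun φ => by
    rw [← covector_pairing_eq hl, ← covector_pairing_eq hl]
    exact (h φ).unique (h' φ)
  -- Testing with φ and iφ separates the part linear in φ from the antilinear one.
  have h2 : ∀ φ : phaseSpace l,
      pairing ξ.1 (toL2 l φ (continuous_potential φ)) =
        pairing η.1 (toL2 l φ (continuous_potential φ)) ∧
      pairing ξ.2 (toL2 l _ (continuous_conj_potential φ)) =
        pairing η.2 (toL2 l _ (continuous_conj_potential φ)) := fun φ => by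
    have e1 := h1 φ
    have e2 := h1 (Complex.I • φ)
    have e3 : toL2 l _ (continuous_potential (Complex.I • φ)) =
        Complex.I • toL2 l φ (continuous_potential φ) := toL2_smul _ _
    have e4 : toL2 l _ (continuous_conj_potential (Complex.I • φ)) =
        (-Complex.I) • toL2 l _ (continuous_conj_potential φ) := by
      rw [← toL2_smul]
      congr 1
      ext z
      simp
    rw [e3, e4] at e2
    simp only [map_smul, smul_eq_mul] at e2
    constructor
    · linear_combination e1 / 2 - Complex.I * e2 / 2 - Complex.I_sq / 2 *
        (pairing ξ.1 (toL2 l φ (continuous_potential φ)) -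
          pairing η.1 (toL2 l φ (continuous_potential φ)) -
          pairing ξ.2 (toL2 l _ (continuous_conj_potential φ)) +
          pairing η.2 (toL2 l _ (continuous_conj_potential φ))) * (-1)
    · linear_combination e1 / 2 + Complex.I * e2 / 2 - Complex.I_sq / 2 *
        (pairing ξ.1 (toL2 l φ (continuous_potential φ)) -
          pairing η.1 (toL2 l φ (continuous_potential φ)) -
          pairing ξ.2 (toL2 l _ (continuous_conj_potential φ)) +
          pairing η.2 (toL2 l _ (continuous_conj_potential φ)))
  have h3 : ∀ a b c : L2 l, pairing (a - b) c = pairing a c - pairing b c := fun a b c => by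
    rw [pairing_comm hl, map_sub, pairing_comm hl c, pairing_comm hl c]
  refine Prod.ext (sub_eq_zero.1 (eq_zero_of_pairing_toL2 hl fun φ => ?_))
    (sub_eq_zero.1 (eq_zero_of_pairing_toL2 hl fun φ => ?_))
  · rw [h3, (h2 φ).1, sub_self]
  · have e : toL2 l φ (continuous_potential φ) =
        toL2 l _ (continuous_conj_potential (conjPotential φ)) := by
      congr 1
      ext z
      simp [conjPotential]
    rw [h3, e, (h2 (conjPotential φ)).2, sub_self]

theorem variation_eq (hl : 0 < l) {A : phaseSpace l → ℂ} {ψ : phaseSpace l} {ξ : Covector l}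
    (h : HasVariation A ψ ξ) : variation A ψ = ξ := by
  have hex : ∃ ξ, HasVariation A ψ ξ := ⟨ξ, h⟩
  rw [variation, dif_pos hex]
  exact hex.choose_spec.unique hl h

/-! ### Field variables and the canonical form -/

theorem hasVariation_psiField (hl : 0 < l) (f ψ : phaseSpace l) :
    HasVariation (psiField f) ψ (toL2 l f (continuous_potential f), 0) := by
  intro φ
  have hf := continuous_potential f
  have hφ := continuous_potential φ
  have hψ := continuous_potential ψ
  have e : ∀ t : ℝ, psiField f (ψ + (t : ℂ) • φ) =
      (∫ z in (-l)..l, (f : ℝ → ℂ) z * (ψ : ℝ → ℂ) z) +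
        t * ∫ z in (-l)..l, (f : ℝ → ℂ) z * (φ : ℝ → ℂ) z := fun t => by
    rw [← intervalIntegral.integral_const_mul, ← intervalIntegral.integral_add
      (by exact (hf.mul hψ).intervalIntegrable _ _)
      (by exact (continuous_const.mul (hf.mul hφ)).intervalIntegrable _ _), psiField]
    refine intervalIntegral.integral_congr fun z _ => ?_
    simp only [Submodule.coe_add, Submodule.coe_smul, Pi.add_apply, Pi.smul_apply, smul_eq_mul]
    ring
  have hd : HasDerivAt (fun t : ℝ => (∫ z in (-l)..l, (f : ℝ → ℂ) z * (ψ : ℝ → ℂ) z) +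
        t * ∫ z in (-l)..l, (f : ℝ → ℂ) z * (φ : ℝ → ℂ) z)
      (∫ z in (-l)..l, (f : ℝ → ℂ) z * (φ : ℝ → ℂ) z) 0 := by
    have := ((Complex.ofRealCLM.hasDerivAt (x := (0 : ℝ))).mul_const
      (∫ z in (-l)..l, (f : ℝ → ℂ) z * (φ : ℝ → ℂ) z)).const_add
      (∫ z in (-l)..l, (f : ℝ → ℂ) z * (ψ : ℝ → ℂ) z)
    simpa using this
  simp only [e]
  refine hd.congr_deriv (integral_congr_period hl ?_)
  filter_upwards [coeFn_toL2 (l := l) hf, Lp.coeFn_zero ℂ 2 (volume.restrict (Set.Ioc (-l) l))]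
    with z h1 h2
  rw [h1, h2]
  simp

theorem hasVariation_psiBarField (hl : 0 < l) (f ψ : phaseSpace l) :
    HasVariation (psiBarField f) ψ (0, toL2 l f (continuous_potential f)) := by
  intro φ
  have hf := continuous_potential f
  have hφ := continuous_conj_potential φ
  have hψ := continuous_conj_potential ψ
  have e : ∀ t : ℝ, psiBarField f (ψ + (t : ℂ) • φ) =
      (∫ z in (-l)..l, (f : ℝ → ℂ) z * conj ((ψ : ℝ → ℂ) z)) +
        t * ∫ z in (-l)..l, (f : ℝ → ℂ) z * conj ((φ : ℝ → ℂ) z) := fun t => by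
    rw [← intervalIntegral.integral_const_mul, ← intervalIntegral.integral_add
      (by exact (hf.mul hψ).intervalIntegrable _ _)
      (by exact (continuous_const.mul (hf.mul hφ)).intervalIntegrable _ _), psiBarField]
    refine intervalIntegral.integral_congr fun z _ => ?_
    simp only [Submodule.coe_add, Submodule.coe_smul, Pi.add_apply, Pi.smul_apply, smul_eq_mul,
      map_add, map_mul, Complex.conj_ofReal]
    ring
  have hd : HasDerivAt (fun t : ℝ => (∫ z in (-l)..l, (f : ℝ → ℂ) z * conj ((ψ : ℝ → ℂ) z)) +
        t * ∫ z in (-l)..l, (f : ℝ → ℂ) z * conj ((φ : ℝ → ℂ) z))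
      (∫ z in (-l)..l, (f : ℝ → ℂ) z * conj ((φ : ℝ → ℂ) z)) 0 := by
    have := ((Complex.ofRealCLM.hasDerivAt (x := (0 : ℝ))).mul_const
      (∫ z in (-l)..l, (f : ℝ → ℂ) z * conj ((φ : ℝ → ℂ) z))).const_add
      (∫ z in (-l)..l, (f : ℝ → ℂ) z * conj ((ψ : ℝ → ℂ) z))
    simpa using this
  simp only [e]
  refine hd.congr_deriv (integral_congr_period hl ?_)
  filter_upwards [coeFn_toL2 (l := l) hf, Lp.coeFn_zero ℂ 2 (volume.restrict (Set.Ioc (-l) l))]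
    with z h1 h2
  rw [h1, h2]
  simp

/-- The canonical form `2i ∫ (ξ₂ η₁ - ξ₁ η₂)` on covectors. -/
def canonicalForm (ξ : Covector l) : Covector l →L[ℂ] ℂ :=
  (2 * Complex.I) • ((pairing ξ.2).comp (ContinuousLinearMap.fst ℂ (L2 l) (L2 l)) -
    (pairing ξ.1).comp (ContinuousLinearMap.snd ℂ (L2 l) (L2 l)))

theorem canonicalForm_apply (ξ η : Covector l) :
    canonicalForm ξ η = 2 * Complex.I * (pairing ξ.2 η.1 - pairing ξ.1 η.2) := rfl

theorem canonicalForm_skew (hl : 0 < l) (ξ η : Covector l) :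
    canonicalForm ξ η = -canonicalForm η ξ := by
  rw [canonicalForm_apply, canonicalForm_apply, pairing_comm hl ξ.2, pairing_comm hl ξ.1]
  ring

theorem nlsBracket_eq (hl : 0 < l) (A B : phaseSpace l → ℂ) (ψ : phaseSpace l) :
    nlsBracket A B ψ = canonicalForm (variation A ψ) (variation B ψ) := by
  have hi : ∀ a b : L2 l, IntervalIntegrable (fun z => a z * b z) volume (-l) l := fun a b => by
    rw [intervalIntegrable_iff_integrableOn_Ioc_of_le (by linarith)]
    exact (Lp.memLp a).integrable_mul (Lp.memLp b)
  rw [canonicalForm_apply, pairing_apply hl, pairing_apply hl, nlsBracket,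
    intervalIntegral.integral_sub (hi _ _) (hi _ _)]

theorem isNLSBracketAt_of_form_eq (hl : 0 < l) {J : PoissonTensor l} {ψ : phaseSpace l}
    (h : ∀ ξ η, J.form ψ ξ η = canonicalForm ξ η) : IsNLSBracketAt J ψ := fun A B _ _ => by
  rw [nlsBracket_eq hl, PoissonTensor.bracket, h]

/-- A functional on covectors that vanishes on the variations of the fields vanishes. -/
theorem eq_zero_of_fields (hl : 0 < l) {Λ : Covector l →L[ℂ] ℂ}
    (h1 : ∀ f : phaseSpace l, Λ (toL2 l f (continuous_potential f), 0) = 0)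
    (h2 : ∀ f : phaseSpace l, Λ (0, toL2 l f (continuous_potential f)) = 0) : Λ = 0 := by
  obtain ⟨r, hr⟩ := exists_eq_pairing (Λ.comp (ContinuousLinearMap.inl ℂ (L2 l) (L2 l)))
  obtain ⟨s, hs⟩ := exists_eq_pairing (Λ.comp (ContinuousLinearMap.inr ℂ (L2 l) (L2 l)))
  have hr0 : r = 0 := eq_zero_of_pairing_toL2 hl fun φ => by
    rw [← hr]
    exact h1 φ
  have hs0 : s = 0 := eq_zero_of_pairing_toL2 hl fun φ => by
    rw [← hs]
    exact h2 φ
  have h0 : ∀ b : L2 l, pairing (0 : L2 l) b = 0 := fun b => by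
    rw [pairing_comm hl, map_zero]
  ext ξ
  · have := DFunLike.congr_fun hr ξ
    rw [hr0, h0] at this
    exact this
  · have := DFunLike.congr_fun hs ξ
    rw [hs0, h0] at this
    exact this

/-- The covectors of the field variables separate bounded functionals, so their brackets fix the
form in one argument, and then by skew-symmetry in the other. The relation for (ψ, ψ̄) is obtained
from the one for (ψ̄, ψ) by skew-symmetry. -/
theorem form_eq_of_canonicalRelations (hl : 0 < l) {J : PoissonTensor l} {ψ : phaseSpace l}
    (h : CanonicalRelations J ψ) (ξ η : Covector l) : J.form ψ ξ η = canonicalForm ξ η := by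
  have h0 : ∀ b : L2 l, pairing (0 : L2 l) b = 0 := fun b => by
    rw [pairing_comm hl, map_zero]
  have hrel : ∀ f g : phaseSpace l,
      J.form ψ (toL2 l f (continuous_potential f), 0) (toL2 l g (continuous_potential g), 0) = 0 ∧
      J.form ψ (0, toL2 l f (continuous_potential f)) (0, toL2 l g (continuous_potential g)) = 0 ∧
      J.form ψ (0, toL2 l f (continuous_potential f)) (toL2 l g (continuous_potential g), 0) =
        2 * Complex.I * pairing (toL2 l f (continuous_potential f))
          (toL2 l g (continuous_potential g)) := by
    intro f g
    obtain ⟨e1, e2, e3⟩ := h f g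
    simp only [PoissonTensor.bracket, variation_eq hl (hasVariation_psiField hl _ ψ),
      variation_eq hl (hasVariation_psiBarField hl _ ψ)] at e1 e2 e3
    refine ⟨e1, e2, ?_⟩
    rw [e3, pairing_toL2_right hl]
    congr 1
    refine integral_congr_period hl ?_
    filter_upwards [coeFn_toL2 (l := l) (continuous_potential f)] with z hz
    rw [hz]
  have hΛ : ∀ ξ, J.form ψ ξ - canonicalForm ξ = 0 → ∀ η, J.form ψ ξ η = canonicalForm ξ η :=
    fun ξ h η => sub_eq_zero.1 (DFunLike.congr_fun h η)
  have hleft : ∀ f : phaseSpace l, ∀ η,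
      J.form ψ (toL2 l f (continuous_potential f), 0) η =
        canonicalForm (toL2 l f (continuous_potential f), 0) η := fun f =>
    hΛ _ (eq_zero_of_fields hl
      (fun g => by
        rw [sub_apply, (hrel f g).1, canonicalForm_apply]
        simp [h0])
      fun g => by
        rw [sub_apply, J.skew, (hrel g f).2.2, canonicalForm_apply]
        simp [h0, pairing_comm hl (toL2 l f _)])
  have hright : ∀ f : phaseSpace l, ∀ η,
      J.form ψ (0, toL2 l f (continuous_potential f)) η =
        canonicalForm (0, toL2 l f (continuous_potential f)) η := fun f =>
    hΛ _ (eq_zero_of_fields hl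
      (fun g => by
        rw [sub_apply, (hrel f g).2.2, canonicalForm_apply]
        simp)
      fun g => by
        rw [sub_apply, (hrel f g).2.1, canonicalForm_apply]
        simp [h0])
  refine hΛ ξ (eq_zero_of_fields hl (fun f => ?_) fun f => ?_) η
  · rw [sub_apply, J.skew, hleft, ← canonicalForm_skew hl, sub_self]
  · rw [sub_apply, J.skew, hright, ← canonicalForm_skew hl, sub_self]

theorem canonicalRelations_of_isNLSBracketAt (hl : 0 < l) {J : PoissonTensor l} {ψ : phaseSpace l}
    (h : IsNLSBracketAt J ψ) : CanonicalRelations J ψ := by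
  have h0 : ∀ b : L2 l, pairing (0 : L2 l) b = 0 := fun b => by
    rw [pairing_comm hl, map_zero]
  intro f g
  have hp := fun f => hasVariation_psiField hl f ψ
  have hb := fun f => hasVariation_psiBarField hl f ψ
  refine ⟨?_, ?_, ?_⟩
  · rw [h _ _ ⟨_, hp f⟩ ⟨_, hp g⟩, nlsBracket_eq hl, variation_eq hl (hp f), variation_eq hl (hp g),
      canonicalForm_apply]
    simp [h0]
  · rw [h _ _ ⟨_, hb f⟩ ⟨_, hb g⟩, nlsBracket_eq hl, variation_eq hl (hb f), variation_eq hl (hb g),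
      canonicalForm_apply]
    simp [h0]
  · rw [h _ _ ⟨_, hb f⟩ ⟨_, hp g⟩, nlsBracket_eq hl, variation_eq hl (hb f), variation_eq hl (hp g),
      canonicalForm_apply]
    simp only [map_zero, sub_zero]
    rw [pairing_toL2_right hl]
    congr 1
    refine integral_congr_period hl ?_
    filter_upwards [coeFn_toL2 (l := l) (continuous_potential f)] with z hz
    rw [hz]

theorem canonicalRelations_iff_isNLSBracketAt (hl : 0 < l) (J : PoissonTensor l)
    (ψ : phaseSpace l) : CanonicalRelations J ψ ↔ IsNLSBracketAt J ψ :=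
  ⟨fun h => isNLSBracketAt_of_form_eq hl (form_eq_of_canonicalRelations hl h),
    canonicalRelations_of_isNLSBracketAt hl⟩

/-! ### Variational derivatives of the Weyl function -/

/-- The Weyl function is the slope of the eigenvector. -/
theorem weyl_spec {ψ : ℝ → ℂ} {lam w : ℂ} (h01 : transition ψ l (-l) lam 0 1 ≠ 0)
    (hdet : (transition ψ l (-l) lam - w • (1 : Matrix (Fin 2) (Fin 2) ℂ)).det = 0) :
    transition ψ l (-l) lam 0 0 + transition ψ l (-l) lam 0 1 * weyl l ψ (-l) lam w = w ∧
      transition ψ l (-l) lam 1 0 + transition ψ l (-l) lam 1 1 * weyl l ψ (-l) lam w =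
        w * weyl l ψ (-l) lam w := by
  have hex : ∃ e, IsFloquetVector l ψ (-l) lam w e := by
    obtain ⟨e, he, hM⟩ := Matrix.exists_mulVec_eq_zero_iff.2 hdet
    refine ⟨e, he, ?_⟩
    rw [monodromy_apply]
    rw [Matrix.sub_mulVec, Matrix.smul_mulVec, Matrix.one_mulVec, sub_eq_zero] at hM
    exact hM
  rw [weyl, dif_pos hex]
  obtain ⟨hne, he⟩ := hex.choose_spec
  set e := hex.choose
  rw [monodromy_apply] at he
  have e0 := congrFun he 0
  have e1 := congrFun he 1
  simp only [Matrix.mulVec, dotProduct, Fin.sum_univ_two, Pi.smul_apply, smul_eq_mul] at e0 e1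
  have h0 : e 0 ≠ 0 := by
    intro h
    rw [h, mul_zero, mul_zero, zero_add, mul_eq_zero] at e0
    refine hne (funext fun i => ?_)
    fin_cases i
    · exact h
    · exact e0.resolve_left h01
  constructor
  · field_simp
    linear_combination e0
  · field_simp
    linear_combination e1

theorem not_isWeylPole {ψ : ℝ → ℂ} {lam w : ℂ} (h01 : transition ψ l (-l) lam 0 1 ≠ 0) :
    ¬ IsWeylPole l ψ (-l) (lam, w) := by
  rintro ⟨e, ⟨hne, he⟩, h0⟩
  rw [monodromy_apply] at he
  have e0 := congrFun he 0
  simp only [Matrix.mulVec, dotProduct, Fin.sum_univ_two, Pi.smul_apply, smul_eq_mul, h0, mul_zero,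
    zero_add, mul_eq_zero] at e0
  refine hne (funext fun i => ?_)
  fin_cases i
  · exact h0
  · exact e0.resolve_left h01

theorem sub_inv_ne_zero {w : ℂ} (hw : w ≠ 0) (hw2 : w ^ 2 ≠ 1) : w - w⁻¹ ≠ 0 := by
  intro h
  apply hw2
  rw [sub_eq_zero] at h
  rw [sq]
  nth_rewrite 2 [h]
  exact mul_inv_cancel₀ hw

theorem floquetBranch_root {w : ℂ} (hw : w ≠ 0) (hw2 : w ^ 2 ≠ 1) (Δ : ℂ) :
    floquetBranch w Δ ^ 2 - 2 * Δ * floquetBranch w Δ + 1 = 0 := by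
  have hd := sub_inv_ne_zero hw hw2
  have h1 := Complex.cpow_nat_inv_pow ((Δ ^ 2 - 1) / ((w - w⁻¹) / 2) ^ 2) (n := 2) two_ne_zero
  have e : (((2 : ℕ) : ℂ)⁻¹) = 1 / 2 := by norm_num
  rw [e] at h1
  have h2 : ((w - w⁻¹) / 2) ^ 2 * ((Δ ^ 2 - 1) / ((w - w⁻¹) / 2) ^ 2) = Δ ^ 2 - 1 := by
    field_simp
  rw [floquetBranch]
  linear_combination ((w - w⁻¹) / 2) ^ 2 * h1 + h2

theorem floquetBranch_self {w : ℂ} (hw : w ≠ 0) (hw2 : w ^ 2 ≠ 1) :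
    ((((w + w⁻¹) / 2) ^ 2 - 1) / ((w - w⁻¹) / 2) ^ 2 = 1) ∧
      floquetBranch w ((w + w⁻¹) / 2) = w := by
  have hd := sub_inv_ne_zero hw hw2
  have e : ((w + w⁻¹) / 2) ^ 2 - 1 = ((w - w⁻¹) / 2) ^ 2 := by
    have := mul_inv_cancel₀ hw
    linear_combination this
  have h1 : (((w + w⁻¹) / 2) ^ 2 - 1) / ((w - w⁻¹) / 2) ^ 2 = 1 := by
    rw [e]
    exact div_self (pow_ne_zero 2 (div_ne_zero hd two_ne_zero))
  refine ⟨h1, ?_⟩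
  rw [floquetBranch, h1, Complex.one_cpow]
  ring

/-- At the base point the radicand equals 1, which is away from the cut of the principal power. -/
theorem differentiableAt_floquetBranch {w : ℂ} (hw : w ≠ 0) (hw2 : w ^ 2 ≠ 1) :
    DifferentiableAt ℂ (floquetBranch w) ((w + w⁻¹) / 2) := by
  have h1 : DifferentiableAt ℂ (fun Δ : ℂ => (Δ ^ 2 - 1) / ((w - w⁻¹) / 2) ^ 2) ((w + w⁻¹) / 2) := by
    fun_prop
  have h2 := h1.cpow_const (c := 1 / 2) (by
    rw [(floquetBranch_self hw hw2).1]
    exact Complex.one_mem_slitPlane)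
  exact differentiableAt_id.add (h2.const_mul _)

/-- The parameter s is complex and multiplies both φ and its conjugate without being conjugated.
This keeps the family holomorphic in s, and for real s it is the family of potentials ψ + sφ. -/
theorem exists_isSolFamily_potential (hl : 0 < l) (ψ φ : phaseSpace l) (lam : ℂ) (y : ℝ) (α β : ℂ) :
    ∃ K U V, IsSolFamily (fun _ => -(Complex.I * lam / 2)) (fun z => conj ((ψ : ℝ → ℂ) z)) ψ
      (fun _ => 0) (fun z => conj ((φ : ℝ → ℂ) z)) φ K y α β U V := by
  obtain ⟨K₁, hK₁, h1⟩ := exists_bound_potential hl ψ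
  obtain ⟨K₂, hK₂, h2⟩ := exists_bound_potential hl φ
  have hn := norm_nonneg (-(Complex.I * lam / 2))
  set K := ‖-(Complex.I * lam / 2)‖ + K₁ + K₂ with hK
  have cψ := continuous_potential ψ
  have cφ := continuous_potential φ
  have cψ' := continuous_conj_potential ψ
  have cφ' := continuous_conj_potential φ
  have hb : ∀ z, ‖-(Complex.I * lam / 2)‖ ≤ K ∧ ‖conj ((ψ : ℝ → ℂ) z)‖ ≤ K ∧
      ‖(ψ : ℝ → ℂ) z‖ ≤ K := fun z => by
    have := h1 z
    rw [RCLike.norm_conj]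
    exact ⟨by linarith, by linarith, by linarith⟩
  have hb' : ∀ z, ‖(0 : ℂ)‖ ≤ K ∧ ‖conj ((φ : ℝ → ℂ) z)‖ ≤ K ∧ ‖(φ : ℝ → ℂ) z‖ ≤ K := fun z => by
    have := h2 z
    rw [RCLike.norm_conj, norm_zero]
    exact ⟨by linarith, by linarith, by linarith⟩
  have hex : ∀ s : ℂ, ∃ u v, IsSol (fun _ => -(Complex.I * lam / 2) + s * 0)
      (fun z => conj ((ψ : ℝ → ℂ) z) + s * conj ((φ : ℝ → ℂ) z))
      (fun z => (ψ : ℝ → ℂ) z + s * (φ : ℝ → ℂ) z) u v ∧ u y = α ∧ v y = β := fun s => by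
    have haux : ∀ x x' : ℂ, ‖x‖ ≤ K → ‖x'‖ ≤ K → ‖x + s * x'‖ ≤ K + ‖s‖ * K := fun x x' hx hx' => by
      refine (norm_add_le _ _).trans ?_
      rw [norm_mul]
      gcongr
    exact exists_isSol (K := K + ‖s‖ * K) continuous_const
      (cψ'.add (continuous_const.mul cφ')) (cψ.add (continuous_const.mul cφ))
      (fun z => ⟨haux _ _ (hb z).1 (hb' z).1, haux _ _ (hb z).2.1 (hb' z).2.1,
        haux _ _ (hb z).2.2 (hb' z).2.2⟩) y α β
  choose U V hUV using hex
  exact ⟨K, U, V, ⟨continuous_const, cψ', cψ⟩, ⟨continuous_const, cφ', cφ⟩, hb, hb',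
    fun s => (hUV s).1, fun s => (hUV s).2.1, fun s => (hUV s).2.2⟩

theorem IsSolFamily.eq_transition (hl : 0 < l) {ψ φ : phaseSpace l} {lam α β : ℂ} {K y : ℝ}
    {U V : ℂ → ℝ → ℂ}
    (h : IsSolFamily (fun _ => -(Complex.I * lam / 2)) (fun z => conj ((ψ : ℝ → ℂ) z)) ψ
      (fun _ => 0) (fun z => conj ((φ : ℝ → ℂ) z)) φ K y α β U V) (t z : ℝ) :
    U t z = α * transition (ψ + (t : ℂ) • φ : phaseSpace l) z y lam 0 0 +
        β * transition (ψ + (t : ℂ) • φ : phaseSpace l) z y lam 0 1 ∧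
      V t z = α * transition (ψ + (t : ℂ) • φ : phaseSpace l) z y lam 1 0 +
        β * transition (ψ + (t : ℂ) • φ : phaseSpace l) z y lam 1 1 := by
  obtain ⟨C, -, hC⟩ := exists_bound_potential hl (ψ + (t : ℂ) • φ)
  have hsol : IsLaxSol (ψ + (t : ℂ) • φ : phaseSpace l) lam (U t) (V t) := by
    have h1 := h.isSol t
    constructor
    · intro z
      refine (h1.left z).congr_deriv ?_
      simp
    · intro z
      refine (h1.right z).congr_deriv ?_
      simp
  have := hsol.eq_transition (continuous_potential _) hC y z
  rwa [h.left_eq, h.right_eq] at this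

/-- The covector of a squared Floquet solution with multiplier `w`. -/
def squareCovector (l : ℝ) (w : ℂ) (u v : ℝ → ℂ) (hu : Continuous u) (hv : Continuous v) :
    Covector l :=
  (w ^ 2 - 1)⁻¹ • (toL2 l (fun z => u z ^ 2) (hu.pow 2), -toL2 l (fun z => v z ^ 2) (hv.pow 2))

theorem weyl_eq_of_isFloquetSol {ψ : phaseSpace l} (hl : 0 < l) {lam w : ℂ} {u v : ℝ → ℂ}
    (h01 : transition ψ l (-l) lam 0 1 ≠ 0) (h : IsFloquetSol ψ (-l) l lam w u v)
    (hu : u (-l) = 1) : weyl l ψ (-l) lam w = v (-l) := by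
  obtain ⟨K, -, hK⟩ := exists_bound_potential hl ψ
  have hc := continuous_potential ψ
  have h1 := (weyl_spec h01 (h.det_eq_zero hc hK)).1
  have h2 := (h.isSol.eq_transition hc hK (-l) l).1
  rw [h.left, hu] at h2
  refine mul_left_cancel₀ h01 ?_
  linear_combination h1 + h2

/-- Let (U, V) solve the perturbed system with the unperturbed initial slope X. The perturbed
eigenvector equation expresses the change of slope as the Wronskian of (u, v) and (U, V) at l,
divided by a factor G with G(0) = w² − 1. That Wronskian vanishes at t = 0, so only its derivative ∫
(u²φ − v²φ̄) contributes. -/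
theorem hasVariation_weylFunctional (hl : 0 < l) {ψ : phaseSpace l} {lam w : ℂ} {u v : ℝ → ℂ}
    (h01 : transition ψ l (-l) lam 0 1 ≠ 0) (hw2 : w ^ 2 ≠ 1) (h : IsFloquetSol ψ (-l) l lam w u v)
    (hu : u (-l) = 1) :
    HasVariation (weylFunctional l (-l) (lam, w)) ψ
      (squareCovector l w u v h.isSol.continuous_left h.isSol.continuous_right) := by
  intro φ
  obtain ⟨K, -, hK⟩ := exists_bound_potential hl ψ
  have hc := continuous_potential ψ
  have hw := h.multiplier_ne_zero hc hK
  obtain ⟨K₁, U₁, V₁, f1⟩ := exists_isSolFamily_potential hl ψ φ lam (-l) 1 0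
  obtain ⟨K₂, U₂, V₂, f2⟩ := exists_isSolFamily_potential hl ψ φ lam (-l) 0 1
  obtain ⟨K₃, U₃, V₃, f3⟩ := exists_isSolFamily_potential hl ψ φ lam (-l) 1 (v (-l))
  set X := v (-l) with hX
  set m : ℝ → Matrix (Fin 2) (Fin 2) ℂ := fun t =>
    transition (ψ + (t : ℂ) • φ : phaseSpace l) l (-l) lam with hm
  have em0 : m 0 = transition ψ l (-l) lam := by simp [hm]
  have m00 : ∀ t : ℝ, U₁ t l = m t 0 0 := fun t => by
    rw [(f1.eq_transition hl t l).1, one_mul, zero_mul, add_zero]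
  have m10 : ∀ t : ℝ, V₁ t l = m t 1 0 := fun t => by
    rw [(f1.eq_transition hl t l).2, one_mul, zero_mul, add_zero]
  have m01 : ∀ t : ℝ, U₂ t l = m t 0 1 := fun t => by
    rw [(f2.eq_transition hl t l).1, zero_mul, one_mul, zero_add]
  have m11 : ∀ t : ℝ, V₂ t l = m t 1 1 := fun t => by
    rw [(f2.eq_transition hl t l).2, zero_mul, one_mul, zero_add]
  have hreal : ∀ F : ℂ → ℂ, DifferentiableAt ℂ F 0 → DifferentiableAt ℝ (fun t : ℝ => F t) 0 :=
    fun F hF => by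
      have h1 : HasDerivAt F (deriv F 0) ((0 : ℝ) : ℂ) := by simpa using hF.hasDerivAt
      exact h1.comp_ofReal.differentiableAt
  have d00 : DifferentiableAt ℝ (fun t => m t 0 0) 0 := by
    simpa only [m00] using hreal _ (f1.differentiableAt l).1
  have d01 : DifferentiableAt ℝ (fun t => m t 0 1) 0 := by
    simpa only [m01] using hreal _ (f2.differentiableAt l).1
  have d11 : DifferentiableAt ℝ (fun t => m t 1 1) 0 := by
    simpa only [m11] using hreal _ (f2.differentiableAt l).2
  -- the multiplier
  set Δ : ℝ → ℂ := fun t => (m t 0 0 + m t 1 1) / 2 with hΔ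
  have hdisc : ∀ t : ℝ, discriminant l (ψ + (t : ℂ) • φ : phaseSpace l) lam = Δ t := fun t => by
    rw [discriminant, monodromy_apply, Matrix.trace_fin_two]
  have hroot := h.det_eq_zero hc hK
  have hchar := hroot
  rw [det_sub_smul_eq hc hK, Matrix.trace_fin_two, ← em0] at hchar
  have hΔ0 : Δ 0 = (w + w⁻¹) / 2 := by
    have : Δ 0 * (2 * w) = (w + w⁻¹) / 2 * (2 * w) := by
      simp only [hΔ]
      have := mul_inv_cancel₀ hw
      linear_combination -hchar - this
    exact mul_right_cancel₀ (mul_ne_zero two_ne_zero hw) this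
  have dΔ : DifferentiableAt ℝ Δ 0 := (d00.add d11).div_const 2
  set W : ℝ → ℂ := fun t => floquetBranch w (Δ t) with hW
  have hW0 : W 0 = w := by
    simp only [hW]
    rw [hΔ0, (floquetBranch_self hw hw2).2]
  have dW : DifferentiableAt ℝ W 0 := by
    have h1 : DifferentiableAt ℝ (floquetBranch w) (Δ 0) := by
      rw [hΔ0]
      exact (differentiableAt_floquetBranch hw hw2).restrictScalars ℝ
    exact DifferentiableAt.comp (0 : ℝ) h1 dΔ
  -- the slope
  set Y : ℝ → ℂ := fun t => weyl l (ψ + (t : ℂ) • φ : phaseSpace l) (-l) lam (W t) with hY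
  have hY0 : Y 0 = X := by
    simp only [hY, hW0]
    simpa using weyl_eq_of_isFloquetSol hl h01 h hu
  have hspec : ∀ᶠ t in nhds (0 : ℝ), m t 0 0 + m t 0 1 * Y t = W t ∧
      m t 1 0 + m t 1 1 * Y t = W t * Y t := by
    have h1 : ∀ᶠ t in nhds (0 : ℝ), m t 0 1 ≠ 0 :=
      d01.continuousAt.eventually_ne (by rw [em0]; exact h01)
    filter_upwards [h1] with t ht
    obtain ⟨C, -, hC⟩ := exists_bound_potential hl (ψ + (t : ℂ) • φ)
    refine weyl_spec ht ?_
    rw [det_sub_smul_eq (continuous_potential _) hC, Matrix.trace_fin_two]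
    have := floquetBranch_root hw hw2 (Δ t)
    simp only [hW]
    linear_combination this
  have hfun : (fun t : ℝ => weylFunctional l (-l) (lam, w) (ψ + (t : ℂ) • φ)) = Y := by
    ext t
    simp only [weylFunctional, hY, hW, hdisc]
  rw [hfun]
  -- the Wronskian
  have hwr := f3.hasDerivAt_wronskian h.isSol l
  have hu0 : U₃ 0 = u ∧ V₃ 0 = v := by
    constructor
    · ext z
      have e1 := (h.isSol.eq_transition hc hK (-l) z).1
      have e2 := (f3.eq_transition hl 0 z).1
      simp at e2
      rw [e1, e2, hu]
      ring
    · ext z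
      have e1 := (h.isSol.eq_transition hc hK (-l) z).2
      have e2 := (f3.eq_transition hl 0 z).2
      simp at e2
      rw [e1, e2, hu]
      ring
  rw [hu0.1, hu0.2, h.left, h.right, hu] at hwr
  set D := ∫ t in (-l)..l, perturbForm (fun _ => 0) (fun z => conj ((φ : ℝ → ℂ) z)) φ u v u v t
  have hwr' : HasDerivAt (fun t : ℝ => w * 1 * V₃ t l - w * X * U₃ t l) D 0 := by
    have h1 : HasDerivAt (fun s => w * 1 * V₃ s l - w * X * U₃ s l) D ((0 : ℝ) : ℂ) := by
      simpa using hwr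
    exact h1.comp_ofReal
  -- This factor comes from eliminating between the two rows of the eigenvector equation, and it
  -- makes the formula for Y below exact; only its differentiability and its value at 0 matter.
  set G : ℝ → ℂ := fun t => w * (W t - m t 1 1 + X * m t 0 1) with hG
  have hG0 : G 0 = w ^ 2 - 1 := by
    have h1 := hspec.self_of_nhds.1
    rw [hW0, hY0] at h1
    simp only [hG, hW0]
    linear_combination w * h1 + hchar
  have hG0ne : G 0 ≠ 0 := by
    rw [hG0]
    exact sub_ne_zero.2 hw2
  have dG : DifferentiableAt ℝ G 0 := ((dW.sub d11).add (d01.const_mul X)).const_mul w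
  have hYeq : ∀ᶠ t in nhds (0 : ℝ), Y t = X + (w * 1 * V₃ t l - w * X * U₃ t l) / G t := by
    filter_upwards [hspec, dG.continuousAt.eventually_ne hG0ne] with t ht hGt
    have e1 := (f3.eq_transition hl t l).1
    have e2 := (f3.eq_transition hl t l).2
    rw [e1, e2, ← sub_eq_iff_eq_add', eq_div_iff hGt]
    change (Y t - X) * (w * (W t - m t 1 1 + X * m t 0 1)) =
      w * 1 * (1 * m t 1 0 + X * m t 1 1) - w * X * (1 * m t 0 0 + X * m t 0 1)
    linear_combination (-w) * ht.2 + w * X * ht.1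
  have hnum0 : w * 1 * V₃ ((0 : ℝ) : ℂ) l - w * X * U₃ ((0 : ℝ) : ℂ) l = 0 := by
    rw [Complex.ofReal_zero, hu0.1, hu0.2, h.left, h.right, hu]
    ring
  have hfinal := ((hwr'.div dG.hasDerivAt hG0ne).const_add X).congr_of_eventuallyEq hYeq
  refine hfinal.congr_deriv ?_
  rw [hnum0, zero_mul, sub_zero, hG0]
  have hne : w ^ 2 - 1 ≠ 0 := sub_ne_zero.2 hw2
  have e : D * (w ^ 2 - 1) / (w ^ 2 - 1) ^ 2 = (w ^ 2 - 1)⁻¹ * D := by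
    field_simp
  rw [e, ← intervalIntegral.integral_const_mul]
  refine (integral_congr_period hl ?_).symm
  have cu := h.isSol.continuous_left
  have cv := h.isSol.continuous_right
  filter_upwards [Lp.coeFn_smul (w ^ 2 - 1)⁻¹ (toL2 l (fun z => u z ^ 2) (cu.pow 2)),
    Lp.coeFn_smul (w ^ 2 - 1)⁻¹ (-toL2 l (fun z => v z ^ 2) (cv.pow 2)),
    Lp.coeFn_neg (toL2 l (fun z => v z ^ 2) (cv.pow 2)), coeFn_toL2 (l := l) (f := fun z => u z ^ 2) (cu.pow 2),
    coeFn_toL2 (l := l) (f := fun z => v z ^ 2) (cv.pow 2)] with z h1 h2 h3 h4 h5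
  simp only [squareCovector, Prod.smul_mk]
  rw [h1, h2]
  simp only [Pi.smul_apply, h3, Pi.neg_apply, h4, h5, perturbForm, smul_eq_mul]
  ring

/-! ### The bracket of Weyl functions -/

theorem pairing_squareCovector (hl : 0 < l) (r s : L2 l) (w : ℂ) {u v : ℝ → ℂ} (hu : Continuous u)
    (hv : Continuous v) :
    pairing r (squareCovector l w u v hu hv).1 + pairing s (squareCovector l w u v hu hv).2 =
      (w ^ 2 - 1)⁻¹ * ∫ z in (-l)..l, pairForm r s u v u v z := by
  have e : ∫ z in (-l)..l, pairForm r s u v u v z =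
      (∫ z in (-l)..l, r z * u z ^ 2) - ∫ z in (-l)..l, s z * v z ^ 2 := by
    rw [← intervalIntegral.integral_sub (intervalIntegrable_L2_mul hl r (f := fun z => u z ^ 2) (hu.pow 2))
      (intervalIntegrable_L2_mul hl s (f := fun z => v z ^ 2) (hv.pow 2))]
    refine intervalIntegral.integral_congr fun z _ => ?_
    simp only [pairForm]
    ring
  simp only [squareCovector, Prod.smul_mk, map_smul, map_neg, smul_eq_mul]
  rw [pairing_toL2_right hl, pairing_toL2_right hl, e]
  ring

/-- The canonical form on squared Floquet solutions. -/
theorem canonicalForm_squareCovector (hl : 0 < l) {ψ : phaseSpace l} {lam mu w w' : ℂ}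
    {u v u' v' : ℝ → ℂ} (h : IsFloquetSol ψ (-l) l lam w u v)
    (h' : IsFloquetSol ψ (-l) l mu w' u' v') (hu : u (-l) = 1) (hu' : u' (-l) = 1)
    (hw : w ^ 2 ≠ 1) (hw' : w' ^ 2 ≠ 1) (hne : lam ≠ mu) :
    canonicalForm (squareCovector l w u v h.isSol.continuous_left h.isSol.continuous_right)
        (squareCovector l w' u' v' h'.isSol.continuous_left h'.isSol.continuous_right) =
      -2 * ((v (-l) - v' (-l)) ^ 2 / (lam - mu)) * ((Omega (lam, w) + Omega (mu, w')) / 2) := by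
  have cu := h.isSol.continuous_left
  have cv := h.isSol.continuous_right
  have cu' := h'.isSol.continuous_left
  have cv' := h'.isSol.continuous_right
  set q := w ^ 2 - 1 with hq
  set q' := w' ^ 2 - 1 with hq'
  have hq0 : q ≠ 0 := sub_ne_zero.2 hw
  have hq0' : q' ≠ 0 := sub_ne_zero.2 hw'
  -- The systems differ only in the diagonal, so the Wronskian has derivative i(μ − λ)/2 · (uv' +
  -- vu'), and the canonical integrand is a total derivative. Over the period the Wronskian is
  -- multiplied by ww', whence the factor w²w'² − 1.
  have hd : ∀ z, HasDerivAt (fun z => (u z * v' z - v z * u' z) ^ 2)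
      (Complex.I * (mu - lam) * ((u z * v' z - v z * u' z) * (u z * v' z + v z * u' z))) z := fun z => by
    refine ((h.isSol.hasDerivAt_wronskian h'.isSol z).pow 2).congr_deriv ?_
    push_cast
    ring
  have hint := intervalIntegral.integral_eq_sub_of_hasDerivAt (a := -l) (b := l) (fun z _ => hd z)
    (Continuous.intervalIntegrable (by fun_prop) _ _)
  rw [intervalIntegral.integral_const_mul, h.left, h.right, h'.left, h'.right, hu, hu'] at hint
  set S := ∫ z in (-l)..l, (u z * v' z - v z * u' z) * (u z * v' z + v z * u' z) with hS
  have hform : canonicalForm (squareCovector l w u v cu cv) (squareCovector l w' u' v' cu' cv') =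
      2 * Complex.I * (q⁻¹ * q'⁻¹ * S) := by
    rw [canonicalForm_apply, sub_eq_add_neg]
    have e1 : -pairing (squareCovector l w u v cu cv).1 (squareCovector l w' u' v' cu' cv').2 =
        pairing (-(squareCovector l w u v cu cv).1) (squareCovector l w' u' v' cu' cv').2 := by
      rw [pairing_comm hl (-_), map_neg, pairing_comm hl]
    rw [e1, pairing_squareCovector hl, mul_comm q⁻¹, mul_assoc (q'⁻¹),
      ← intervalIntegral.integral_const_mul q⁻¹]
    congr 2
    refine integral_congr_period hl ?_
    filter_upwards [Lp.coeFn_smul (w ^ 2 - 1)⁻¹ (toL2 l (fun z => u z ^ 2) (cu.pow 2)),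
      Lp.coeFn_neg ((w ^ 2 - 1)⁻¹ • toL2 l (fun z => u z ^ 2) (cu.pow 2)),
      Lp.coeFn_smul (w ^ 2 - 1)⁻¹ (-toL2 l (fun z => v z ^ 2) (cv.pow 2)),
      Lp.coeFn_neg (toL2 l (fun z => v z ^ 2) (cv.pow 2)),
      coeFn_toL2 (l := l) (f := fun z => u z ^ 2) (cu.pow 2),
      coeFn_toL2 (l := l) (f := fun z => v z ^ 2) (cv.pow 2)] with z h1 h2 h3 h4 h5 h6
    simp only [pairForm, squareCovector, Prod.smul_mk]
    rw [h2, h3]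
    simp only [Pi.neg_apply, h1, Pi.smul_apply, h4, h5, h6, smul_eq_mul]
    ring
  rw [hform]
  have hne' : lam - mu ≠ 0 := sub_ne_zero.2 hne
  have hI := Complex.I_sq
  have hS' : Complex.I * S = -((w ^ 2 * w' ^ 2 - 1) * (v (-l) - v' (-l)) ^ 2 / (lam - mu)) := by
    rw [← neg_div, eq_div_iff hne']
    linear_combination -hint
  have hO : (Omega (lam, w) + Omega (mu, w')) / 2 = (w ^ 2 * w' ^ 2 - 1) * (q⁻¹ * q'⁻¹) := by
    simp only [Omega, ← hq, ← hq']
    field_simp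
    rw [hq, hq']
    ring
  rw [hO]
  calc _ = 2 * (q⁻¹ * q'⁻¹) * (Complex.I * S) := by ring
    _ = _ := by
      rw [hS']
      ring

/-- A Floquet solution can be normalized at the left end point. -/
theorem IsFloquetSol.exists_normalized {ψ : phaseSpace l} (hl : 0 < l) {lam w : ℂ} {u v : ℝ → ℂ}
    (h : IsFloquetSol ψ (-l) l lam w u v) (h01 : transition ψ l (-l) lam 0 1 ≠ 0) :
    ∃ c : ℂ, c ≠ 0 ∧ c * u (-l) = 1 ∧
      IsFloquetSol ψ (-l) l lam w (fun z => c * u z) (fun z => c * v z) := by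
  obtain ⟨K, -, hK⟩ := exists_bound_potential hl ψ
  have hu0 : u (-l) ≠ 0 := by
    intro h0
    have h1 := (h.isSol.eq_transition (continuous_potential ψ) hK (-l) l).1
    rw [h.left, h0, mul_zero, zero_mul, zero_add, eq_comm, mul_eq_zero] at h1
    exact (h.ne_zero (-l)).elim (fun h => h h0) fun h => h (h1.resolve_right h01)
  have hc0 : (u (-l))⁻¹ ≠ 0 := inv_ne_zero hu0
  refine ⟨(u (-l))⁻¹, hc0, inv_mul_cancel₀ hu0, ?_, ?_, ?_, fun z => ?_⟩
  · simpa using h.isSol.linear_comb h.isSol (u (-l))⁻¹ 0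
  · simp only [h.left]
    ring
  · simp only [h.right]
    ring
  · exact (h.ne_zero z).imp (mul_ne_zero hc0) (mul_ne_zero hc0)

/-- A functional on covectors that vanishes on the squared Floquet solutions vanishes. -/
theorem eq_zero_of_squareCovectors (hl : 0 < l) {ψ : phaseSpace l} (hψ : ψ ≠ 0)
    {Λ : Covector l →L[ℂ] ℂ} (mu : ℂ)
    (h : ∀ (lam w : ℂ) (u v : ℝ → ℂ) (hf : IsFloquetSol ψ (-l) l lam w u v), u (-l) = 1 → w ^ 2 ≠ 1 →
      transition ψ l (-l) lam 0 1 ≠ 0 → lam ≠ mu →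
      Λ (squareCovector l w u v hf.isSol.continuous_left hf.isSol.continuous_right) = 0) : Λ = 0 := by
  obtain ⟨K, hKpos, hK⟩ := exists_bound_potential hl ψ
  have hc := continuous_potential ψ
  obtain ⟨r, hr⟩ := exists_eq_pairing (Λ.comp (ContinuousLinearMap.inl ℂ (L2 l) (L2 l)))
  obtain ⟨s, hs⟩ := exists_eq_pairing (Λ.comp (ContinuousLinearMap.inr ℂ (L2 l) (L2 l)))
  have hΛ : ∀ ξ : Covector l, Λ ξ = pairing r ξ.1 + pairing s ξ.2 := fun ξ => by
    rw [← hr, ← hs, ContinuousLinearMap.comp_apply, ContinuousLinearMap.comp_apply, ← map_add]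
    congr 1
    ext1 <;> simp
  obtain ⟨lam₀, hlam₀⟩ := exists_monodromy_offdiag_ne_zero hl hψ
  have hentire := differentiable_transition hc hK (-l) l 0 1
  -- The excluded λ are the isolated zeros of the entire function M₁₂ and the single point `mu`.
  have hD : ∀ lam, ∀ᶠ m in nhdsWithin lam {lam}ᶜ, transition ψ l (-l) m 0 1 ≠ 0 ∧ m ≠ mu := by
    intro lam
    refine (eventually_ne_zero_of_entire hentire (fun h => hlam₀ (congrFun h lam₀)) lam).and ?_
    rcases eq_or_ne lam mu with rfl | hne
    · exact self_mem_nhdsWithin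
    · exact nhdsWithin_le_nhds (isOpen_ne.mem_nhds hne)
  obtain ⟨h1, h2⟩ := ae_eq_zero_of_orthogonal hc hK (by linarith : -l < l) (intervalIntegrable_L2 hl r)
    (intervalIntegrable_L2 hl s) hD (fun lam w u v hlam _ hw hf => by
      have hw2 : w ^ 2 ≠ 1 := fun h1 => by
        have := congrArg norm h1
        rw [norm_pow, norm_one] at this
        nlinarith [norm_nonneg w]
      obtain ⟨c, hc0, hcu, hf'⟩ := hf.exists_normalized hl hlam.1
      have := h lam w _ _ hf' hcu hw2 hlam.1 hlam.2
      rw [hΛ, pairing_squareCovector hl, mul_eq_zero] at this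
      have h0 := this.resolve_left (inv_ne_zero (sub_ne_zero.2 hw2))
      have e : ∀ z, pairForm r s (fun z => c * u z) (fun z => c * v z) (fun z => c * u z)
          (fun z => c * v z) z = c ^ 2 * pairForm r s u v u v z := fun z => by
        simp only [pairForm]
        ring
      simp only [e, intervalIntegral.integral_const_mul] at h0
      exact (mul_eq_zero.1 h0).resolve_left (pow_ne_zero 2 hc0)) hKpos
  have hr0 : r = 0 := (Lp.eq_zero_iff_ae_eq_zero).2 h1
  have hs0 : s = 0 := (Lp.eq_zero_iff_ae_eq_zero).2 h2
  refine ContinuousLinearMap.ext fun ξ => ?_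
  rw [hΛ, hr0, hs0, pairing_comm hl, pairing_comm hl 0, map_zero, map_zero, add_zero]
  rfl

/-- Only x = −l is used. For a fixed squared covector at μ, (AH) gives agreement with all those at λ
≠ μ, and completeness tolerates the missing point. A second use of completeness, after exchanging
the arguments, frees the other one. -/
theorem form_eq_of_deformedAH (hl : 0 < l) {J : PoissonTensor l} {ψ : phaseSpace l} (hψ : ψ ≠ 0)
    (hJ : DeformedAH J ψ) (ξ η : Covector l) : J.form ψ ξ η = canonicalForm ξ η := by
  obtain ⟨K, -, hK⟩ := exists_bound_potential hl ψ
  have hc := continuous_potential ψ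
  have hmem : ∀ {lam w : ℂ} {u v : ℝ → ℂ}, IsFloquetSol ψ (-l) l lam w u v →
      (lam, w) ∈ spectralCurve l ψ := fun h => by
    have := h.det_eq_zero hc hK
    rw [← monodromy_apply] at this
    exact this
  have hpair : ∀ {lam w u v mu w' u' v'} (h : IsFloquetSol ψ (-l) l lam w u v)
      (h' : IsFloquetSol ψ (-l) l mu w' u' v'), u (-l) = 1 → u' (-l) = 1 → w ^ 2 ≠ 1 → w' ^ 2 ≠ 1 →
      transition ψ l (-l) lam 0 1 ≠ 0 → transition ψ l (-l) mu 0 1 ≠ 0 → lam ≠ mu →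
      J.form ψ (squareCovector l w u v h.isSol.continuous_left h.isSol.continuous_right)
        (squareCovector l w' u' v' h'.isSol.continuous_left h'.isSol.continuous_right) =
      canonicalForm (squareCovector l w u v h.isSol.continuous_left h.isSol.continuous_right)
        (squareCovector l w' u' v' h'.isSol.continuous_left h'.isSol.continuous_right) := by
    intro lam w u v mu w' u' v' h h' hu hu' hw hw' hM hM' hne
    have := hJ (-l) (lam, w) (hmem h) (mu, w') (hmem h') hw hw' (not_isWeylPole hM)
      (not_isWeylPole hM') hne
    rw [PoissonTensor.bracket, variation_eq hl (hasVariation_weylFunctional hl hM hw h hu),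
      variation_eq hl (hasVariation_weylFunctional hl hM' hw' h' hu'),
      weyl_eq_of_isFloquetSol hl hM h hu, weyl_eq_of_isFloquetSol hl hM' h' hu'] at this
    rw [this, canonicalForm_squareCovector hl h h' hu hu' hw hw' hne]
  have hsquare : ∀ (mu w' : ℂ) (u' v' : ℝ → ℂ) (h' : IsFloquetSol ψ (-l) l mu w' u' v'),
      u' (-l) = 1 → w' ^ 2 ≠ 1 → transition ψ l (-l) mu 0 1 ≠ 0 →
      J.form ψ (squareCovector l w' u' v' h'.isSol.continuous_left h'.isSol.continuous_right) -
        canonicalForm (squareCovector l w' u' v' h'.isSol.continuous_left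
          h'.isSol.continuous_right) = 0 := fun mu w' u' v' h' hu' hw' hM' =>
    eq_zero_of_squareCovectors hl hψ mu fun lam w u v h hu hw hM hne => by
      rw [sub_apply, hpair h' h hu' hu hw' hw hM' hM hne.symm, sub_self]
  have hall : J.form ψ ξ - canonicalForm ξ = 0 :=
    -- No point has to be excluded in this argument; `Complex.I` is an arbitrary choice for the
    -- excluded one.
    eq_zero_of_squareCovectors hl hψ Complex.I fun mu w' u' v' h' hu' hw' hM' _ => by
      have := DFunLike.congr_fun (hsquare mu w' u' v' h' hu' hw' hM') ξ
      rw [sub_apply, zero_apply, sub_eq_zero] at this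
      rw [sub_apply, J.skew, this, ← canonicalForm_skew hl, sub_self]
  exact sub_eq_zero.1 (DFunLike.congr_fun hall η)

theorem canonicalRelations_of_deformedAH (hl : 0 < l) {J : PoissonTensor l} {ψ : phaseSpace l}
    (hψ : ψ ≠ 0) (hJ : DeformedAH J ψ) : CanonicalRelations J ψ :=
  canonicalRelations_of_isNLSBracketAt hl
    (isNLSBracketAt_of_form_eq hl (form_eq_of_deformedAH hl hψ hJ))

/-- At the zero potential the bracket is found by continuity. -/
theorem form_zero_eq_of_deformedAH (hl : 0 < l) {J : PoissonTensor l}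
    (hJ : ∀ ψ : phaseSpace l, DeformedAH J ψ) (ξ η : Covector l) :
    J.form 0 ξ η = canonicalForm ξ η := by
  -- Any nonzero direction would serve; along it the form is canonical for t ≠ 0, and continuity
  -- along the line carries this to t = 0.
  let φ : phaseSpace l := ⟨fun _ => 1, contDiff_const, fun _ => rfl⟩
  have hφ : ∀ t : ℝ, t ≠ 0 → (0 : phaseSpace l) + (t : ℂ) • φ ≠ 0 := fun t ht h => by
    have := congrFun (congrArg Subtype.val h) 0
    simp [φ] at this
    exact ht this
  have hcont := (J.continuous_line 0 φ ξ η).tendsto 0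
  have hconst : Filter.Tendsto (fun t : ℝ => J.form (0 + (t : ℂ) • φ) ξ η) (nhdsWithin 0 {0}ᶜ)
      (nhds (canonicalForm ξ η)) := by
    refine tendsto_const_nhds.congr' ?_
    filter_upwards [self_mem_nhdsWithin] with t ht
    exact (form_eq_of_deformedAH hl (hφ t ht) (hJ _) ξ η).symm
  have := tendsto_nhds_unique (hcont.mono_left nhdsWithin_le_nhds) hconst
  simpa using this

end NLS

end

theorem theorem3p2 (l : ℝ) (hl : 0 < l) (J : NLS.PoissonTensor l) :
    (∀ ψ : NLS.phaseSpace l, ψ ≠ 0 → NLS.DeformedAH J ψ → NLS.CanonicalRelations J ψ) ∧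
    ((∀ ψ : NLS.phaseSpace l, NLS.DeformedAH J ψ) →
      ∀ ψ : NLS.phaseSpace l, NLS.CanonicalRelations J ψ) ∧
    (∀ ψ : NLS.phaseSpace l, NLS.CanonicalRelations J ψ ↔ NLS.IsNLSBracketAt J ψ) := by
  refine ⟨fun ψ hψ hJ => NLS.canonicalRelations_of_deformedAH hl hψ hJ, fun hJ ψ => ?_,
    NLS.canonicalRelations_iff_isNLSBracketAt hl J⟩
  rcases eq_or_ne ψ 0 with rfl | hψ
  · exact NLS.canonicalRelations_of_isNLSBracketAt hl
      (NLS.isNLSBracketAt_of_form_eq hl (NLS.form_zero_eq_of_deformedAH hl hJ))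
  · exact NLS.canonicalRelations_of_deformedAH hl hψ (hJ ψ)
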